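/- Notation: $^*$ is complex conjugation, $\sigma_2=\begin{pmatrix}0&-i\\ i&0\end{pmatrix}$, $\sigma_3=\mathrm{diag}(1,-1)$, $\mathbb C^{(+)}=\{\operatorname{Im}\lambda>0\}$. Let $J\subset\mathbb R$ be an interval with more than one point, $t_0\in J$, and let $q(x,t)$ be smooth on $[0,\infty)\times J$ with $iq_t+q_{xx}+2|q|^2q=0$, such that $q(\cdot,t_0)$ is of Schwartz type on $[0,\infty)$ (it and all its derivatives decay faster than any power of $x$). Put $Q=\begin{pmatrix}0&q\\-q^*&0\end{pmatrix}$, $U=-i\lambda\sigma_3+Q$, $V=-2i\lambda^2\sigma_3+2\lambda Q-iQ_x\sigma_3-iQ^2\sigma_3$. *Boundary condition.* Let $\kappa(\lambda)=\epsilon f(\lambda)/g(\lambda)$ with $\epsilon=\pm1$, $f(\lambda)=\prod_{j=1}^{\mathcal N}(\lambda-\beta_j)(\lambda+\beta_j^*)\prod_{\ell=1}^{\mathcal M}(\lambda-i\alpha_\ell)$, $g(\lambda)=f^*(\lambda^*)$, $\mathcal N,\mathcal M\ge0$, where $\operatorname{Re}\beta_j\ne0$, $\operatorname{Im}\beta_j<0$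 and $\alpha_\ell<0$ (so all zeros of $\kappa$ lie in the open lower half-plane). For $t\in J$ let $K_-(t;\lambda)=\mathcal L(t;\lambda)/g(\lambda)$ be a $2\times2$ matrix, the entries of $\mathcal L$ being polynomials in $\lambda$ of degree at most $2\mathcal N+\mathcal M$, with $\det K_-=\kappa$, $K_-(t;\lambda)^{-1}=K_-(t;-\lambda)$, $\kappa(-\lambda)K_-(t;\lambda)=\sigma_2K_-^*(t;\lambda^*)\sigma_2$, $\lim_{\lambda\to\infty}K_-=\mathrm{diag}(1,\epsilon)$, and $$\frac{d}{dt}K_-(t;\lambda)=V(0,t;-\lambda)K_-(t;\lambda)-K_-(t;\lambda)V(0,t;\lambda).$$ *Scattering functions.* At time $t_0$ let $T(x,y;\lambda)$ be the path-ordered exponential of $\int_y^xU$ (that is, $\partial_xT=UT$, $T|_{x=y}=I$), and put $T_\infty(\lambda)=\lim_{L\to\infty}e^{i\lambda L\sigma_3}T(L,0;\lambda)$, $T_\infty^{-1}(\lambda)=\lim_{L\to\infty}T(L,0;\lambda)^{-1}e^{-i\lambda L\sigma_3}$, $K_+(\lambda)=\mathrm{diag}(1,\kappa(\lambda))$, $$\Gamma(\lambda)=T_\infty(\lambda)\,K_-(t_0;-\lambda)\,T_\infty^{-1}(-\lambda)\,K_+(\lambda),\qquad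 A=\Gamma_{11},\quad B=\Gamma_{21}.$$ Here $B$ is considered on $\mathbb R$, while $A$ is defined by this formula for $\operatorname{Im}\lambda\ge0$ (it involves only the first row of $T_\infty(\lambda)$ and the first column of $T_\infty^{-1}(-\lambda)$, for which the limits, taken entry by entry, exist when $\operatorname{Im}\lambda\ge0$). *Zeros.* Assume that $A$ has no zeros on $\mathbb R$ and that its zeros in $\mathbb C^{(+)}$ are simple and are exactly the pairwise distinct points $r_j,\,-r_j^*$ ($1\le j\le N$, $\operatorname{Re}r_j\ne0$, $\operatorname{Im}r_j>0$) and $is_\ell$ ($1\le\ell\le M$, $s_\ell>0$); put $$\zeta(\lambda)=\prod_{j=1}^N\left[\frac{\lambda-r_j}{\lambda-r_j^*}\,\frac{\lambda+r_j^*}{\lambda+r_j}\right]\prod_{\ell=1}^M\frac{\lambda-is_\ell}{\lambda+is_\ell}.$$ *Lemma (trace identities).* $A$ is analytic in $\mathbb C^{(+)}$ and continuous on its closure, $|B|<1$ on $\mathbb R$, and for every $\lambda\in\mathbb C^{(+)}$ $$A(\lambda)=\zeta(\lambda)\exp\left[\frac1{i\pi}\int_0^\infty\frac{\lambda\log\left(1-|B(\mu)|^2\right)}{\mu^2-\lambda^2}\,d\mu\right],$$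 with an absolutely convergent integral. Moreover, as $\lambda\to\infty$ in $\mathbb C^{(+)}$, $\log A(\lambda)$ (the branch that tends to $0$) has the asymptotic expansion $$\log A(\lambda)\sim\sum_{j=0}^\infty\frac{I_{2j}}{(2i\lambda)^{2j+1}},$$ that is, for every $n\ge0$, $\log A(\lambda)-\sum_{j<n}I_{2j}(2i\lambda)^{-(2j+1)}=O(\lambda^{-(2n+1)})$, where $$I_{2j}=-\frac2\pi\int_0^\infty\log\left(1-|B(\mu)|^2\right)(2i\mu)^{2j}\,d\mu+2\sum_{\ell=1}^N\frac{(2ir_\ell^*)^{2j+1}-(2ir_\ell)^{2j+1}}{2j+1}+2\sum_{\ell=1}^M\frac{(2s_\ell)^{2j+1}}{2j+1},$$ all these integrals being absolutely convergent. -/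

import Mathlib

open scoped ComplexConjugate Topology ContDiff

noncomputable section

namespace NLSHalfLine

/-- The Pauli matrix `σ₂`. -/
def sigma2 : Matrix (Fin 2) (Fin 2) ℂ := !![0, -Complex.I; Complex.I, 0]

/-- The Pauli matrix `σ₃`. -/
def sigma3 : Matrix (Fin 2) (Fin 2) ℂ := !![1, 0; 0, -1]

/-- The off-diagonal matrix `Q` built from the value `w` of the field. -/
def potQ (w : ℂ) : Matrix (Fin 2) (Fin 2) ℂ := !![0, w; -conj w, 0]

/-- The space-part Lax matrix `U = -i z σ₃ + Q`, for the field `u` at a fixed time. -/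
def laxU (u : ℝ → ℂ) (z : ℂ) (x : ℝ) : Matrix (Fin 2) (Fin 2) ℂ :=
  (-Complex.I * z) • sigma3 + potQ (u x)

/-- The time-part Lax matrix `V = -2 i z² σ₃ + 2 z Q - i Q_x σ₃ - i Q² σ₃` at a point where the
field has the value `w` and the space derivative `wx`. -/
def laxV (w wx z : ℂ) : Matrix (Fin 2) (Fin 2) ℂ :=
  (-2 * Complex.I * z ^ 2) • sigma3 + (2 * z) • potQ w - Complex.I • (potQ wx * sigma3)
    - Complex.I • (potQ w * potQ w * sigma3)

/-- The terms of the path-ordered exponential of `∫_y^x U`: the identity, and then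
`P_{n+1}(x) = ∫_y^x U(s) P_n(s) ds`. -/
def pathTerm (u : ℝ → ℂ) (z : ℂ) (y : ℝ) : ℕ → ℝ → Matrix (Fin 2) (Fin 2) ℂ
  | 0, _ => 1
  | n + 1, x => Matrix.of fun i j => ∫ s in y..x, (laxU u z s * pathTerm u z y n s) i j

/-- The transition matrix `T(x, y; z)`, the path-ordered exponential of `∫_y^x U`. -/
def transition (u : ℝ → ℂ) (x y : ℝ) (z : ℂ) : Matrix (Fin 2) (Fin 2) ℂ :=
  Matrix.of fun i j => ∑' n : ℕ, pathTerm u z y n x i j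

/-- The diagonal matrix `exp(i w σ₃)`. -/
def expSigma3 (w : ℂ) : Matrix (Fin 2) (Fin 2) ℂ :=
  !![Complex.exp (Complex.I * w), 0; 0, Complex.exp (-Complex.I * w)]

/-- `T_∞(z) = lim_{L → ∞} exp(i z L σ₃) T(L, 0; z)`, entry by entry. All four limits exist for
real `z`; those of the first row exist for `Im z ≥ 0`, those of the second row for `Im z ≤ 0`. -/
def halfLineTransition (u : ℝ → ℂ) (z : ℂ) : Matrix (Fin 2) (Fin 2) ℂ :=
  Matrix.of fun i j =>
    Filter.limUnder Filter.atTop fun L : ℝ => (expSigma3 (z * L) * transition u L 0 z) i j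

/-- `T_∞⁻¹(z) = lim_{L → ∞} T(L, 0; z)⁻¹ exp(-i z L σ₃)`, entry by entry. All four limits exist
for real `z`; those of the first column exist for `Im z ≤ 0`, those of the second column for
`Im z ≥ 0`. -/
def halfLineTransitionInv (u : ℝ → ℂ) (z : ℂ) : Matrix (Fin 2) (Fin 2) ℂ :=
  Matrix.of fun i j =>
    Filter.limUnder Filter.atTop fun L : ℝ => ((transition u L 0 z)⁻¹ * expSigma3 (-(z * L))) i j

/-- The parameters of `κ`: the numbers `β_j` (neither real nor purely imaginary), the nonzero
real numbers `α_ℓ`, and the sign `ε`. Repetitions are allowed. -/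
structure KappaData where
  numBeta : ℕ
  numAlpha : ℕ
  beta : Fin numBeta → ℂ
  alpha : Fin numAlpha → ℝ
  eps : ℂ
  beta_re : ∀ j, (beta j).re ≠ 0
  beta_im : ∀ j, (beta j).im ≠ 0
  alpha_ne : ∀ l, alpha l ≠ 0
  eps_sign : eps = 1 ∨ eps = -1

/-- `f(z) = ∏_j (z - β_j)(z + β_j^*) ∏_ℓ (z - i α_ℓ)`. -/
def KappaData.f (k : KappaData) (z : ℂ) : ℂ :=
  (∏ j, (z - k.beta j) * (z + conj (k.beta j))) * ∏ l, (z - Complex.I * k.alpha l)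

/-- `g(z) = f^*(z^*)`. -/
def KappaData.g (k : KappaData) (z : ℂ) : ℂ := conj (k.f (conj z))

/-- `κ(z) = ε f(z) / g(z)`. -/
def KappaData.kappa (k : KappaData) (z : ℂ) : ℂ := k.eps * k.f z / k.g z

/-- The reflection matrix `K(z) = 𝓛(z) / g(z)` with polynomial numerator `𝓛`. -/
def reflK (k : KappaData) (P : Matrix (Fin 2) (Fin 2) (Polynomial ℂ)) (z : ℂ) :
    Matrix (Fin 2) (Fin 2) ℂ :=
  Matrix.of fun i j => (P i j).eval z / k.g z

/-- The reflection matrix at infinity, `K₊(z) = diag(1, κ(z))`. -/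
def reflKPlus (k : KappaData) (z : ℂ) : Matrix (Fin 2) (Fin 2) ℂ := !![1, 0; 0, k.kappa z]

/-- `𝓛(t)`, `t ∈ J`, is the numerator of a family of reflection matrices `K(t; z) = 𝓛(t; z) / g(z)`
of the hierarchy with determinant `κ`, for the boundary values `w t = q(0,t)` and
`wx t = q_x(0,t)`. -/
structure IsReflectionFamily (k : KappaData) (J : Set ℝ) (w wx : ℝ → ℂ)
    (P : ℝ → Matrix (Fin 2) (Fin 2) (Polynomial ℂ)) : Prop where
  /-- the entries of `𝓛` have degree at most `2 𝓝 + 𝓜` -/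
  natDegree_le : ∀ t ∈ J, ∀ i j, (P t i j).natDegree ≤ 2 * k.numBeta + k.numAlpha
  /-- `det K = κ` -/
  det_eq : ∀ t ∈ J, ∀ z, k.g z ≠ 0 → (reflK k (P t) z).det = k.kappa z
  /-- `K(-z) = K(z)⁻¹` -/
  mul_neg : ∀ t ∈ J, ∀ z, k.g z ≠ 0 → k.g (-z) ≠ 0 → reflK k (P t) z * reflK k (P t) (-z) = 1
  /-- `κ(-z) K(z) = σ₂ K^*(z^*) σ₂` -/
  involution : ∀ t ∈ J, ∀ z, k.g z ≠ 0 → k.g (-z) ≠ 0 → k.g (conj z) ≠ 0 →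
    k.kappa (-z) • reflK k (P t) z = sigma2 * (reflK k (P t) (conj z)).map conj * sigma2
  /-- `K(z) → diag(1, ε)` as `z → ∞` -/
  tendsto : ∀ t ∈ J, ∀ i j, Filter.Tendsto (fun z => reflK k (P t) z i j)
    (Bornology.cobounded ℂ) (𝓝 ((!![1, 0; 0, k.eps] : Matrix (Fin 2) (Fin 2) ℂ) i j))
  /-- `dK/dt = V(0,t;-z) K - K V(0,t;z)`, which encodes the boundary condition at `x = 0` -/
  evolution : ∀ t ∈ J, ∀ z, k.g z ≠ 0 → ∀ i j,
    HasDerivWithinAt (fun t' => reflK k (P t') z i j)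
      ((laxV (w t) (wx t) (-z) * reflK k (P t) z - reflK k (P t) z * laxV (w t) (wx t) z) i j) J t

/-- The half-line double-row monodromy matrix
`Γ(z) = T_∞(z) K₋(-z) T_∞⁻¹(-z) K₊(z)`, for the field `u` and the reflection matrix `K₋`
at a fixed time. -/
def monodromy (k : KappaData) (u : ℝ → ℂ) (K : ℂ → Matrix (Fin 2) (Fin 2) ℂ) (z : ℂ) :
    Matrix (Fin 2) (Fin 2) ℂ :=
  halfLineTransition u z * K (-z) * halfLineTransitionInv u (-z) * reflKPlus k z

/-- The scattering function `A`, the upper left entry of `Γ`. It involves only the first row of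
`T_∞(z)` and the first column of `T_∞⁻¹(-z)`, so that the formula is meaningful for `Im z ≥ 0`,
where it is the analytic continuation of `A` from the real axis. -/
def scatA (k : KappaData) (u : ℝ → ℂ) (K : ℂ → Matrix (Fin 2) (Fin 2) ℂ) (z : ℂ) : ℂ :=
  monodromy k u K z 0 0

/-- The reflection coefficient `B`, the lower left entry of `Γ` on the real axis. -/
def scatB (k : KappaData) (u : ℝ → ℂ) (K : ℂ → Matrix (Fin 2) (Fin 2) ℂ) (x : ℝ) : ℂ :=
  monodromy k u K (x : ℂ) 1 0

/-- `q` is smooth on `[0,∞) × J` (up to the boundary) and solves `i q_t + q_xx + 2 |q|² q = 0`. -/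
def IsNLSSolution (J : Set ℝ) (q : ℝ → ℝ → ℂ) : Prop :=
  ContDiffOn ℝ ∞ (fun p : ℝ × ℝ => q p.1 p.2) (Set.Ici 0 ×ˢ J) ∧
  ∀ x ∈ Set.Ici (0 : ℝ), ∀ t ∈ J,
    Complex.I * derivWithin (fun t' => q x t') J t
      + iteratedDerivWithin 2 (fun x' => q x' t) (Set.Ici 0) x
      + 2 * (‖q x t‖ : ℂ) ^ 2 * q x t = 0

/-- `u` and all its derivatives decay rapidly on the closed half-line `[0,∞)`. -/
def IsHalfLineSchwartz (u : ℝ → ℂ) : Prop :=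
  ContDiffOn ℝ ∞ u (Set.Ici 0) ∧
  ∀ m n : ℕ, ∃ C : ℝ, ∀ x ∈ Set.Ici (0 : ℝ), x ^ m * ‖iteratedDerivWithin n u (Set.Ici 0) x‖ ≤ C

/-- The rational function `ζ` with zeros `r_j`, `-r_j^*`, `i s_ℓ` and the conjugate poles. -/
def zetaFactor {N M : ℕ} (r : Fin N → ℂ) (s : Fin M → ℝ) (z : ℂ) : ℂ :=
  (∏ j, (z - r j) / (z - conj (r j)) * ((z + conj (r j)) / (z + r j))) *
    ∏ l, (z - Complex.I * s l) / (z + Complex.I * s l)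

/-- The coefficient `I_{2j}`. -/
def traceCoeff {N M : ℕ} (B : ℝ → ℂ) (r : Fin N → ℂ) (s : Fin M → ℝ) (j : ℕ) : ℂ :=
  -(2 / (Real.pi : ℂ)) *
      (∫ x in Set.Ioi (0 : ℝ), (Real.log (1 - ‖B x‖ ^ 2) : ℂ) * (2 * Complex.I * x) ^ (2 * j))
    + 2 * ∑ l, ((2 * Complex.I * conj (r l)) ^ (2 * j + 1) - (2 * Complex.I * r l) ^ (2 * j + 1))
        / (2 * j + 1 : ℂ)
    + 2 * ∑ l, (2 * (s l : ℂ)) ^ (2 * j + 1) / (2 * j + 1 : ℂ)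

end NLSHalfLine

end

/-! The analytic part is the classical dispersion relation. The first row of `T_∞` continues to the
upper half-plane, because the Jost vector `exp(i z x) T(x, 0; z)` has nonincreasing norm when `Im z
≥ 0` (`norm_sq_jost_le`) and its first component has derivative bounded by `|q|`. The poles of
`K₋(-z)` lie in the lower half-plane, so `A` is analytic above the real axis and continuous up to
it. On the axis `T_∞` and `K₋` are unitary; hence `|A|² + |B|² = 1` and `A(-x)` is the conjugate of
`A(x)` (`scattering_relations`). Since `A = 1 + O(1/z)`, dividing by the Blaschke product of the
zeros leaves a function with a logarithm `G = O(1/z)`, and `G` is the Cauchy integral of twice its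
real part (`eq_integral_re_of_isBigO`). That real part is even, so the integral folds onto `(0, ∞)`
(`eq_prod_mul_exp_integral`).

The delicate point is that `log(1 - |B|²)` decays faster than every power: on a half-line, boundary
terms at `x = 0` would in general leave only power decay. The boundary condition removes them. The
Riccati equation for the quotient of the components of a Lax solution has a formal solution `s` in
powers of `h = 1/z`, whose coefficients are differential polynomials in `q` and its conjugate. By
the nonlinear Schrödinger equation, the same `s` solves the Riccati equation of the time part
(`riccatiSeries_time`). The first row of `T_∞` is, to all orders, a scalar times `(1, -s)` at `x =
0` (`exists_jost_expansion`). So the upper right entry of the monodromy matrix, stripped of `κ`, is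
to all orders a scalar times `b = (1, -s(h)) K₋(-1/h) (s(-h), 1)ᵀ`. The evolution of `K₋` turns into
`h² db/dt = (-4i + O(h)) b`. As `-4i` is invertible, the coefficients of `b` vanish one after the
other at all times of `J` (`IsReflectionFamily.gauge_eq_zero`). The row of `Γ` then gives `1 - |A|²
= O(x⁻ⁿ)` for every `n`.

For the asymptotic series, the Jost expansion shows that `A` has some expansion in powers of `1/z`
throughout the closed half-plane. Its coefficients are read off along the imaginary axis, where the
integral formula expands by a geometric series with a harmless remainder (`hasExpansion_integral`);
two analytic functions of `h` agreeing to order `n` along that ray agree to order `n` near `0`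
(`HasExpansion.transfer`). Even powers cancel because the zero set is symmetric under `z ↦ -z^*`. -/

noncomputable section

namespace NLSHalfLine

/-! ### Formal solution of the space Riccati equation, and its compatibility with the time equation.
-/

section Algebra

open PowerSeries

variable {R : Type*} [CommRing R] [Algebra ℂ R]

theorem coeff_complex_smul (c : ℂ) (f : R⟦X⟧) (n : ℕ) : coeff n (c • f) = c • coeff n f := rfl

theorem C_complex_smul (c : ℂ) (a : R) : (C (c • a) : R⟦X⟧) = c • C a := by
  ext n
  rw [coeff_complex_smul, coeff_C, coeff_C]
  split_ifs <;> simp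

/-- A derivation of `R`, applied to the coefficients of a power series. -/
def coeffDeriv (d : Derivation ℂ R R) : Derivation ℂ R⟦X⟧ R⟦X⟧ :=
  Derivation.mk'
    { toFun := fun f => PowerSeries.mk fun n => d (coeff n f)
      map_add' := fun f g => by ext n; simp
      map_smul' := fun c f => by ext n; simp }
    (fun f g => by
      ext n
      simp only [LinearMap.coe_mk, AddHom.coe_mk, coeff_mk, coeff_mul, map_sum, Derivation.leibniz,
        smul_eq_mul, map_add, Finset.sum_add_distrib]
      congr 1
      exact (Finset.sum_equiv (Equiv.prodComm ℕ ℕ) (by simp [add_comm]) (fun _ _ => rfl)))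

@[simp]
theorem coeff_coeffDeriv (d : Derivation ℂ R R) (f : R⟦X⟧) (n : ℕ) :
    coeff n (coeffDeriv d f) = d (coeff n f) := by
  simp [coeffDeriv]

@[simp]
theorem coeffDeriv_C (d : Derivation ℂ R R) (a : R) :
    coeffDeriv d (C a : R⟦X⟧) = C (d a) := by
  ext n
  simp [coeff_C, apply_ite d]

@[simp]
theorem coeffDeriv_X (d : Derivation ℂ R R) : coeffDeriv d (X : R⟦X⟧) = 0 := by
  ext n
  simp [coeff_X, apply_ite d]

theorem coeffDeriv_comm {d e : Derivation ℂ R R} (h : ∀ a, d (e a) = e (d a)) (f : R⟦X⟧) :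
    coeffDeriv d (coeffDeriv e f) = coeffDeriv e (coeffDeriv d f) := by
  ext n
  simp [h]

/-- The coefficients of the formal solution of `h s' = -2 i s + h (u + v s²)`. -/
def riccatiCoeff (d : Derivation ℂ R R) (u v : R) : ℕ → R
  | 0 => 0
  | n + 1 => (Complex.I / 2) • (d (riccatiCoeff d u v n) - (if n = 0 then u else 0)
      - v * ∑ i : Fin (n + 1), riccatiCoeff d u v i * riccatiCoeff d u v (n - i))

/-- The formal solution of `h s' = -2 i s + h (u + v s²)`. -/
def riccatiSeries (d : Derivation ℂ R R) (u v : R) : R⟦X⟧ := PowerSeries.mk (riccatiCoeff d u v)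

theorem riccatiSeries_eq (d : Derivation ℂ R R) (u v : R) :
    X * coeffDeriv d (riccatiSeries d u v) =
      (-2 * Complex.I) • riccatiSeries d u v + X * (C u + C v * riccatiSeries d u v ^ 2) := by
  ext n
  cases n with
  | zero => simp [riccatiSeries, riccatiCoeff]
  | succ n =>
    rw [map_add, coeff_succ_X_mul, coeff_succ_X_mul]
    have hsq : coeff n (riccatiSeries d u v ^ 2)
        = ∑ i ∈ Finset.range (n + 1), riccatiCoeff d u v i * riccatiCoeff d u v (n - i) := by
      rw [sq, coeff_mul, ← Finset.Nat.sum_antidiagonal_eq_sum_range_succ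
        (fun i j => riccatiCoeff d u v i * riccatiCoeff d u v j)]
      simp [riccatiSeries]
    rw [map_add, coeff_C_mul, hsq, coeff_complex_smul, coeff_coeffDeriv, coeff_C, riccatiSeries,
      coeff_mk, coeff_mk]
    rw [riccatiCoeff, smul_smul, show -2 * Complex.I * (Complex.I / 2) = 1 by
      linear_combination -Complex.I_mul_I, one_smul,
      Fin.sum_univ_eq_sum_range (fun i => riccatiCoeff d u v i * riccatiCoeff d u v (n - i))]
    ring

/-- A formal solution of `h d(f) = (c + h w) f` with an invertible constant `c` vanishes. -/
theorem eq_zero_of_X_mul_coeffDeriv {d : Derivation ℂ R R} {f w : R⟦X⟧} {c : ℂ} (hc : c ≠ 0)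
    (h : X * coeffDeriv d f = c • f + X * (w * f)) : f = 0 := by
  ext n
  -- In degree `n` the two terms with a factor `X` involve only coefficients of `f` of lower degree,
  -- which vanish by induction; what remains is `c • coeff n f = 0`.
  induction n using Nat.strong_induction_on with
  | _ n ih =>
    have h1 := congrArg (coeff n) h
    suffices c • coeff n f = 0 by
      have := congrArg (fun a => c⁻¹ • a) this
      simpa [smul_smul, hc] using this
    cases n with
    | zero => simpa using h1.symm
    | succ n =>
      rw [map_add, coeff_succ_X_mul, coeff_succ_X_mul, coeff_coeffDeriv,
        ih n (Nat.lt_succ_self n), coeff_mul, map_zero, Finset.sum_eq_zero, coeff_complex_smul] at h1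
      · simpa using h1.symm
      · intro p hp
        have : p.2 ≤ n := by
          have := Finset.HasAntidiagonal.mem_antidiagonal.1 hp
          omega
        rw [ih p.2 (by omega)]
        simp

/-- The formal solution of the space Riccati equation solves the time Riccati equation, if `u` and
`v` solve the nonlinear Schrödinger system. -/
theorem riccatiSeries_time {d e : Derivation ℂ R R} (hde : ∀ a, d (e a) = e (d a)) {u v : R}
    (hu : Complex.I • e u + d (d u) + 2 * u ^ 2 * v = 0)
    (hv : -(Complex.I • e v) + d (d v) + 2 * u * v ^ 2 = 0) :
    X ^ 2 * coeffDeriv e (riccatiSeries d u v) =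
      2 * X * C u + Complex.I • (X ^ 2 * C (d u))
      + (-4 * Complex.I) • riccatiSeries d u v
      + (2 * Complex.I) • (X ^ 2 * C u * C v * riccatiSeries d u v)
      - (Complex.I • (X ^ 2 * C (d v)) - 2 * X * C v) * riccatiSeries d u v ^ 2 := by
  set S := riccatiSeries d u v
  set J : R⟦X⟧ := algebraMap ℂ R⟦X⟧ Complex.I with hJ
  have hJJ : J * J = -1 := by rw [hJ, ← map_mul, Complex.I_mul_I, map_neg, map_one]
  have hsm (f : R⟦X⟧) : Complex.I • f = J * f := Algebra.smul_def _ _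
  have hsm2 (f : R⟦X⟧) : (2 * Complex.I) • f = 2 * J * f := by
    rw [mul_smul, hsm, two_smul]; ring
  have hsm3 (f : R⟦X⟧) : (-2 * Complex.I) • f = -2 * J * f := by
    rw [neg_mul, neg_smul, hsm2]; ring
  have hsm4 (f : R⟦X⟧) : (-4 * Complex.I) • f = -4 * J * f := by
    rw [show -4 * Complex.I = 2 * (-2 * Complex.I) by ring, mul_smul, hsm3, two_smul]; ring
  have hDJ (D : Derivation ℂ R R) : coeffDeriv D J = 0 := Derivation.map_algebraMap _ _
  have hnat2 (D : Derivation ℂ R R) : coeffDeriv D (2 : R⟦X⟧) = 0 := by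
    have := Derivation.map_natCast (coeffDeriv D) 2
    simpa using this
  have hnat4 (D : Derivation ℂ R R) : coeffDeriv D (4 : R⟦X⟧) = 0 := by
    have := Derivation.map_natCast (coeffDeriv D) 4
    simpa using this
  have e1 : X * coeffDeriv d S = -2 * J * S + X * (C u + C v * S ^ 2) := by
    rw [← hsm3]; exact riccatiSeries_eq d u v
  have e2 := congrArg (coeffDeriv e) e1
  have hu' := congrArg (C : R → R⟦X⟧) hu
  have hv' := congrArg (C : R → R⟦X⟧) hv
  have hCs (a : R) : (C (Complex.I • a) : R⟦X⟧) = J * C a := by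
    rw [← hsm, C_complex_smul]
  have hC2 : (C (2 : R) : R⟦X⟧) = 2 := map_ofNat _ 2
  simp only [map_add, map_neg, map_mul, map_pow, hCs, hC2, map_zero] at hu' hv'
  simp only [map_add, map_neg, Derivation.leibniz, Derivation.leibniz_pow, hDJ, hnat2,
    coeffDeriv_X, coeffDeriv_C, smul_eq_mul, nsmul_eq_mul, mul_zero, add_zero, zero_add,
    ← coeffDeriv_comm hde] at e2
  rw [hsm, hsm2, hsm4, hsm]
  rw [← sub_eq_zero]
  -- `E` is the defect of the time equation. Differentiating it in space, and using the time
  -- derivative `e2` of the space equation, yields the homogeneous equation `X d(E) = (-2i + 2 X v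
  -- S) E`, so `E = 0`. The nonlinear Schrödinger system enters only through the multiples of `hu'`
  -- and `hv'` in the final combination.
  set E := X ^ 2 * coeffDeriv e S - (2 * X * C u + J * (X ^ 2 * C (d u)) + -4 * J * S
    + 2 * J * (X ^ 2 * C u * C v * S) - (J * (X ^ 2 * C (d v)) - 2 * X * C v) * S ^ 2) with hE
  refine eq_zero_of_X_mul_coeffDeriv (d := d) (w := 2 * C v * S) (c := -2 * Complex.I)
    (by simp) ?_
  rw [hsm3, hE]
  simp only [map_add, map_neg, map_sub, Derivation.leibniz, Derivation.leibniz_pow, hDJ,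
    hnat2, hnat4, coeffDeriv_X, coeffDeriv_C, smul_eq_mul, nsmul_eq_mul, mul_zero, add_zero, zero_add]
  push_cast
  push_cast at e2
  linear_combination X ^ 2 * e2 + (-(-4*J+2*J*X^2*C u*C v) + 2*S*(-2*X*C v+J*X^2*C (d v))) * e1
    - J * X^3 * hu' + J * X^3 * S^2 * hv'
    + (-2*X^2*C (d u) - 2*X^2*S^2*C (d v) + X^3*S^2*C (e v) + X^3*C (e u)) * hJJ

end Algebra

/-! ### Smooth functions on a set with boundary, as a differential algebra. -/

section SmoothFunctions

variable {E : Type*} [NormedAddCommGroup E] [NormedSpace ℝ E]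

/-- The algebra of the smooth complex functions on a set. -/
def smoothFunctions (S : Set E) : Subalgebra ℂ (S → ℂ) where
  carrier := {f | ∃ F : E → ℂ, ContDiffOn ℝ ∞ F S ∧ ∀ p : S, f p = F p}
  mul_mem' := by
    rintro f g ⟨F, hF, hf⟩ ⟨G, hG, hg⟩
    exact ⟨fun p => F p * G p, hF.mul hG, fun p => by simp [hf, hg]⟩
  add_mem' := by
    rintro f g ⟨F, hF, hf⟩ ⟨G, hG, hg⟩
    exact ⟨fun p => F p + G p, hF.add hG, fun p => by simp [hf, hg]⟩
  algebraMap_mem' c := ⟨fun _ => c, contDiffOn_const, fun _ => rfl⟩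

variable {S : Set E}

/-- The restriction of a smooth function to `S`. -/
def smoothMk (F : E → ℂ) (hF : ContDiffOn ℝ ∞ F S) : smoothFunctions S :=
  ⟨fun p => F p, F, hF, fun _ => rfl⟩

/-- The extension by zero of a smooth function on `S`. -/
def smoothExt (f : smoothFunctions S) : E → ℂ := Function.extend Subtype.val f.1 0

theorem smoothExt_apply (f : smoothFunctions S) (p : S) : (smoothExt f) p = f.1 p :=
  Subtype.val_injective.extend_apply _ _ _

theorem contDiffOn_smoothExt (f : smoothFunctions S) : ContDiffOn ℝ ∞ (smoothExt f) S := by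
  obtain ⟨F, hF, hf⟩ := f.2
  exact hF.congr fun p hp => by rw [smoothExt_apply f ⟨p, hp⟩, hf]

theorem smoothExt_mk {F : E → ℂ} (hF : ContDiffOn ℝ ∞ F S) {p : E} (hp : p ∈ S) :
    smoothExt (smoothMk F hF) p = F p :=
  smoothExt_apply _ ⟨p, hp⟩

theorem smoothExt_add (f g : smoothFunctions S) {p : E} (hp : p ∈ S) :
    smoothExt (f + g) p = (smoothExt f) p + (smoothExt g) p := by
  lift p to S using hp
  simp [smoothExt_apply]

theorem smoothExt_mul (f g : smoothFunctions S) {p : E} (hp : p ∈ S) :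
    smoothExt (f * g) p = (smoothExt f) p * (smoothExt g) p := by
  lift p to S using hp
  simp [smoothExt_apply]

theorem smoothExt_smul (c : ℂ) (f : smoothFunctions S) {p : E} (hp : p ∈ S) :
    smoothExt (c • f) p = c * (smoothExt f) p := by
  lift p to S using hp
  simp [smoothExt_apply]

theorem differentiableWithinAt_smoothExt (f : smoothFunctions S) {p : E} (hp : p ∈ S) :
    DifferentiableWithinAt ℝ (smoothExt f) S p :=
  ((contDiffOn_smoothExt f) p hp).differentiableWithinAt (by simp)

/-- The derivative in the direction `v`, as a derivation of the smooth functions on `S`. -/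
def dirDeriv (hS : UniqueDiffOn ℝ S) (v : E) :
    Derivation ℂ (smoothFunctions S) (smoothFunctions S) :=
  Derivation.mk'
    { toFun := fun f => smoothMk (fun p => fderivWithin ℝ (smoothExt f) S p v)
        (((contDiffOn_smoothExt f).fderivWithin hS (by simp)).clm_apply contDiffOn_const)
      map_add' := fun f g => by
        refine Subtype.ext (funext fun p => ?_)
        change fderivWithin ℝ (smoothExt (f + g)) S p v
          = fderivWithin ℝ (smoothExt f) S p v + fderivWithin ℝ (smoothExt g) S p v
        rw [fderivWithin_congr (fun q hq => smoothExt_add f g hq)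
          (smoothExt_add f g p.2), fderivWithin_fun_add (hS p p.2)
          (differentiableWithinAt_smoothExt f p.2) (differentiableWithinAt_smoothExt g p.2)]
        rfl
      map_smul' := fun c f => by
        refine Subtype.ext (funext fun p => ?_)
        change fderivWithin ℝ (smoothExt (c • f)) S p v = c * fderivWithin ℝ (smoothExt f) S p v
        rw [fderivWithin_congr (fun q hq => smoothExt_smul c f hq)
          (smoothExt_smul c f p.2), fderivWithin_const_mul (hS p p.2)
            (differentiableWithinAt_smoothExt f p.2)]
        rfl }
    (fun f g => by
      refine Subtype.ext (funext fun p => ?_)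
      change fderivWithin ℝ (smoothExt (f * g)) S p v
        = f.1 p * fderivWithin ℝ (smoothExt g) S p v + g.1 p * fderivWithin ℝ (smoothExt f) S p v
      rw [fderivWithin_congr (fun q hq => smoothExt_mul f g hq)
          (smoothExt_mul f g p.2), fderivWithin_fun_mul (hS p p.2)
          (differentiableWithinAt_smoothExt f p.2) (differentiableWithinAt_smoothExt g p.2), ← smoothExt_apply f,
          ← smoothExt_apply g]
      rfl)

theorem ext_dirDeriv (hS : UniqueDiffOn ℝ S) (v : E) (f : smoothFunctions S) {p : E} (hp : p ∈ S) :
    smoothExt (dirDeriv hS v f) p = fderivWithin ℝ (smoothExt f) S p v :=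
  smoothExt_mk _ hp

/-- Symmetry of the second derivative within `S` persists at boundary points that are limits of
interior points. This supplies the commuting derivations required by the formal computation. -/
theorem dirDeriv_comm (hS : UniqueDiffOn ℝ S) (hS' : S ⊆ closure (interior S)) (v w : E)
    (f : smoothFunctions S) :
    dirDeriv hS v (dirDeriv hS w f) = dirDeriv hS w (dirDeriv hS v f) := by
  have key (v w : E) (p : S) : (dirDeriv hS v (dirDeriv hS w f)).1 p
      = fderivWithin ℝ (fderivWithin ℝ (smoothExt f) S) S p v w := by
    have hd : DifferentiableWithinAt ℝ (fderivWithin ℝ (smoothExt f) S) S p :=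
      (((contDiffOn_smoothExt f).fderivWithin (m := ∞) hS (by simp)) p p.2).differentiableWithinAt (by simp)
    rw [← smoothExt_apply, ext_dirDeriv hS v _ p.2,
      fderivWithin_congr (fun q hq => ext_dirDeriv hS w f hq) (ext_dirDeriv hS w f p.2),
      fderivWithin_clm_apply (hS p p.2) hd (differentiableWithinAt_const w)]
    simp
  refine Subtype.ext (funext fun p => ?_)
  rw [key, key]
  exact (contDiffOn_smoothExt f p p.2).isSymmSndFDerivWithinAt
    (by rw [minSmoothness_of_isRCLikeNormedField]; exact WithTop.coe_le_coe.2 (le_top : (2 : ℕ∞) ≤ ⊤)) hS (hS' p.2) p.2 v w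

theorem hasDerivWithinAt_ext_comp (hS : UniqueDiffOn ℝ S) (v : E) (f : smoothFunctions S)
    {c : ℝ → E} {I : Set ℝ} (hc : Set.MapsTo c I S) {x : ℝ} (hx : x ∈ I)
    (hcx : HasDerivWithinAt c v I x) :
    HasDerivWithinAt (fun y => (smoothExt f) (c y)) (smoothExt (dirDeriv hS v f) (c x)) I x := by
  rw [ext_dirDeriv hS v f (hc hx)]
  exact (differentiableWithinAt_smoothExt f (hc hx)).hasFDerivWithinAt.comp_hasDerivWithinAt x hcx hc

/-- Evaluation at a point of `S`. -/
def evalAt (p : S) : smoothFunctions S →+* ℂ :=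
  (Pi.evalRingHom (fun _ : S => ℂ) p).comp (smoothFunctions S).val.toRingHom

theorem evalAt_apply (p : S) (f : smoothFunctions S) : evalAt p f = (smoothExt f) p :=
  (smoothExt_apply f p).symm

end SmoothFunctions

/-! ### Power series and polynomials depending on time. -/

section FormalTime

open PowerSeries

/-- Differentiability of a family of power series, coefficient by coefficient. -/
def HasCoeffDerivWithinAt (b : ℝ → ℂ⟦X⟧) (b' : ℂ⟦X⟧) (J : Set ℝ) (t : ℝ) : Prop :=
  ∀ n, HasDerivWithinAt (fun t => coeff n (b t)) (coeff n b') J t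

variable {b c : ℝ → ℂ⟦X⟧} {b' c' : ℂ⟦X⟧} {J : Set ℝ} {t : ℝ}

theorem HasCoeffDerivWithinAt.add (hb : HasCoeffDerivWithinAt b b' J t)
    (hc : HasCoeffDerivWithinAt c c' J t) :
    HasCoeffDerivWithinAt (fun t => b t + c t) (b' + c') J t := fun n => by
  simpa using (hb n).fun_add (hc n)

theorem HasCoeffDerivWithinAt.sub (hb : HasCoeffDerivWithinAt b b' J t)
    (hc : HasCoeffDerivWithinAt c c' J t) :
    HasCoeffDerivWithinAt (fun t => b t - c t) (b' - c') J t := fun n => by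
  simpa using (hb n).fun_sub (hc n)

theorem HasCoeffDerivWithinAt.mul (hb : HasCoeffDerivWithinAt b b' J t)
    (hc : HasCoeffDerivWithinAt c c' J t) :
    HasCoeffDerivWithinAt (fun t => b t * c t) (b' * c t + b t * c') J t := fun n => by
  simp only [coeff_mul, map_add, ← Finset.sum_add_distrib]
  exact HasDerivWithinAt.fun_sum fun p _ => (hb p.1).mul (hc p.2)

theorem HasCoeffDerivWithinAt.rescale (hb : HasCoeffDerivWithinAt b b' J t) (a : ℂ) :
    HasCoeffDerivWithinAt (fun t => PowerSeries.rescale a (b t)) (PowerSeries.rescale a b') J t :=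
  fun n => by
    simp only [coeff_rescale]
    exact (hb n).const_mul _

/-- A family of power series with `h² b' = (c + h w) b`, `c ≠ 0`, vanishes. -/
theorem eq_zero_of_X_sq_mul_hasCoeffDerivWithinAt {b b' w : ℝ → ℂ⟦X⟧} (hJ : UniqueDiffOn ℝ J)
    {c : ℂ} (hc : c ≠ 0) (hb : ∀ t ∈ J, HasCoeffDerivWithinAt b (b' t) J t)
    (h : ∀ t ∈ J, X ^ 2 * b' t = C c * b t + X * (w t * b t)) : ∀ t ∈ J, b t = 0 := by
  -- The induction must treat all times at once: the vanishing of a lower coefficient on all of `J`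
  -- is what makes its time derivative vanish.
  suffices H : ∀ n, ∀ t ∈ J, coeff n (b t) = 0 from fun t ht => by
    ext n; simpa using H n t ht
  intro n
  induction n using Nat.strong_induction_on with
  | _ n ih =>
    intro t ht
    have h1 := congrArg (coeff n) (h t ht)
    -- This coefficient is the derivative of the coefficient of degree `n - 2`, which is identically
    -- zero on `J`.
    have h2 : coeff n (X ^ 2 * b' t) = 0 := by
      rw [coeff_X_pow_mul']
      split_ifs with h2
      · have h3 : HasDerivWithinAt (fun t => coeff (n - 2) (b t)) 0 J t :=
          (hasDerivWithinAt_const t J (0 : ℂ)).congr (fun s hs => ih (n - 2) (by omega) s hs)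
            (ih (n - 2) (by omega) t ht)
        exact (hJ t ht).eq_deriv _ (hb t ht (n - 2)) h3
      · rfl
    have h3 : coeff n (X * (w t * b t)) = 0 := by
      cases n with
      | zero => simp
      | succ n =>
        rw [coeff_succ_X_mul, coeff_mul]
        refine Finset.sum_eq_zero fun p hp => ?_
        have : p.2 ≤ n := by
          have := Finset.HasAntidiagonal.mem_antidiagonal.1 hp
          omega
        rw [ih p.2 (by omega) t ht, mul_zero]
    rw [h2, map_add, h3, coeff_C_mul, add_zero] at h1
    simpa [hc] using h1.symm

/-- A family of polynomials of bounded degree whose values are differentiable has differentiable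
coefficients. -/
theorem exists_coeff_hasDerivWithinAt {p : ℝ → Polynomial ℂ} {D : ℕ}
    (hp : ∀ t ∈ J, (p t).natDegree ≤ D) (ht : t ∈ J) {d : ℕ → ℂ}
    (hd : ∀ n : ℕ, HasDerivWithinAt (fun t => (p t).eval ((n : ℂ) + 1)) (d n) J t) :
    ∃ p' : Polynomial ℂ, ∀ k, HasDerivWithinAt (fun t => (p t).coeff k) (p'.coeff k) J t := by
  set s := Finset.range (D + 1)
  set v : ℕ → ℂ := fun i => (i : ℂ) + 1
  have hv : Set.InjOn v s := fun i _ j _ h => by simpa [v] using h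
  refine ⟨Lagrange.interpolate s v d, fun k => ?_⟩
  -- Lagrange interpolation at the `D + 1` nodes `1, …, D + 1` expresses each coefficient as a fixed
  -- linear combination of values. The node `0` is avoided, since for the reflection matrix it would
  -- correspond to `z = ∞`.
  have h1 : ∀ t ∈ J, (p t).coeff k = ∑ i ∈ s, (p t).eval (v i) * (Lagrange.basis s v i).coeff k := by
    intro t ht
    have hdeg : (p t).degree < (s.card : ℕ) := by
      refine lt_of_le_of_lt Polynomial.degree_le_natDegree ?_
      rw [Finset.card_range]
      exact_mod_cast Nat.lt_succ_of_le (hp t ht)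
    conv_lhs => rw [Lagrange.eq_interpolate hv hdeg]
    rw [Lagrange.interpolate_apply, Polynomial.finsetSum_coeff]
    simp
  have h2 : (Lagrange.interpolate s v d).coeff k
      = ∑ i ∈ s, d i * (Lagrange.basis s v i).coeff k := by
    rw [Lagrange.interpolate_apply, Polynomial.finsetSum_coeff]
    simp
  rw [h2]
  exact (HasDerivWithinAt.fun_sum fun i _ => (hd i).mul_const _).congr h1 (h1 t ht)

theorem hasDerivWithinAt_eval_of_coeff {p : ℝ → Polynomial ℂ} {D : ℕ} {p' : Polynomial ℂ}
    (hp : ∀ t ∈ J, (p t).natDegree ≤ D) (ht : t ∈ J)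
    (hp' : ∀ k, HasDerivWithinAt (fun t => (p t).coeff k) (p'.coeff k) J t) (z : ℂ) :
    HasDerivWithinAt (fun t => (p t).eval z) (p'.eval z) J t := by
  have hN : ∀ t ∈ J, (p t).eval z
      = ∑ k ∈ Finset.range (max D p'.natDegree + 1), (p t).coeff k * z ^ k := fun t ht =>
    Polynomial.eval_eq_sum_range' (Nat.lt_succ_of_le ((hp t ht).trans (le_max_left _ _))) z
  rw [Polynomial.eval_eq_sum_range' (Nat.lt_succ_of_le (le_max_right D p'.natDegree)) z]
  exact (HasDerivWithinAt.fun_sum fun k _ => (hp' k).mul_const _).congr hN (hN t ht)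

end FormalTime

/-! ### The half-strip `[0, ∞) × J`, and decay in space at a fixed time. -/

section HalfStrip

open PowerSeries

theorem convex_interior_nonempty_of_ordConnected {J : Set ℝ} (hJ : J.OrdConnected)
    (hJ' : J.Nontrivial) : Convex ℝ J ∧ (interior J).Nonempty := by
  refine ⟨hJ.convex, ?_⟩
  obtain ⟨a, ha, b, hb, hab⟩ := hJ'.exists_lt
  exact (Set.nonempty_Ioo.2 hab).mono
    (interior_maximal (Set.Ioo_subset_Icc_self.trans (hJ.out ha hb)) isOpen_Ioo)

theorem uniqueDiffOn_of_ordConnected {J : Set ℝ} (hJ : J.OrdConnected) (hJ' : J.Nontrivial) :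
    UniqueDiffOn ℝ J :=
  let h := convex_interior_nonempty_of_ordConnected hJ hJ'
  uniqueDiffOn_convex h.1 h.2

theorem uniqueDiffOn_halfStrip {J : Set ℝ} (hJ : J.OrdConnected) (hJ' : J.Nontrivial) :
    UniqueDiffOn ℝ (Set.Ici (0 : ℝ) ×ˢ J) :=
  (uniqueDiffOn_Ici 0).prod (uniqueDiffOn_of_ordConnected hJ hJ')

theorem halfStrip_subset_closure_interior {J : Set ℝ} (hJ : J.OrdConnected) (hJ' : J.Nontrivial) :
    Set.Ici (0 : ℝ) ×ˢ J ⊆ closure (interior (Set.Ici (0 : ℝ) ×ˢ J)) := by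
  obtain ⟨h1, h2⟩ := convex_interior_nonempty_of_ordConnected hJ hJ'
  rw [interior_prod_eq, closure_prod_eq,
    h1.closure_interior_eq_closure_of_nonempty_interior h2, interior_Ici, closure_Ioi]
  exact Set.prod_mono le_rfl subset_closure

theorem smoothExt_dirDeriv_conj {E : Type*} [NormedAddCommGroup E] [NormedSpace ℝ E] {S : Set E}
    (hS : UniqueDiffOn ℝ S) (w : E) {f g : smoothFunctions S}
    (h : ∀ p ∈ S, smoothExt g p = conj (smoothExt f p)) :
    ∀ p ∈ S, smoothExt (dirDeriv hS w g) p = conj (smoothExt (dirDeriv hS w f) p) := by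
  intro p hp
  rw [ext_dirDeriv hS w g hp, ext_dirDeriv hS w f hp, fderivWithin_congr h (h p hp)]
  have := Complex.conjCLE.comp_fderivWithin (f := smoothExt f) (hS p hp)
  have h2 := DFunLike.congr_fun this w
  simpa [Function.comp_def] using h2

/-- A rapidly decreasing class at the time `t`: all iterated derivatives decay quadratically. -/
def DecaysAt {S : Set (ℝ × ℝ)} (d : Derivation ℂ (smoothFunctions S) (smoothFunctions S)) (t : ℝ)
    (f : smoothFunctions S) : Prop :=
  ∀ n : ℕ, ∃ C : ℝ, ∀ x ∈ Set.Ici (0 : ℝ), (1 + x ^ 2) * ‖smoothExt (d^[n] f) (x, t)‖ ≤ C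

section Decay

variable {S : Set (ℝ × ℝ)} {d : Derivation ℂ (smoothFunctions S) (smoothFunctions S)} {t : ℝ}
  {f g : smoothFunctions S}

theorem iterate_derivation_add {R : Type*} [CommRing R] [Algebra ℂ R] (d : Derivation ℂ R R)
    (n : ℕ) (f g : R) : d^[n] (f + g) = d^[n] f + d^[n] g := by
  induction n generalizing f g with
  | zero => rfl
  | succ n ih => rw [Function.iterate_succ_apply, map_add, ih]; rfl

theorem iterate_derivation_smul {R : Type*} [CommRing R] [Algebra ℂ R] (d : Derivation ℂ R R)
    (n : ℕ) (c : ℂ) (f : R) : d^[n] (c • f) = c • d^[n] f := by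
  induction n generalizing f with
  | zero => rfl
  | succ n ih => rw [Function.iterate_succ_apply, Derivation.map_smul, ih]; rfl

theorem DecaysAt.add (hS : ∀ x ∈ Set.Ici (0 : ℝ), (x, t) ∈ S) (hf : DecaysAt d t f)
    (hg : DecaysAt d t g) : DecaysAt d t (f + g) := fun n => by
  obtain ⟨C, hC⟩ := hf n
  obtain ⟨C', hC'⟩ := hg n
  refine ⟨C + C', fun x hx => ?_⟩
  rw [iterate_derivation_add, smoothExt_add _ _ (hS x hx)]
  have h1 := hC x hx
  have h2 := hC' x hx
  have h3 := mul_le_mul_of_nonneg_left (norm_add_le (smoothExt (d^[n] f) (x, t))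
    (smoothExt (d^[n] g) (x, t))) (by positivity : 0 ≤ 1 + x ^ 2)
  linarith

theorem DecaysAt.smul (hS : ∀ x ∈ Set.Ici (0 : ℝ), (x, t) ∈ S) (c : ℂ) (hf : DecaysAt d t f) :
    DecaysAt d t (c • f) := fun n => by
  obtain ⟨C, hC⟩ := hf n
  refine ⟨‖c‖ * C, fun x hx => ?_⟩
  rw [iterate_derivation_smul, smoothExt_smul _ _ (hS x hx), norm_mul]
  calc _ = ‖c‖ * ((1 + x ^ 2) * ‖smoothExt (d^[n] f) (x, t)‖) := by ring
    _ ≤ _ := mul_le_mul_of_nonneg_left (hC x hx) (norm_nonneg _)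

theorem DecaysAt.derivation (hf : DecaysAt d t f) : DecaysAt d t (d f) := fun n => hf (n + 1)

/-- Leibniz rule, by induction on the number of derivatives. The weight `1 + x²` is spent on one
factor; the other is merely bounded. -/
theorem DecaysAt.mul (hS : ∀ x ∈ Set.Ici (0 : ℝ), (x, t) ∈ S) (hf : DecaysAt d t f)
    (hg : DecaysAt d t g) : DecaysAt d t (f * g) := fun n => by
  induction n generalizing f g with
  | zero =>
    obtain ⟨C, hC⟩ := hf 0
    obtain ⟨C', hC'⟩ := hg 0
    refine ⟨C * C', fun x hx => ?_⟩
    rw [Function.iterate_zero_apply, smoothExt_mul _ _ (hS x hx), norm_mul]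
    have h1 := hC x hx
    have h2 := hC' x hx
    rw [Function.iterate_zero_apply] at h1 h2
    have h3 : ‖smoothExt g (x, t)‖ ≤ (1 + x ^ 2) * ‖smoothExt g (x, t)‖ :=
      le_mul_of_one_le_left (norm_nonneg _) (by nlinarith [sq_nonneg x])
    rw [← mul_assoc]
    exact mul_le_mul h1 (h3.trans h2) (norm_nonneg _) (le_trans (by positivity) h1)
  | succ n ih =>
    obtain ⟨C, hC⟩ := ih hf hg.derivation
    obtain ⟨C', hC'⟩ := ih hg hf.derivation
    refine ⟨C + C', fun x hx => ?_⟩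
    rw [Function.iterate_succ_apply, Derivation.leibniz, iterate_derivation_add,
      smoothExt_add _ _ (hS x hx), smul_eq_mul, smul_eq_mul]
    have h1 := hC x hx
    have h2 := hC' x hx
    have h3 := mul_le_mul_of_nonneg_left (norm_add_le (smoothExt (d^[n] (f * d g)) (x, t))
      (smoothExt (d^[n] (g * d f)) (x, t))) (by positivity : 0 ≤ 1 + x ^ 2)
    linarith

theorem DecaysAt.sum (hS : ∀ x ∈ Set.Ici (0 : ℝ), (x, t) ∈ S) {ι : Type*} (s : Finset ι)
    {F : ι → smoothFunctions S} (hF : ∀ i ∈ s, DecaysAt d t (F i)) :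
    DecaysAt d t (∑ i ∈ s, F i) := by
  classical
  induction s using Finset.induction_on with
  | empty =>
    rw [Finset.sum_empty]
    exact fun n => ⟨0, fun x hx => by
      have : d^[n] 0 = 0 := by
        induction n with
        | zero => rfl
        | succ n ih => rw [Function.iterate_succ_apply, map_zero, ih]
      have h2 := smoothExt_smul (0 : ℂ) (0 : smoothFunctions S) (hS x hx)
      rw [zero_smul, zero_mul] at h2
      rw [this, h2]
      simp⟩
  | insert a s ha ih =>
    rw [Finset.sum_insert ha]
    exact (hF a (Finset.mem_insert_self _ _)).add hS
      (ih fun i hi => hF i (Finset.mem_insert_of_mem hi))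

/-- The coefficients are polynomials without constant term in `f`, `g` and their derivatives.
Quadratic decay is all that is needed later, for integrability over the half-line. -/
theorem DecaysAt.riccatiCoeff (hS : ∀ x ∈ Set.Ici (0 : ℝ), (x, t) ∈ S) (hf : DecaysAt d t f)
    (hg : DecaysAt d t g) (n : ℕ) : DecaysAt d t (riccatiCoeff d f g n) := by
  have h0 : DecaysAt d t 0 := by simpa using DecaysAt.sum (d := d) hS (∅ : Finset ℕ) (F := fun _ => 0)
  induction n using Nat.strong_induction_on with
  | _ n ih =>
    cases n with
    | zero => rw [NLSHalfLine.riccatiCoeff]; exact h0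
    | succ n =>
      rw [NLSHalfLine.riccatiCoeff]
      have hneg {a b : smoothFunctions S} (ha : DecaysAt d t a) (hb : DecaysAt d t b) :
          DecaysAt d t (a - b) := by
        have := ha.add hS (hb.smul hS (-1))
        rwa [neg_one_smul, ← sub_eq_add_neg] at this
      refine DecaysAt.smul hS _ (hneg (hneg (ih n n.lt_succ_self).derivation ?_) (hg.mul hS ?_))
      · split_ifs
        exacts [hf, h0]
      · exact DecaysAt.sum hS _ fun i _ => (ih i (by omega)).mul hS (ih (n - i) (by omega))

end Decay

end HalfStrip

/-! ### The field and its conjugate in the algebra of smooth functions. -/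

section NLS

open PowerSeries

variable {J : Set ℝ} {q : ℝ → ℝ → ℂ}

theorem hasDerivWithinAt_smoothExt_space
    (hS : UniqueDiffOn ℝ (Set.Ici (0 : ℝ) ×ˢ J)) (f : smoothFunctions (Set.Ici (0 : ℝ) ×ˢ J))
    {x t : ℝ} (hx : x ∈ Set.Ici (0 : ℝ)) (ht : t ∈ J) :
    HasDerivWithinAt (fun y => smoothExt f (y, t)) (smoothExt (dirDeriv hS (1, 0) f) (x, t))
      (Set.Ici 0) x :=
  hasDerivWithinAt_ext_comp hS (1, 0) f (c := fun y => (y, t)) (fun _ hy => ⟨hy, ht⟩) hx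
    ((hasDerivWithinAt_id x _).prodMk (hasDerivWithinAt_const x _ t))

theorem hasDerivWithinAt_smoothExt_time
    (hS : UniqueDiffOn ℝ (Set.Ici (0 : ℝ) ×ˢ J)) (f : smoothFunctions (Set.Ici (0 : ℝ) ×ˢ J))
    {x t : ℝ} (hx : x ∈ Set.Ici (0 : ℝ)) (ht : t ∈ J) :
    HasDerivWithinAt (fun s => smoothExt f (x, s)) (smoothExt (dirDeriv hS (0, 1) f) (x, t)) J t :=
  hasDerivWithinAt_ext_comp hS (0, 1) f (c := fun s => (x, s)) (fun _ hs => ⟨hx, hs⟩) ht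
    ((hasDerivWithinAt_const t _ x).prodMk (hasDerivWithinAt_id t _))

theorem iteratedDerivWithin_smoothExt (hS : UniqueDiffOn ℝ (Set.Ici (0 : ℝ) ×ˢ J))
    (f : smoothFunctions (Set.Ici (0 : ℝ) ×ˢ J)) {g : ℝ → ℂ} {t : ℝ} (ht : t ∈ J)
    (hg : ∀ x ∈ Set.Ici (0 : ℝ), g x = smoothExt f (x, t)) (n : ℕ) :
    ∀ x ∈ Set.Ici (0 : ℝ), iteratedDerivWithin n g (Set.Ici 0) x
      = smoothExt ((dirDeriv hS (1, 0))^[n] f) (x, t) := by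
  induction n with
  | zero => simpa using hg
  | succ n ih =>
    intro x hx
    rw [iteratedDerivWithin_succ, derivWithin_congr ih (ih x hx), Function.iterate_succ_apply']
    exact (hasDerivWithinAt_smoothExt_space hS _ hx ht).derivWithin (uniqueDiffOn_Ici 0 x hx)

/-- The field as an element of the algebra of smooth functions on the half-strip. -/
def fieldU (hq : IsNLSSolution J q) : smoothFunctions (Set.Ici (0 : ℝ) ×ˢ J) :=
  smoothMk (fun p => q p.1 p.2) hq.1

/-- The conjugate field as an element of the algebra of smooth functions on the half-strip. -/
def fieldV (hq : IsNLSSolution J q) : smoothFunctions (Set.Ici (0 : ℝ) ×ˢ J) :=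
  smoothMk (fun p => conj (q p.1 p.2)) (Complex.conjCLE.contDiff.comp_contDiffOn hq.1)

theorem smoothExt_fieldU (hq : IsNLSSolution J q) {p : ℝ × ℝ} (hp : p ∈ Set.Ici (0 : ℝ) ×ˢ J) :
    smoothExt (fieldU hq) p = q p.1 p.2 :=
  smoothExt_mk _ hp

theorem smoothExt_fieldV (hq : IsNLSSolution J q) {p : ℝ × ℝ} (hp : p ∈ Set.Ici (0 : ℝ) ×ˢ J) :
    smoothExt (fieldV hq) p = conj (q p.1 p.2) :=
  smoothExt_mk (Complex.conjCLE.contDiff.comp_contDiffOn hq.1) hp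

theorem smoothExt_fieldV_eq_conj (hq : IsNLSSolution J q) :
    ∀ p ∈ Set.Ici (0 : ℝ) ×ˢ J, smoothExt (fieldV hq) p = conj (smoothExt (fieldU hq) p) :=
  fun p hp => by rw [smoothExt_fieldV hq hp, smoothExt_fieldU hq hp]

theorem smoothFunctions_eq_zero_iff {E : Type*} [NormedAddCommGroup E] [NormedSpace ℝ E] {S : Set E}
    {f : smoothFunctions S} : f = 0 ↔ ∀ p ∈ S, smoothExt f p = 0 := by
  refine ⟨fun h p hp => ?_, fun h => Subtype.ext (funext fun p => ?_)⟩
  · rw [h, smoothExt_apply 0 ⟨p, hp⟩]; rfl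
  · rw [← smoothExt_apply, h p p.2]; rfl

theorem fieldU_equation (hS : UniqueDiffOn ℝ (Set.Ici (0 : ℝ) ×ˢ J)) (hJ : UniqueDiffOn ℝ J)
    (hq : IsNLSSolution J q) :
    Complex.I • dirDeriv hS (0, 1) (fieldU hq)
      + dirDeriv hS (1, 0) (dirDeriv hS (1, 0) (fieldU hq))
      + 2 * fieldU hq ^ 2 * fieldV hq = 0 := by
  rw [smoothFunctions_eq_zero_iff]
  rintro ⟨x, t⟩ ⟨hx, ht⟩
  have hp : (x, t) ∈ Set.Ici (0 : ℝ) ×ˢ J := ⟨hx, ht⟩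
  have h2 := hq.2 x hx t ht
  rw [iteratedDerivWithin_smoothExt hS (fieldU hq) ht
      (fun y hy => (smoothExt_fieldU hq (p := (y, t)) ⟨hy, ht⟩).symm) 2 x hx,
    derivWithin_congr (fun s hs => (smoothExt_fieldU hq (p := (x, s)) ⟨hx, hs⟩).symm)
      (smoothExt_fieldU hq (p := (x, t)) ⟨hx, ht⟩).symm,
    (hasDerivWithinAt_smoothExt_time hS _ hx ht).derivWithin (hJ t ht)] at h2
  rw [smoothExt_add _ _ hp, smoothExt_add _ _ hp, smoothExt_smul _ _ hp, smoothExt_mul _ _ hp,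
    sq, two_mul, smoothExt_add _ _ hp, smoothExt_mul _ _ hp, smoothExt_fieldV hq hp,
    smoothExt_fieldU hq hp]
  rw [← Complex.mul_conj'] at h2
  simp only [Function.iterate_succ, Function.iterate_zero, Function.comp_apply, id] at h2
  linear_combination h2

/-- Conjugate of the equation of the field. The formal computation treats the field and its
conjugate as two unknowns, so it takes this as a separate hypothesis. -/
theorem fieldV_equation (hS : UniqueDiffOn ℝ (Set.Ici (0 : ℝ) ×ˢ J)) (hJ : UniqueDiffOn ℝ J)
    (hq : IsNLSSolution J q) :
    -(Complex.I • dirDeriv hS (0, 1) (fieldV hq))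
      + dirDeriv hS (1, 0) (dirDeriv hS (1, 0) (fieldV hq))
      + 2 * fieldU hq * fieldV hq ^ 2 = 0 := by
  have h := fieldU_equation hS hJ hq
  rw [smoothFunctions_eq_zero_iff] at h ⊢
  intro p hp
  have hc := smoothExt_fieldV_eq_conj hq
  have h2 := congrArg conj (h p hp)
  rw [← neg_smul, smoothExt_add _ _ hp, smoothExt_add _ _ hp, smoothExt_smul _ _ hp,
    smoothExt_mul _ _ hp, sq, two_mul, smoothExt_add _ _ hp, smoothExt_mul _ _ hp,
    smoothExt_dirDeriv_conj hS _ hc p hp,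
    smoothExt_dirDeriv_conj hS _ (smoothExt_dirDeriv_conj hS _ hc) p hp, hc p hp]
  rw [smoothExt_add _ _ hp, smoothExt_add _ _ hp, smoothExt_smul _ _ hp,
    smoothExt_mul _ _ hp, sq, two_mul, smoothExt_add _ _ hp, smoothExt_mul _ _ hp, hc p hp] at h2
  simp only [map_add, map_mul, Complex.conj_I, Complex.conj_conj, map_zero] at h2
  linear_combination h2

theorem decaysAt_fieldU (hS : UniqueDiffOn ℝ (Set.Ici (0 : ℝ) ×ˢ J)) (hq : IsNLSSolution J q)
    {t : ℝ} (ht : t ∈ J) (h : IsHalfLineSchwartz (fun x => q x t)) :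
    DecaysAt (dirDeriv hS (1, 0)) t (fieldU hq) := by
  intro n
  obtain ⟨C, hC⟩ := h.2 0 n
  obtain ⟨C', hC'⟩ := h.2 2 n
  refine ⟨C + C', fun x hx => ?_⟩
  have h1 := hC x hx
  have h2 := hC' x hx
  rw [iteratedDerivWithin_smoothExt hS (fieldU hq) ht
      (fun y hy => (smoothExt_fieldU hq (p := (y, t)) ⟨hy, ht⟩).symm) n x hx] at h1 h2
  rw [add_mul]
  simpa using add_le_add h1 h2

theorem decaysAt_fieldV (hS : UniqueDiffOn ℝ (Set.Ici (0 : ℝ) ×ˢ J)) (hq : IsNLSSolution J q)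
    {t : ℝ} (ht : t ∈ J) (h : IsHalfLineSchwartz (fun x => q x t)) :
    DecaysAt (dirDeriv hS (1, 0)) t (fieldV hq) := by
  intro n
  obtain ⟨C, hC⟩ := decaysAt_fieldU hS hq ht h n
  refine ⟨C, fun x hx => ?_⟩
  have key : ∀ p ∈ Set.Ici (0 : ℝ) ×ˢ J, smoothExt ((dirDeriv hS (1, 0))^[n] (fieldV hq)) p
      = conj (smoothExt ((dirDeriv hS (1, 0))^[n] (fieldU hq)) p) := by
    clear hC
    induction n with
    | zero => exact smoothExt_fieldV_eq_conj hq
    | succ n ih =>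
      rw [Function.iterate_succ_apply', Function.iterate_succ_apply']
      exact smoothExt_dirDeriv_conj hS _ ih
  rw [key (x, t) ⟨hx, ht⟩, RCLike.norm_conj]
  exact hC x hx

end NLS

/-! ### The boundary condition, to all orders in `h = 1/z`. -/

section BoundaryIdentity

open PowerSeries

/-- The polynomial `h ^ D * p (-1 / h)`. -/
def reflectNeg (D : ℕ) (p : Polynomial ℂ) : Polynomial ℂ := (p.comp (-Polynomial.X)).reflect D

theorem natDegree_comp_neg_X (p : Polynomial ℂ) : (p.comp (-Polynomial.X)).natDegree = p.natDegree := by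
  rw [Polynomial.natDegree_comp, Polynomial.natDegree_neg, Polynomial.natDegree_X, mul_one]

theorem natDegree_reflectNeg_le {D : ℕ} {p : Polynomial ℂ} (hp : p.natDegree ≤ D) :
    (reflectNeg D p).natDegree ≤ D := by
  rw [Polynomial.natDegree_le_iff_coeff_eq_zero]
  intro n hn
  rw [reflectNeg, Polynomial.coeff_reflect, Polynomial.revAt_eq_self_of_lt hn]
  exact Polynomial.coeff_eq_zero_of_natDegree_lt (by rw [natDegree_comp_neg_X]; omega)

theorem eval_reflectNeg {D : ℕ} {p : Polynomial ℂ} (hp : p.natDegree ≤ D) {h : ℂ} (hh : h ≠ 0) :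
    (reflectNeg D p).eval h = h ^ D * p.eval (-h⁻¹) := by
  let _ : Invertible h⁻¹ := invertibleOfNonzero (inv_ne_zero hh)
  have h1 := Polynomial.eval₂_reflect_mul_pow (RingHom.id ℂ) h⁻¹ D (p.comp (-Polynomial.X))
    (by rw [natDegree_comp_neg_X]; exact hp)
  rw [invOf_eq_inv, inv_inv] at h1
  simp only [Polynomial.eval₂_id, Polynomial.eval_comp, Polynomial.eval_neg, Polynomial.eval_X] at h1
  rw [← h1, reflectNeg, mul_comm (h ^ D), mul_assoc, ← mul_pow, inv_mul_cancel₀ hh, one_pow, mul_one]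

theorem KappaData.f_ne_zero (k : KappaData) (hbeta : ∀ j, (k.beta j).im < 0)
    (halpha : ∀ l, k.alpha l < 0) {z : ℂ} (hz : 0 ≤ z.im) : k.f z ≠ 0 := by
  refine mul_ne_zero (Finset.prod_ne_zero_iff.2 fun j _ => mul_ne_zero ?_ ?_)
    (Finset.prod_ne_zero_iff.2 fun l _ => ?_) <;> intro h <;> have h2 := congrArg Complex.im h
  · have := hbeta j
    simp at h2
    linarith
  · have := hbeta j
    simp at h2
    linarith
  · have := halpha l
    simp at h2
    linarith

/-- The zeros of `f` lie in the open lower half-plane and those of `g` are their conjugates. Hence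
`K₋(-z)` has no pole for `Im z ≥ 0`. -/
theorem KappaData.g_ne_zero (k : KappaData) (hbeta : ∀ j, (k.beta j).im < 0)
    (halpha : ∀ l, k.alpha l < 0) {z : ℂ} (hz : z.im ≤ 0) : k.g z ≠ 0 := by
  rw [KappaData.g, map_ne_zero]
  exact k.f_ne_zero hbeta halpha (by simpa using hz)

/-- The matrix `h² V(1 / h)`, with polynomial entries. -/
def scaledLaxV (w wx : ℂ) : Matrix (Fin 2) (Fin 2) (Polynomial ℂ) :=
  !![Polynomial.C (-2 * Complex.I) + Polynomial.C (Complex.I * (w * conj w)) * Polynomial.X ^ 2,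
      Polynomial.C (2 * w) * Polynomial.X + Polynomial.C (Complex.I * wx) * Polynomial.X ^ 2;
    Polynomial.C (-2 * conj w) * Polynomial.X + Polynomial.C (Complex.I * conj wx) * Polynomial.X ^ 2,
      Polynomial.C (2 * Complex.I) - Polynomial.C (Complex.I * (w * conj w)) * Polynomial.X ^ 2]

theorem eval_scaledLaxV (w wx : ℂ) {h : ℂ} (hh : h ≠ 0) (i j : Fin 2) :
    (scaledLaxV w wx i j).eval h = h ^ 2 * laxV w wx h⁻¹ i j := by
  fin_cases i <;> fin_cases j <;>
  · simp [scaledLaxV, laxV, potQ, sigma3]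
    field_simp
    try ring

variable {k : KappaData} {J : Set ℝ} {w wx : ℝ → ℂ} {P : ℝ → Matrix (Fin 2) (Fin 2) (Polynomial ℂ)}

/-- The time evolution of the coefficients of the numerator of the reflection matrix. -/
theorem IsReflectionFamily.exists_coeff_evolution (hP : IsReflectionFamily k J w wx P)
    (hJ : UniqueDiffOn ℝ J)
    (hbeta : ∀ j, (k.beta j).im < 0) (halpha : ∀ l, k.alpha l < 0) {t : ℝ} (ht : t ∈ J) :
    ∃ P' : Matrix (Fin 2) (Fin 2) (Polynomial ℂ),
      (∀ i j, HasCoeffDerivWithinAt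
        (fun t => (reflectNeg (2 * k.numBeta + k.numAlpha) (P t i j) : ℂ⟦X⟧)) (P' i j : ℂ⟦X⟧) J t) ∧
      ∀ i j, Polynomial.X ^ 2 * P' i j =
        (∑ l, scaledLaxV (w t) (wx t) i l * reflectNeg (2 * k.numBeta + k.numAlpha) (P t l j))
        - ∑ l, reflectNeg (2 * k.numBeta + k.numAlpha) (P t i l)
            * (scaledLaxV (w t) (wx t) l j).comp (-Polynomial.X) := by
  set D := 2 * k.numBeta + k.numAlpha
  have hdeg : ∀ i j, ∀ t ∈ J, (reflectNeg D (P t i j)).natDegree ≤ D := fun i j t ht =>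
    natDegree_reflectNeg_le (hP.natDegree_le t ht i j)
  -- the nodes are positive integers, where `g` does not vanish
  have hn0 (n : ℕ) : ((n : ℂ) + 1) ≠ 0 := Nat.cast_add_one_ne_zero n
  have hg (n : ℕ) : k.g (-((n : ℂ) + 1)⁻¹) ≠ 0 := k.g_ne_zero hbeta halpha (le_of_eq (by
    rw [show (-((n : ℂ) + 1)⁻¹) = ((-((n : ℝ) + 1)⁻¹ : ℝ) : ℂ) by push_cast; rfl]
    exact Complex.ofReal_im _))
  have hev (n : ℕ) (i j : Fin 2) (s : ℝ) (hs : s ∈ J) :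
      (reflectNeg D (P s i j)).eval ((n : ℂ) + 1) = ((n : ℂ) + 1) ^ D * k.g (-((n : ℂ) + 1)⁻¹)
        * reflK k (P s) (-((n : ℂ) + 1)⁻¹) i j := by
    rw [eval_reflectNeg (D := D) (hP.natDegree_le s hs i j) (hn0 n), reflK, Matrix.of_apply,
      mul_assoc, mul_div_cancel₀ _ (hg n)]
  have hderiv (n : ℕ) (i j : Fin 2) :=
    ((hP.evolution t ht (-((n : ℂ) + 1)⁻¹) (hg n) i j).const_mul
      (((n : ℂ) + 1) ^ D * k.g (-((n : ℂ) + 1)⁻¹))).congr (hev n i j) (hev n i j t ht)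
  choose P' hP' using fun i j => exists_coeff_hasDerivWithinAt (hdeg i j) ht (hderiv · i j)
  refine ⟨P', fun i j n => by simpa using hP' i j n, fun i j => ?_⟩
  -- The polynomial identity is the evolution of `K` at `z = -1/h`, multiplied by `h^(D+2) g(-1/h)`;
  -- it suffices to have it at the infinitely many nodes.
  refine Polynomial.eq_of_infinite_eval_eq _ _ ((Set.infinite_range_of_injective
    (f := fun n : ℕ => (n : ℂ) + 1) fun a b h => by simpa using h).mono ?_)
  rintro _ ⟨n, rfl⟩
  have h1 := (hJ t ht).eq_deriv _ (hasDerivWithinAt_eval_of_coeff (hdeg i j) ht (hP' i j) ((n : ℂ) + 1))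
    (hderiv n i j)
  -- At `z = -1/h` the left factor `V(-z)` becomes `V(1/h)`, while the right factor `V(z)` becomes
  -- `V(-1/h)`; this is the substitution `X ↦ -X` on the right.
  have hneg (l : Fin 2) : ((scaledLaxV (w t) (wx t) l j).comp (-Polynomial.X)).eval ((n : ℂ) + 1)
      = ((n : ℂ) + 1) ^ 2 * laxV (w t) (wx t) (-((n : ℂ) + 1)⁻¹) l j := by
    rw [Polynomial.eval_comp, Polynomial.eval_neg, Polynomial.eval_X,
      eval_scaledLaxV _ _ (neg_ne_zero.2 (hn0 n)), neg_sq, inv_neg]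
  simp only [Set.mem_ofPred_eq, Fin.sum_univ_two, Polynomial.eval_mul, Polynomial.eval_sub, Polynomial.eval_add,
    Polynomial.eval_pow, Polynomial.eval_X, h1, eval_scaledLaxV _ _ (hn0 n), hneg,
    hev n _ _ t ht, Matrix.sub_apply, Matrix.mul_apply, neg_neg]
  ring

/-- The off-diagonal entry of the gauge transformed reflection matrix vanishes. -/
theorem IsReflectionFamily.gauge_eq_zero (hP : IsReflectionFamily k J w wx P)
    (hJ : UniqueDiffOn ℝ J)
    (hbeta : ∀ j, (k.beta j).im < 0) (halpha : ∀ l, k.alpha l < 0)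
    {s s' : ℝ → ℂ⟦X⟧} (hs : ∀ t ∈ J, HasCoeffDerivWithinAt s (s' t) J t)
    (hs' : ∀ t ∈ J, X ^ 2 * s' t =
      (scaledLaxV (w t) (wx t) 0 1 : ℂ⟦X⟧)
      + ((scaledLaxV (w t) (wx t) 0 0 : ℂ⟦X⟧) - (scaledLaxV (w t) (wx t) 1 1 : ℂ⟦X⟧)) * s t
      - (scaledLaxV (w t) (wx t) 1 0 : ℂ⟦X⟧) * s t ^ 2) :
    ∀ t ∈ J, ((reflectNeg (2 * k.numBeta + k.numAlpha) (P t 0 0) : ℂ⟦X⟧) * rescale (-1) (s t)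
        + (reflectNeg (2 * k.numBeta + k.numAlpha) (P t 0 1) : ℂ⟦X⟧))
      - s t * ((reflectNeg (2 * k.numBeta + k.numAlpha) (P t 1 0) : ℂ⟦X⟧) * rescale (-1) (s t)
        + (reflectNeg (2 * k.numBeta + k.numAlpha) (P t 1 1) : ℂ⟦X⟧)) = 0 := by
  set D := 2 * k.numBeta + k.numAlpha
  have hex : ∀ t, ∃ P' : Matrix (Fin 2) (Fin 2) (Polynomial ℂ), t ∈ J →
      (∀ i j, HasCoeffDerivWithinAt
        (fun t => (reflectNeg D (P t i j) : ℂ⟦X⟧)) (P' i j : ℂ⟦X⟧) J t) ∧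
      ∀ i j, Polynomial.X ^ 2 * P' i j =
        (∑ l, scaledLaxV (w t) (wx t) i l * reflectNeg D (P t l j))
        - ∑ l, reflectNeg D (P t i l) * (scaledLaxV (w t) (wx t) l j).comp (-Polynomial.X) := by
    intro t
    by_cases ht : t ∈ J
    · obtain ⟨P', h⟩ := hP.exists_coeff_evolution hJ hbeta halpha ht
      exact ⟨P', fun _ => h⟩
    · exact ⟨0, fun h => absurd h ht⟩
  choose P' hP' using hex
  -- Write `W = h² V(1/h)`, `W~ = W(-h)`, `s~ = s(-h)`, and let `M` be the numerator. Then `b = (1,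
  -- -s) M (s~, 1)ᵀ` with `h² M' = W M - M W~`. The Riccati equation makes `(1, -s)` a left and
  -- `(s~, 1)ᵀ` a right eigenvector of the evolution, so `h² b' = (W₀₀ - s W₁₀ - W~₁₁ - W~₁₀ s~) b`.
  -- The constant term is `-2i - 2i = -4i`; the remainder is `h` times the series chosen for `w`.
  refine eq_zero_of_X_sq_mul_hasCoeffDerivWithinAt hJ (c := -4 * Complex.I) (by simp)
    (b := fun t => ((reflectNeg D (P t 0 0) : ℂ⟦X⟧) * rescale (-1) (s t)
        + (reflectNeg D (P t 0 1) : ℂ⟦X⟧))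
      - s t * ((reflectNeg D (P t 1 0) : ℂ⟦X⟧) * rescale (-1) (s t)
        + (reflectNeg D (P t 1 1) : ℂ⟦X⟧)))
    (b' := fun t => ((P' t 0 0 : ℂ⟦X⟧) * rescale (-1) (s t)
        + (reflectNeg D (P t 0 0) : ℂ⟦X⟧) * rescale (-1) (s' t) + (P' t 0 1 : ℂ⟦X⟧))
      - (s' t * ((reflectNeg D (P t 1 0) : ℂ⟦X⟧) * rescale (-1) (s t)
        + (reflectNeg D (P t 1 1) : ℂ⟦X⟧)) + s t * ((P' t 1 0 : ℂ⟦X⟧) * rescale (-1) (s t)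
        + (reflectNeg D (P t 1 0) : ℂ⟦X⟧) * rescale (-1) (s' t) + (P' t 1 1 : ℂ⟦X⟧))))
    (w := fun t => C (2 * Complex.I * (w t * conj (w t))) * X
      - (C (-2 * conj (w t)) + C (Complex.I * conj (wx t)) * X) * s t
      - (C (2 * conj (w t)) + C (Complex.I * conj (wx t)) * X) * rescale (-1) (s t))
    (fun t ht => ?_) (fun t ht => ?_)
  · have h := (hP' t ht).1
    have hr := (hs t ht).rescale (-1)
    exact (((h 0 0).mul hr).add (h 0 1)).sub ((hs t ht).mul (((h 1 0).mul hr).add (h 1 1)))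
  · have h (i j : Fin 2) := congrArg (fun p : Polynomial ℂ => (p : ℂ⟦X⟧)) ((hP' t ht).2 i j)
    have e := hs' t ht
    have er := congrArg (rescale (-1 : ℂ)) e
    have h00 := h 0 0
    have h01 := h 0 1
    have h10 := h 1 0
    have h11 := h 1 1
    have hrC (a : ℂ) : rescale (-1 : ℂ) (C a) = C a := by
      ext n
      rw [coeff_rescale, coeff_C]
      split_ifs with hn <;> simp [hn]
    have hrX : rescale (-1 : ℂ) (X : ℂ⟦X⟧) = -X := by
      rw [rescale_X]; simp
    have hr2 : rescale (-1 : ℂ) (2 : ℂ⟦X⟧) = 2 := map_ofNat _ 2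
    have hC2 : (C (2 : ℂ) : ℂ⟦X⟧) = 2 := map_ofNat _ 2
    have hC4 : (C (4 : ℂ) : ℂ⟦X⟧) = 4 := map_ofNat _ 4
    simp only [Fin.sum_univ_two, scaledLaxV, Matrix.of_apply, Matrix.cons_val', Matrix.cons_val_zero,
      Matrix.cons_val_one, Matrix.cons_val_fin_one, Polynomial.coe_mul, Polynomial.coe_add,
      Polynomial.coe_sub, Polynomial.coe_pow, Polynomial.coe_C, Polynomial.coe_X, Polynomial.add_comp,
      Polynomial.sub_comp, Polynomial.mul_comp, Polynomial.pow_comp, Polynomial.C_comp,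
      Polynomial.X_comp, Polynomial.neg_comp, Polynomial.coe_neg, map_add, map_sub, map_mul, map_pow, hrC, hrX, map_neg,
      hC2, hC4, hr2]
      at e er h00 h01 h10 h11 ⊢
    linear_combination h00 * rescale (-1) (s t) + h01 - s t * (h10 * rescale (-1) (s t) + h11)
      + (reflectNeg D (P t 0 0) : ℂ⟦X⟧) * er - s t * (reflectNeg D (P t 1 0) : ℂ⟦X⟧) * er
      - e * ((reflectNeg D (P t 1 0) : ℂ⟦X⟧) * rescale (-1) (s t) + (reflectNeg D (P t 1 1) : ℂ⟦X⟧))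

/-- The coefficients of the formal gauge transformation at a time `t`, as functions of the space
variable, and the vanishing of the off-diagonal part of the transformed reflection matrix. -/
theorem exists_riccati_coefficients {k : KappaData} (hbeta : ∀ j, (k.beta j).im < 0)
    (halpha : ∀ l, k.alpha l < 0) {J : Set ℝ} (hJ : J.OrdConnected) (hJ' : J.Nontrivial) {t : ℝ}
    (ht : t ∈ J) {q : ℝ → ℝ → ℂ} (hq : IsNLSSolution J q)
    (hqt : IsHalfLineSchwartz (fun x => q x t))
    {P : ℝ → Matrix (Fin 2) (Fin 2) (Polynomial ℂ)}
    (hP : IsReflectionFamily k J (fun t => q 0 t)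
      (fun t => derivWithin (fun x => q x t) (Set.Ici 0) 0) P) :
    ∃ a a' : ℕ → ℝ → ℂ, (∀ x ∈ Set.Ici (0 : ℝ), a 0 x = 0) ∧
      (∀ n, ∀ x ∈ Set.Ici (0 : ℝ), HasDerivWithinAt (a n) (a' n x) (Set.Ici 0) x) ∧
      (∀ n, ∀ x ∈ Set.Ici (0 : ℝ), a' n x = -2 * Complex.I * a (n + 1) x
        + (if n = 0 then q x t else 0)
        + conj (q x t) * ∑ i ∈ Finset.range (n + 1), a i x * a (n - i) x) ∧
      (∀ n, ∃ C : ℝ, ∀ x ∈ Set.Ici (0 : ℝ), (1 + x ^ 2) * ‖a n x‖ ≤ C) ∧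
      ((reflectNeg (2 * k.numBeta + k.numAlpha) (P t 0 0) : ℂ⟦X⟧)
          * rescale (-1) (PowerSeries.mk (a · 0))
        + (reflectNeg (2 * k.numBeta + k.numAlpha) (P t 0 1) : ℂ⟦X⟧))
      - PowerSeries.mk (a · 0) * ((reflectNeg (2 * k.numBeta + k.numAlpha) (P t 1 0) : ℂ⟦X⟧)
          * rescale (-1) (PowerSeries.mk (a · 0))
        + (reflectNeg (2 * k.numBeta + k.numAlpha) (P t 1 1) : ℂ⟦X⟧)) = 0 := by
  have hJu := uniqueDiffOn_of_ordConnected hJ hJ'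
  have hS := uniqueDiffOn_halfStrip hJ hJ'
  have hcl := halfStrip_subset_closure_interior hJ hJ'
  have h0 : (0 : ℝ) ∈ Set.Ici (0 : ℝ) := Set.self_mem_Ici
  set σ := riccatiCoeff (dirDeriv hS (1, 0)) (fieldU hq) (fieldV hq)
  have hmem : ∀ x ∈ Set.Ici (0 : ℝ), (x, t) ∈ Set.Ici (0 : ℝ) ×ˢ J := fun x hx => ⟨hx, ht⟩
  have hdec := DecaysAt.riccatiCoeff hmem (decaysAt_fieldU hS hq ht hqt)
    (decaysAt_fieldV hS hq ht hqt)
  have hsmul (c : ℂ) (f : smoothFunctions (Set.Ici (0 : ℝ) ×ˢ J)) (p) : evalAt p (c • f) = c * evalAt p f := by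
    rw [evalAt_apply, evalAt_apply, smoothExt_smul _ _ p.2]
  refine ⟨fun n x => smoothExt (σ n) (x, t), fun n x => smoothExt (dirDeriv hS (1, 0) (σ n)) (x, t), fun x hx => ?_,
    fun n x hx => hasDerivWithinAt_smoothExt_space hS _ hx ht, fun n x hx => ?_, fun n => hdec n 0, ?_⟩
  · beta_reduce
    rw [show σ 0 = 0 from riccatiCoeff.eq_1 .., smoothFunctions_eq_zero_iff.1 rfl _ (hmem x hx)]
  · have h1 : σ (n + 1) = (Complex.I / 2) • (dirDeriv hS (1, 0) (σ n) - (if n = 0 then fieldU hq else 0)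
        - fieldV hq * ∑ i : Fin (n + 1), σ i * σ (n - i)) := riccatiCoeff.eq_2 ..
    have h2 := congrArg (evalAt ⟨(x, t), hmem x hx⟩) h1
    rw [hsmul, Fin.sum_univ_eq_sum_range (fun i => σ i * σ (n - i))] at h2
    simp only [map_sub, map_mul, map_sum, evalAt_apply, smoothExt_fieldV hq (hmem x hx)] at h2
    have h3 : smoothExt (if n = 0 then fieldU hq else 0) (x, t) = if n = 0 then q x t else 0 := by
      split_ifs
      · exact smoothExt_fieldU hq (hmem x hx)
      · exact smoothFunctions_eq_zero_iff.1 rfl _ (hmem x hx)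
    rw [h3] at h2
    beta_reduce
    rw [h2]
    linear_combination (smoothExt (dirDeriv hS (1, 0) (σ n)) (x, t) - (if n = 0 then q x t else 0)
      - conj (q x t) * ∑ i ∈ Finset.range (n + 1), smoothExt (σ i) (x, t) * smoothExt (σ (n - i)) (x, t))
        * Complex.I_mul_I
  -- On the boundary line the time equation is used at all times of `J`. No decay enters here; decay
  -- is known only at the time `t`.
  · have hm : ∀ s ∈ J, ((0 : ℝ), s) ∈ Set.Ici (0 : ℝ) ×ˢ J := fun s hs => ⟨h0, hs⟩
    have key := hP.gauge_eq_zero hJu hbeta halpha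
      (s := fun s => PowerSeries.mk fun n => smoothExt (σ n) (0, s))
      (s' := fun s => PowerSeries.mk fun n => smoothExt (dirDeriv hS (0, 1) (σ n)) (0, s))
      (fun s hs n => by simpa using hasDerivWithinAt_smoothExt_time hS (σ n) h0 hs) ?_ t ht
    · exact key
    · intro s hs
      have h1 := riccatiSeries_time (dirDeriv_comm hS hcl (1, 0) (0, 1)) (fieldU_equation hS hJu hq)
        (fieldV_equation hS hJu hq)
      -- Evaluation at `(0, s)` turns the identity over the smooth functions into a numerical one,
      -- whose coefficients are the entries of `h² V(1/h)` at the boundary.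
      have h2 := congrArg (PowerSeries.map (evalAt ⟨(0, s), hm s hs⟩)) h1
      have hs1 (c : ℂ) (f : (smoothFunctions (Set.Ici (0 : ℝ) ×ˢ J))⟦X⟧) (p) :
          PowerSeries.map (evalAt p) (c • f) = C c * PowerSeries.map (evalAt p) f := by
        ext n
        rw [coeff_map, coeff_complex_smul, hsmul, coeff_C_mul, coeff_map]
      have hux : derivWithin (fun x => q x s) (Set.Ici 0) 0 = smoothExt (dirDeriv hS (1, 0) (fieldU hq)) (0, s) := by
        have := iteratedDerivWithin_smoothExt hS (fieldU hq) hs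
          (fun y hy => (smoothExt_fieldU hq (p := (y, s)) ⟨hy, hs⟩).symm) 1 0 h0
        simpa [iteratedDerivWithin_one] using this
      have e1 : PowerSeries.map (evalAt ⟨(0, s), hm s hs⟩) (riccatiSeries (dirDeriv hS (1, 0)) (fieldU hq) (fieldV hq))
          = PowerSeries.mk fun n => smoothExt (σ n) (0, s) := by
        ext n
        simp [riccatiSeries, evalAt_apply, σ]
      have e2 : PowerSeries.map (evalAt ⟨(0, s), hm s hs⟩)
          (coeffDeriv (dirDeriv hS (0, 1)) (riccatiSeries (dirDeriv hS (1, 0)) (fieldU hq) (fieldV hq)))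
          = PowerSeries.mk fun n => smoothExt (dirDeriv hS (0, 1) (σ n)) (0, s) := by
        ext n
        simp [riccatiSeries, evalAt_apply, σ]
      have hC2 : (C (2 : ℂ) : ℂ⟦X⟧) = 2 := map_ofNat _ 2
      have hC4 : (C (4 : ℂ) : ℂ⟦X⟧) = 4 := map_ofNat _ 4
      have hM2 : PowerSeries.map (evalAt ⟨(0, s), hm s hs⟩) 2 = 2 := map_ofNat _ 2
      rw [hux]
      simp only [map_add, map_sub, map_mul, map_pow, map_neg, hs1, PowerSeries.map_X,
        PowerSeries.map_C, e1, e2, evalAt_apply, smoothExt_fieldU hq (hm s hs),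
        smoothExt_fieldV hq (hm s hs), hC2, hC4, hM2,
        smoothExt_dirDeriv_conj hS _ (smoothExt_fieldV_eq_conj hq) _ (hm s hs)] at h2
      simp only [scaledLaxV, Matrix.of_apply, Matrix.cons_val', Matrix.cons_val_zero,
        Matrix.cons_val_one, Matrix.cons_val_fin_one, Polynomial.coe_mul, Polynomial.coe_add,
        Polynomial.coe_sub, Polynomial.coe_pow, Polynomial.coe_C, Polynomial.coe_X,
        Polynomial.coe_neg, map_mul, map_neg, hC2]
      linear_combination h2

end BoundaryIdentity

/-! ### The path-ordered exponential as a solution of the space equation. -/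

section Transition

open MeasureTheory Set

theorem laxU_apply (u : ℝ → ℂ) (z : ℂ) (x : ℝ) :
    laxU u z x = !![-Complex.I * z, u x; -conj (u x), Complex.I * z] := by
  ext i j
  fin_cases i <;> fin_cases j <;> simp [laxU, sigma3, potQ]

theorem pathTerm_succ (u : ℝ → ℂ) (z : ℂ) (y : ℝ) (n : ℕ) (x : ℝ) (i j : Fin 2) :
    pathTerm u z y (n + 1) x i j = ∫ s in y..x, (laxU u z s * pathTerm u z y n s) i j := rfl

theorem pathTerm_congr {u w : ℝ → ℂ} (h : ∀ x, 0 ≤ x → u x = w x) (z : ℂ) (n : ℕ) {x : ℝ}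
    (hx : 0 ≤ x) : pathTerm u z 0 n x = pathTerm w z 0 n x := by
  induction n generalizing x with
  | zero => rfl
  | succ n ih =>
    ext i j
    rw [pathTerm_succ, pathTerm_succ]
    refine intervalIntegral.integral_congr fun s hs => ?_
    rw [uIcc_of_le hx] at hs
    simp only [ih hs.1, laxU_apply, h s hs.1]

/-- Only values on `[0, ∞)` matter, so the field may be replaced by a continuous function on all of
`ℝ`. -/
theorem transition_congr {u w : ℝ → ℂ} (h : ∀ x, 0 ≤ x → u x = w x) (z : ℂ) {x : ℝ}
    (hx : 0 ≤ x) : transition u x 0 z = transition w x 0 z := by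
  ext i j
  simp only [transition, Matrix.of_apply, pathTerm_congr h z _ hx]

theorem intervalIntegral_conj (f : ℝ → ℂ) (a b : ℝ) :
    ∫ x in a..b, conj (f x) = conj (∫ x in a..b, f x) := by
  rw [intervalIntegral, intervalIntegral, integral_conj, integral_conj, map_sub]

/-- The symmetry `U^*(z^*) = σ₂ U(z) σ₂` passes to every term of the series. It reduces the second
row to the first. -/
theorem pathTerm_conj (u : ℝ → ℂ) (z : ℂ) (y : ℝ) (n : ℕ) (x : ℝ) :
    pathTerm u z y n x 1 1 = conj (pathTerm u (conj z) y n x 0 0) ∧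
      pathTerm u z y n x 1 0 = -conj (pathTerm u (conj z) y n x 0 1) := by
  induction n generalizing x z with
  | zero => simp [pathTerm]
  | succ n ih =>
    simp only [pathTerm_succ, ← intervalIntegral_conj, ← intervalIntegral.integral_neg]
    constructor <;> congr 1 <;> ext s <;> (
      have h1 := ih (conj z) s
      rw [Complex.conj_conj] at h1
      simp [laxU_apply, Matrix.mul_apply, Fin.sum_univ_two, (ih z s).1, (ih z s).2, h1.1, h1.2]
      try ring)

variable {w : ℝ → ℂ}

theorem continuous_pathTerm (hw : Continuous w) (z : ℂ) (n : ℕ) (i j : Fin 2) :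
    Continuous fun x => pathTerm w z 0 n x i j := by
  induction n generalizing i j with
  | zero => exact continuous_const
  | succ n ih =>
    simp only [pathTerm_succ]
    refine intervalIntegral.continuous_primitive (fun a b => Continuous.intervalIntegrable ?_ _ _) 0
    simp only [laxU_apply, Matrix.mul_apply, Fin.sum_univ_two]
    fin_cases i <;> simp <;> fun_prop

theorem continuous_laxU_mul_pathTerm (hw : Continuous w) (z : ℂ) (n : ℕ) (i j : Fin 2) :
    Continuous fun x => (laxU w z x * pathTerm w z 0 n x) i j := by
  have h := continuous_pathTerm hw z n
  simp only [laxU_apply, Matrix.mul_apply, Fin.sum_univ_two]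
  fin_cases i <;> simp <;> fun_prop

theorem hasDerivAt_pathTerm (hw : Continuous w) (z : ℂ) (n : ℕ) (i j : Fin 2) (x : ℝ) :
    HasDerivAt (fun x => pathTerm w z 0 (n + 1) x i j) ((laxU w z x * pathTerm w z 0 n x) i j) x :=
  (continuous_laxU_mul_pathTerm hw z n i j).integral_hasStrictDerivAt 0 x |>.hasDerivAt

theorem norm_laxU_mul_le {M : ℝ} {z : ℂ} {x : ℝ} (hz : ‖z‖ ≤ M) (hx : ‖w x‖ ≤ M)
    {A : Matrix (Fin 2) (Fin 2) ℂ} {c : ℝ} (hA : ∀ i j, ‖A i j‖ ≤ c) (i j : Fin 2) :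
    ‖(laxU w z x * A) i j‖ ≤ 2 * M * c := by
  have hM : 0 ≤ M := (norm_nonneg _).trans hz
  have h (l : Fin 2) : ‖laxU w z x i l * A l j‖ ≤ M * c := by
    rw [norm_mul]
    refine mul_le_mul ?_ (hA l j) (norm_nonneg _) hM
    rw [laxU_apply]
    fin_cases i <;> fin_cases l <;> simpa
  rw [Matrix.mul_apply, Fin.sum_univ_two]
  linarith [norm_add_le (laxU w z x i 0 * A 0 j) (laxU w z x i 1 * A 1 j), h 0, h 1]

/-- Picard iteration: each entry of `U P` is a sum of two products, whence the factor `2 M` per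
integration. -/
theorem norm_pathTerm_le {M L : ℝ} (hM : ∀ x ∈ Icc 0 L, ‖w x‖ ≤ M) {z : ℂ}
    (hz : ‖z‖ ≤ M) (n : ℕ) {x : ℝ} (hx : x ∈ Icc 0 L) (i j : Fin 2) :
    ‖pathTerm w z 0 n x i j‖ ≤ (2 * M * x) ^ n / n.factorial := by
  induction n generalizing x i j with
  | zero => fin_cases i <;> fin_cases j <;> simp [pathTerm]
  | succ n ih =>
    rw [pathTerm_succ]
    have h1 : ∀ s ∈ Ioc 0 x, ‖(laxU w z s * pathTerm w z 0 n s) i j‖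
        ≤ (2 * M) ^ (n + 1) / n.factorial * s ^ n := fun s hs => by
      have hs' : s ∈ Icc 0 L := ⟨hs.1.le, hs.2.trans hx.2⟩
      refine (norm_laxU_mul_le hz (hM s hs') (fun i j => ih hs' i j) i j).trans (le_of_eq ?_)
      ring
    refine (intervalIntegral.norm_integral_le_of_norm_le hx.1 (Filter.Eventually.of_forall h1)
      (Continuous.intervalIntegrable (by fun_prop) _ _)).trans (le_of_eq ?_)
    rw [intervalIntegral.integral_const_mul, integral_pow, Nat.factorial_succ]
    push_cast
    field_simp
    simp [mul_pow]

/-- A bound for the potential and the spectral parameter, for the purpose of summation. -/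
theorem exists_bound (hw : Continuous w) (L R : ℝ) :
    ∃ M : ℝ, R ≤ M ∧ ∀ x ∈ Icc 0 L, ‖w x‖ ≤ M := by
  obtain ⟨M, hM⟩ := isCompact_Icc.exists_bound_of_continuousOn (hw.continuousOn (s := Icc 0 L))
  exact ⟨max M R, le_max_right _ _, fun x hx => (hM x hx).trans (le_max_left _ _)⟩

theorem norm_pathTerm_le' {M L : ℝ} (hM : ∀ x ∈ Icc 0 L, ‖w x‖ ≤ M) {z : ℂ}
    (hz : ‖z‖ ≤ M) (n : ℕ) {x : ℝ} (hx : x ∈ Icc 0 L) (i j : Fin 2) :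
    ‖pathTerm w z 0 n x i j‖ ≤ (2 * M * L) ^ n / n.factorial := by
  refine (norm_pathTerm_le hM hz n hx i j).trans ?_
  have : 0 ≤ M := (norm_nonneg _).trans hz
  have := hx.1
  gcongr
  exact hx.2

theorem summable_pathTerm (hw : Continuous w) (z : ℂ) {x : ℝ} (hx : 0 ≤ x) (i j : Fin 2) :
    Summable fun n => pathTerm w z 0 n x i j := by
  obtain ⟨M, hz, hM⟩ := exists_bound hw x ‖z‖
  exact Summable.of_norm_bounded (Real.summable_pow_div_factorial _)
    fun n => norm_pathTerm_le' hM hz n ⟨hx, le_rfl⟩ i j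

theorem transition_zero (z : ℂ) : transition w 0 0 z = 1 := by
  ext i j
  rw [transition, Matrix.of_apply, tsum_eq_single 0]
  · rfl
  · intro n hn
    obtain ⟨m, rfl⟩ := Nat.exists_eq_succ_of_ne_zero hn
    rw [Nat.succ_eq_add_one, pathTerm_succ, intervalIntegral.integral_same]

theorem continuousOn_transition (hw : Continuous w) (z : ℂ) (i j : Fin 2) :
    ContinuousOn (fun x => transition w x 0 z i j) (Ici 0) := by
  intro x hx
  obtain ⟨M, hz, hM⟩ := exists_bound hw (x + 1) ‖z‖
  have h : ContinuousOn (fun x => transition w x 0 z i j) (Icc 0 (x + 1)) :=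
    continuousOn_tsum (fun n => (continuous_pathTerm hw z n i j).continuousOn)
      (Real.summable_pow_div_factorial _) fun n y hy => norm_pathTerm_le' hM hz n hy i j
  refine (h x ⟨hx, by linarith⟩).mono_of_mem_nhdsWithin ?_
  exact Filter.mem_of_superset (inter_mem_nhdsWithin _ (Iio_mem_nhds (lt_add_one x)))
    fun y hy => ⟨hy.1, hy.2.le⟩

theorem hasDerivAt_transition (hw : Continuous w) (z : ℂ) {x : ℝ} (hx : 0 < x) (i j : Fin 2) :
    HasDerivAt (fun x => transition w x 0 z i j) ((laxU w z x * transition w x 0 z) i j) x := by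
  obtain ⟨M, hz, hM⟩ := exists_bound hw (x + 1) ‖z‖
  -- The derivatives are shifted by one index: the constant term `n = 0` contributes `0`, and the
  -- term `m + 1` contributes `U` times the term `m`.
  set g' : ℕ → ℝ → ℂ := fun n y => n.casesOn 0 fun m => (laxU w z y * pathTerm w z 0 m y) i j
  have hM0 : 0 ≤ M := (norm_nonneg _).trans hz
  have hsum : Summable fun n : ℕ => n.casesOn (motive := fun _ => ℝ) 0
      fun m => 2 * M * ((2 * M * (x + 1)) ^ m / m.factorial) := by
    rw [← summable_nat_add_iff 1]
    exact (Real.summable_pow_div_factorial _).mul_left _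
  have h := hasDerivAt_tsum_of_isPreconnected (g := fun n x => pathTerm w z 0 n x i j) (g' := g')
    (t := Ioo 0 (x + 1)) (y₀ := x) (y := x) hsum isOpen_Ioo isPreconnected_Ioo ?_ ?_
    ⟨hx, lt_add_one x⟩ (summable_pathTerm hw z hx.le i j) ⟨hx, lt_add_one x⟩
  · have hs (l : Fin 2) := summable_pathTerm hw z hx.le l j
    have e : ∑' n, g' n x = (laxU w z x * transition w x 0 z) i j := by
      rw [Summable.tsum_eq_zero_add]
      · simp only [g', Matrix.mul_apply, Fin.sum_univ_two, transition, Matrix.of_apply]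
        rw [((hs 0).mul_left _).tsum_add ((hs 1).mul_left _), tsum_mul_left, tsum_mul_left]
        exact zero_add _
      · rw [← summable_nat_add_iff 1]
        simp only [g', Matrix.mul_apply, Fin.sum_univ_two]
        exact ((hs 0).mul_left _).add ((hs 1).mul_left _)
    rw [← e]
    exact h
  · rintro (_ | n) y hy
    · exact hasDerivAt_const y _
    · exact hasDerivAt_pathTerm hw z n i j y
  · rintro (_ | n) y hy
    · simp [g']
    · exact norm_laxU_mul_le hz (hM y ⟨hy.1.le, hy.2.le⟩)
        (fun i j => norm_pathTerm_le' hM hz n ⟨hy.1.le, hy.2.le⟩ i j) i j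

/-- Each term of the path-ordered exponential is a polynomial in the spectral parameter. -/
theorem exists_pathTerm_eq_sum (hw : Continuous w) (n : ℕ) (j : Fin 2) :
    ∃ c : ℕ → Fin 2 → ℝ → ℂ, (∀ k i, Continuous (c k i)) ∧
      ∀ i z x, pathTerm w z 0 n x i j = ∑ k ∈ Finset.range (n + 1), c k i x * z ^ k := by
  induction n with
  | zero =>
    refine ⟨fun _ i _ => (1 : Matrix (Fin 2) (Fin 2) ℂ) i j, fun _ _ => continuous_const,
      fun i z x => ?_⟩
    simp [pathTerm]
  | succ n ih =>
    obtain ⟨c, hc, h⟩ := ih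
    set b : ℕ → Fin 2 → ℝ → ℂ := fun k i x =>
      (if k = 0 then 0 else (if i = 0 then -Complex.I else Complex.I) * c (k - 1) i x)
      + (if k < n + 1 then (if i = 0 then w x * c k 1 x else -conj (w x) * c k 0 x) else 0) with hb
    have hbc : ∀ k i, Continuous (b k i) := fun k i => by
      have h1 := hc (k - 1) i
      have h2 := hc k 0
      have h3 := hc k 1
      simp only [hb]
      split_ifs <;> fun_prop
    refine ⟨fun k i x => ∫ s in (0 : ℝ)..x, b k i s, fun k i =>
      intervalIntegral.continuous_primitive (fun a b => (hbc k i).intervalIntegrable _ _) 0,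
      fun i z x => ?_⟩
    rw [pathTerm_succ]
    simp only [← intervalIntegral.integral_mul_const]
    rw [← intervalIntegral.integral_finsetSum (f := fun k s => b k i s * z ^ k)
      fun k _ => ((hbc k i).mul continuous_const).intervalIntegrable _ _]
    congr 1
    ext s
    have e1 : ∑ k ∈ Finset.range (n + 2),
        (if k = 0 then 0 else (if i = 0 then -Complex.I else Complex.I) * c (k - 1) i s) * z ^ k
        = (if i = 0 then -Complex.I else Complex.I) * z
          * ∑ k ∈ Finset.range (n + 1), c k i s * z ^ k := by
      rw [Finset.sum_range_succ', Finset.mul_sum]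
      simp only [if_true, zero_mul, add_zero, Nat.succ_ne_zero, if_false, Nat.add_sub_cancel]
      exact Finset.sum_congr rfl fun k _ => by ring
    have e2 : ∑ k ∈ Finset.range (n + 2),
        (if k < n + 1 then (if i = 0 then w s * c k 1 s else -conj (w s) * c k 0 s) else 0) * z ^ k
        = ∑ k ∈ Finset.range (n + 1),
          (if i = 0 then w s * c k 1 s else -conj (w s) * c k 0 s) * z ^ k := by
      rw [Finset.sum_range_succ]
      simp only [lt_irrefl, if_false, zero_mul, add_zero]
      exact Finset.sum_congr rfl fun k hk => by rw [if_pos (Finset.mem_range.1 hk)]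
    simp only [hb, add_mul, Finset.sum_add_distrib]
    rw [e1, e2, Matrix.mul_apply, Fin.sum_univ_two, h, h, laxU_apply]
    fin_cases i <;> simp [Finset.mul_sum, mul_assoc] <;> ring

/-- The terms are polynomials in `z`, and the Picard bound is uniform on a disc, so the sum is
entire. -/
theorem differentiable_transition (hw : Continuous w) {x : ℝ} (hx : 0 ≤ x) (i j : Fin 2) :
    Differentiable ℂ fun z => transition w x 0 z i j := by
  intro z₀
  obtain ⟨M, hz, hM⟩ := exists_bound hw x (‖z₀‖ + 1)
  have h : DifferentiableOn ℂ (fun z => ∑' n, pathTerm w z 0 n x i j) (Metric.ball 0 (‖z₀‖ + 1)) := by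
    refine DifferentiableOn.congr (f := fun z => ∑' n, pathTerm w z 0 n x i j) ?_ fun _ _ => rfl
    refine Complex.differentiableOn_tsum_of_summable_norm
      (Real.summable_pow_div_factorial (2 * M * x)) (fun n => ?_) Metric.isOpen_ball
      fun n z hzb => norm_pathTerm_le' hM ?_ n ⟨hx, le_rfl⟩ i j
    · obtain ⟨c, -, hc⟩ := exists_pathTerm_eq_sum hw n j
      simp only [hc]
      fun_prop
    · exact (mem_ball_zero_iff.1 hzb).le.trans hz
  exact h.differentiableAt (Metric.isOpen_ball.mem_nhds (by simp))

/-- Liouville's formula: `U` has trace zero, so the determinant keeps its initial value. -/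
theorem det_transition (hw : Continuous w) (z : ℂ) {x : ℝ} (hx : 0 ≤ x) :
    (transition w x 0 z).det = 1 := by
  have h := intervalIntegral.integral_eq_sub_of_hasDerivAt_of_le hx
    (f := fun x => (transition w x 0 z).det) (f' := fun _ => 0) ?_ ?_ (by simp)
  · simp only [intervalIntegral.integral_zero, transition_zero, Matrix.det_one] at h
    exact (sub_eq_zero.1 h.symm)
  · simp only [Matrix.det_fin_two]
    have hc (i j : Fin 2) := (continuousOn_transition hw z i j).mono
      (fun y hy => hy.1 : Icc 0 x ⊆ Ici 0)
    exact ((hc 0 0).mul (hc 1 1)).sub ((hc 0 1).mul (hc 1 0))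
  · intro y hy
    have hd (i j : Fin 2) := hasDerivAt_transition hw z hy.1 i j
    simp only [Matrix.det_fin_two]
    have e := ((hd 0 0).mul (hd 1 1)).sub ((hd 0 1).mul (hd 1 0))
    simp only [Matrix.mul_apply, Fin.sum_univ_two, laxU_apply] at e
    refine e.congr_deriv ?_
    simp
    ring

theorem transition_conj (u : ℝ → ℂ) (z : ℂ) (x y : ℝ) :
    transition u x y z 1 1 = conj (transition u x y (conj z) 0 0) ∧
      transition u x y z 1 0 = -conj (transition u x y (conj z) 0 1) := by
  simp only [transition, Matrix.of_apply]
  rw [Complex.conj_tsum, Complex.conj_tsum, ← tsum_neg]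
  exact ⟨tsum_congr fun n => (pathTerm_conj u z y n x).1,
    tsum_congr fun n => (pathTerm_conj u z y n x).2⟩

end Transition

/-! ### Limits at infinity of the first row, and their expansion in `1/z`. -/

section Jost

open MeasureTheory Set Filter

/-- A function with derivative `O(1 / (1 + x²))` converges at infinity. -/
theorem exists_tendsto_of_norm_deriv_le {f f' : ℝ → ℂ} {C : ℝ} (hf : ContinuousOn f (Ici 0))
    (hd : ∀ x, 0 < x → HasDerivAt f (f' x) x) (hb : ∀ x, 0 < x → (1 + x ^ 2) * ‖f' x‖ ≤ C) :
    ∃ l, Tendsto f atTop (𝓝 l) ∧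
      ∀ a, 0 ≤ a → ‖l - f a‖ ≤ C * (Real.pi / 2 - Real.arctan a) := by
  -- The comparison function is `C arctan`, whose derivative is the assumed bound and whose total
  -- increase on `[0, ∞)` is finite.
  have h1 : ∀ a b, 0 < a → a ≤ b → ‖f b - f a‖ ≤ C * (Real.arctan b - Real.arctan a) := by
    intro a b ha hab
    refine image_norm_le_of_norm_deriv_right_le_deriv_boundary' (a := a) (b := b)
      (f := fun x => f x - f a) (f' := f') (B := fun x => C * (Real.arctan x - Real.arctan a))
      (B' := fun x => C * (1 / (1 + x ^ 2)))
      ((hf.mono fun x hx => ha.le.trans hx.1).sub continuousOn_const)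
      (fun x hx => ((hd x (ha.trans_le hx.1)).sub_const _).hasDerivWithinAt) (by simp)
      (Continuous.continuousOn (by fun_prop))
      (fun x hx => (((Real.hasDerivAt_arctan x).sub_const _).const_mul C).hasDerivWithinAt)
      (fun x hx => ?_) ⟨hab, le_rfl⟩
    have := hb x (ha.trans_le hx.1)
    rw [mul_one_div, le_div_iff₀ (by positivity)]
    linarith
  have h2 : ∀ a b, 0 ≤ a → a ≤ b → ‖f b - f a‖ ≤ C * (Real.arctan b - Real.arctan a) := by
    intro a b ha hab
    rcases ha.eq_or_lt with rfl | ha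
    · rcases hab.eq_or_lt with rfl | hb
      · simp
      · have t1 : Tendsto f (𝓝[>] 0) (𝓝 (f 0)) :=
          (hf 0 self_mem_Ici).mono_left (nhdsWithin_mono _ Ioi_subset_Ici_self)
        have t2 : Tendsto Real.arctan (𝓝[>] 0) (𝓝 (Real.arctan 0)) :=
          Real.continuous_arctan.continuousAt.tendsto.mono_left nhdsWithin_le_nhds
        refine le_of_tendsto_of_tendsto (tendsto_const_nhds.sub t1).norm
          ((tendsto_const_nhds.sub t2).const_mul C) ?_
        filter_upwards [Ioo_mem_nhdsGT hb] with a ha using h1 a b ha.1 ha.2.le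
    · exact h1 a b ha hab
  have hC : 0 ≤ C := le_trans (by positivity) (hb 1 one_pos)
  have hlim : Tendsto Real.arctan atTop (𝓝 (Real.pi / 2)) :=
    tendsto_nhds_of_tendsto_nhdsWithin Real.tendsto_arctan_atTop
  have h3 : CauchySeq f := by
    rw [Metric.cauchySeq_iff']
    intro ε hε
    have : ∀ᶠ a in atTop, C * (Real.pi / 2 - Real.arctan a) < ε := by
      have h := (hlim.const_sub (Real.pi / 2)).const_mul C
      rw [sub_self, mul_zero] at h
      exact h.eventually (gt_mem_nhds hε)
    obtain ⟨a, ha, ha0⟩ := (this.and (eventually_ge_atTop 0)).exists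
    refine ⟨a, fun b hb => ?_⟩
    rw [dist_eq_norm]
    refine (h2 a b ha0 hb).trans_lt (lt_of_le_of_lt ?_ ha)
    gcongr
    exact (Real.arctan_lt_pi_div_two b).le
  obtain ⟨l, hl⟩ := cauchySeq_tendsto_of_complete h3
  refine ⟨l, hl, fun a ha => ?_⟩
  refine le_of_tendsto_of_tendsto (hl.sub_const _).norm ((hlim.sub_const _).const_mul C) ?_
  filter_upwards [eventually_ge_atTop a] with b hb using h2 a b ha hb

/-- The `j`-th column of `exp(i z x) T(x, 0; z)`. -/
def jost (w : ℝ → ℂ) (z : ℂ) (i j : Fin 2) (x : ℝ) : ℂ :=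
  Complex.exp (Complex.I * (z * x)) * transition w x 0 z i j

variable {w : ℝ → ℂ} {z : ℂ}

theorem continuousOn_jost (hw : Continuous w) (i j : Fin 2) :
    ContinuousOn (jost w z i j) (Ici 0) :=
  (Continuous.continuousOn (by fun_prop)).mul (continuousOn_transition hw z i j)

theorem jost_zero (i j : Fin 2) : jost w z i j 0 = (1 : Matrix (Fin 2) (Fin 2) ℂ) i j := by
  simp [jost, transition_zero]

theorem hasDerivAt_jost_zero (hw : Continuous w) (j : Fin 2) {x : ℝ} (hx : 0 < x) :
    HasDerivAt (jost w z 0 j) (w x * jost w z 1 j x) x := by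
  have h1 : HasDerivAt (fun x : ℝ => Complex.exp (Complex.I * (z * x)))
      (Complex.exp (Complex.I * (z * x)) * (Complex.I * z)) x := by
    have : HasDerivAt (fun x : ℝ => Complex.I * (z * x)) (Complex.I * z) x := by
      simpa using ((Complex.ofRealCLM.hasDerivAt (x := x)).const_mul z).const_mul Complex.I
    exact this.cexp
  refine (h1.mul (hasDerivAt_transition hw z hx 0 j)).congr_deriv ?_
  simp [Matrix.mul_apply, Fin.sum_univ_two, laxU_apply, jost]
  ring

theorem hasDerivAt_jost_one (hw : Continuous w) (j : Fin 2) {x : ℝ} (hx : 0 < x) :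
    HasDerivAt (jost w z 1 j)
      (2 * Complex.I * z * jost w z 1 j x - conj (w x) * jost w z 0 j x) x := by
  have h1 : HasDerivAt (fun x : ℝ => Complex.exp (Complex.I * (z * x)))
      (Complex.exp (Complex.I * (z * x)) * (Complex.I * z)) x := by
    have : HasDerivAt (fun x : ℝ => Complex.I * (z * x)) (Complex.I * z) x := by
      simpa using ((Complex.ofRealCLM.hasDerivAt (x := x)).const_mul z).const_mul Complex.I
    exact this.cexp
  refine (h1.mul (hasDerivAt_transition hw z hx 1 j)).congr_deriv ?_
  simp [Matrix.mul_apply, Fin.sum_univ_two, laxU_apply, jost]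
  ring

/-- The anti-Hermitian matrix `Q` does not change the norm, and the diagonal part gives it the
derivative `-4 Im z` times the square of the second component. The resulting bound is uniform in the
closed upper half-plane. -/
theorem norm_sq_jost_le (hw : Continuous w) (hz : 0 ≤ z.im) (j : Fin 2) {x : ℝ} (hx : 0 ≤ x) :
    ‖jost w z 0 j x‖ ^ 2 + ‖jost w z 1 j x‖ ^ 2 ≤ 1 := by
  have hanti : AntitoneOn (fun x => ‖jost w z 0 j x‖ ^ 2 + ‖jost w z 1 j x‖ ^ 2) (Ici 0) := by
    have hd : ∀ x ∈ interior (Ici (0 : ℝ)),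
        HasDerivAt (fun x => ‖jost w z 0 j x‖ ^ 2 + ‖jost w z 1 j x‖ ^ 2)
          (-4 * z.im * ‖jost w z 1 j x‖ ^ 2) x := by
      intro x hx
      rw [interior_Ici] at hx
      refine ((hasDerivAt_jost_zero hw j hx).norm_sq.add
        (hasDerivAt_jost_one hw j hx).norm_sq).congr_deriv ?_
      rw [Complex.inner, Complex.inner, ← Complex.normSq_eq_norm_sq, Complex.normSq_apply]
      simp [Complex.mul_re, Complex.mul_im]
      ring
    refine antitoneOn_of_deriv_nonpos (convex_Ici 0)
      (((continuousOn_jost hw 0 j).norm.pow 2).add ((continuousOn_jost hw 1 j).norm.pow 2))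
      (fun x hx => (hd x hx).differentiableAt.differentiableWithinAt) fun x hx => ?_
    rw [(hd x hx).deriv]
    have := mul_nonneg hz (sq_nonneg ‖jost w z 1 j x‖)
    linarith
  refine (hanti self_mem_Ici hx hx).trans ?_
  fin_cases j <;> simp [jost_zero]

theorem norm_jost_le (hw : Continuous w) (hz : 0 ≤ z.im) (i j : Fin 2) {x : ℝ} (hx : 0 ≤ x) :
    ‖jost w z i j x‖ ≤ 1 := by
  have h := norm_sq_jost_le hw hz j hx
  rw [← sq_le_one_iff₀ (norm_nonneg _)]
  obtain rfl | rfl : i = 0 ∨ i = 1 := by fin_cases i <;> simp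
  · linarith [sq_nonneg ‖jost w z 1 j x‖]
  · linarith [sq_nonneg ‖jost w z 0 j x‖]

/-- The first component has derivative `w` times a quantity of norm at most `1`. The rate of
convergence therefore does not depend on `z`, which makes the limit continuous on the closed
half-plane and analytic inside. -/
theorem tendsto_jost (hw : Continuous w) {C : ℝ} (hC : ∀ x, 0 ≤ x → (1 + x ^ 2) * ‖w x‖ ≤ C)
    (hz : 0 ≤ z.im) (j : Fin 2) :
    Tendsto (jost w z 0 j) atTop (𝓝 (halfLineTransition w z 0 j)) ∧
      ∀ a, 0 ≤ a → ‖halfLineTransition w z 0 j - jost w z 0 j a‖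
        ≤ C * (Real.pi / 2 - Real.arctan a) := by
  obtain ⟨l, hl, h⟩ := exists_tendsto_of_norm_deriv_le (continuousOn_jost (z := z) hw 0 j)
    (fun x hx => hasDerivAt_jost_zero hw j hx) (C := C) (fun x hx => by
      rw [norm_mul, ← mul_assoc]
      exact (mul_le_of_le_one_right (by positivity) (norm_jost_le hw hz 1 j hx.le)).trans
        (hC x hx.le))
  have e : halfLineTransition w z 0 j = l := by
    rw [halfLineTransition, Matrix.of_apply]
    refine Tendsto.limUnder_eq (hl.congr fun L => ?_)
    simp [expSigma3, Matrix.mul_apply, Fin.sum_univ_two, jost]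
  rw [e]
  exact ⟨hl, h⟩

theorem tendstoUniformlyOn_jost (hw : Continuous w) {C : ℝ}
    (hC : ∀ x, 0 ≤ x → (1 + x ^ 2) * ‖w x‖ ≤ C) (j : Fin 2) :
    TendstoUniformlyOn (fun (L : ℝ) z => jost w z 0 j L) (fun z => halfLineTransition w z 0 j) atTop
      {z | 0 ≤ z.im} := by
  rw [Metric.tendstoUniformlyOn_iff]
  intro ε hε
  have hlim : Tendsto (fun a => C * (Real.pi / 2 - Real.arctan a)) atTop (𝓝 0) := by
    have h := ((tendsto_nhds_of_tendsto_nhdsWithin Real.tendsto_arctan_atTop).const_sub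
      (Real.pi / 2)).const_mul C
    rwa [sub_self, mul_zero] at h
  filter_upwards [hlim.eventually (gt_mem_nhds hε), eventually_ge_atTop 0] with a ha ha0 z hz
  rw [dist_eq_norm]
  exact ((tendsto_jost hw hC hz j).2 a ha0).trans_lt ha

theorem differentiable_jost (hw : Continuous w) (i j : Fin 2) {x : ℝ} (hx : 0 ≤ x) :
    Differentiable ℂ fun z => jost w z i j x :=
  Differentiable.mul (by fun_prop) (differentiable_transition hw hx i j)

theorem continuousOn_halfLineTransition (hw : Continuous w) {C : ℝ}
    (hC : ∀ x, 0 ≤ x → (1 + x ^ 2) * ‖w x‖ ≤ C) (j : Fin 2) :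
    ContinuousOn (fun z => halfLineTransition w z 0 j) {z | 0 ≤ z.im} :=
  (tendstoUniformlyOn_jost hw hC j).continuousOn <| Eventually.frequently <| by
    filter_upwards [eventually_ge_atTop 0] with x hx
    exact (differentiable_jost hw 0 j hx).continuous.continuousOn

theorem differentiableOn_halfLineTransition (hw : Continuous w) {C : ℝ}
    (hC : ∀ x, 0 ≤ x → (1 + x ^ 2) * ‖w x‖ ≤ C) (j : Fin 2) :
    DifferentiableOn ℂ (fun z => halfLineTransition w z 0 j) {z | 0 < z.im} := by
  refine ((tendstoUniformlyOn_jost hw hC j).mono fun z hz => le_of_lt hz).tendstoLocallyUniformlyOn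
    |>.differentiableOn ?_ (isOpen_lt continuous_const Complex.continuous_im)
  filter_upwards [eventually_ge_atTop 0] with x hx
  exact (differentiable_jost hw 0 j hx).differentiableOn

/-- The truncated formal solution solves the Riccati equation up to a small residual. -/
theorem riccati_truncation {a a' : ℕ → ℂ} {u v z y : ℂ} (hzy : z * y = 1) (h0 : a 0 = 0)
    (h : ∀ n, a' n = -2 * Complex.I * a (n + 1) + (if n = 0 then u else 0)
      + v * ∑ i ∈ Finset.range (n + 1), a i * a (n - i)) (n : ℕ) :
    ∑ k ∈ Finset.range (n + 1), a' k * y ^ k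
      = -2 * Complex.I * z * (∑ k ∈ Finset.range (n + 1), a k * y ^ k) + u
        + v * (∑ k ∈ Finset.range (n + 1), a k * y ^ k) ^ 2
        + (-2 * Complex.I * a (n + 1) * y ^ n - v * ∑ m ∈ Finset.range (n + 1),
          ∑ k ∈ Finset.Ico (n + 1 - m) (n + 1), a m * a k * y ^ (m + k)) := by
  have h1 : ∑ k ∈ Finset.range (n + 1), a (k + 1) * y ^ k
      = z * (∑ k ∈ Finset.range (n + 1), a k * y ^ k) + a (n + 1) * y ^ n := by
    have e : ∑ k ∈ Finset.range (n + 1), a (k + 1) * y ^ (k + 1)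
        = (∑ k ∈ Finset.range (n + 1), a k * y ^ k) + a (n + 1) * y ^ (n + 1) := by
      rw [← Finset.sum_range_succ, Finset.sum_range_succ' _ (n + 1), h0]
      simp
    have e2 : ∑ k ∈ Finset.range (n + 1), a (k + 1) * y ^ k
        = z * ∑ k ∈ Finset.range (n + 1), a (k + 1) * y ^ (k + 1) := by
      rw [Finset.mul_sum]
      refine Finset.sum_congr rfl fun k _ => ?_
      rw [pow_succ]
      linear_combination (-(a (k + 1) * y ^ k)) * hzy
    rw [e2, e, pow_succ]
    linear_combination (a (n + 1) * y ^ n) * hzy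
  have h2 : ∑ k ∈ Finset.range (n + 1), (if k = 0 then u else 0) * y ^ k = u := by
    rw [Finset.sum_eq_single 0] <;> simp +contextual
  -- The square splits into the Cauchy products of degree at most `n`, which belong to the
  -- recursion, and the products of degree above `n`, which go into the residual.
  have h3 : (∑ k ∈ Finset.range (n + 1), a k * y ^ k) ^ 2
      = ∑ k ∈ Finset.range (n + 1), (∑ i ∈ Finset.range (k + 1), a i * a (k - i)) * y ^ k
        + ∑ m ∈ Finset.range (n + 1), ∑ k ∈ Finset.Ico (n + 1 - m) (n + 1),
          a m * a k * y ^ (m + k) := by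
    have e : ∑ k ∈ Finset.range (n + 1), (∑ i ∈ Finset.range (k + 1), a i * a (k - i)) * y ^ k
        = ∑ m ∈ Finset.range (n + 1), ∑ k ∈ Finset.range (n + 1 - m), a m * a k * y ^ (m + k) := by
      rw [← Finset.sum_range_diag_flip (n + 1) (fun m k => a m * a k * y ^ (m + k))]
      refine Finset.sum_congr rfl fun k _ => ?_
      rw [Finset.sum_mul]
      refine Finset.sum_congr rfl fun i hi => ?_
      rw [Nat.add_sub_cancel' (Nat.lt_succ_iff.1 (Finset.mem_range.1 hi))]
    rw [e, ← Finset.sum_add_distrib, sq, Finset.sum_mul_sum]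
    refine Finset.sum_congr rfl fun m _ => ?_
    rw [Finset.range_eq_Ico, Finset.range_eq_Ico,
      Finset.sum_Ico_consecutive _ (Nat.zero_le _) (Nat.sub_le _ _)]
    exact Finset.sum_congr rfl fun k _ => by ring
  have h4 : ∑ k ∈ Finset.range (n + 1), a' k * y ^ k
      = -2 * Complex.I * (∑ k ∈ Finset.range (n + 1), a (k + 1) * y ^ k)
        + ∑ k ∈ Finset.range (n + 1), (if k = 0 then u else 0) * y ^ k
        + v * ∑ k ∈ Finset.range (n + 1), (∑ i ∈ Finset.range (k + 1), a i * a (k - i)) * y ^ k := by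
    rw [Finset.mul_sum, Finset.mul_sum, ← Finset.sum_add_distrib, ← Finset.sum_add_distrib]
    refine Finset.sum_congr rfl fun k _ => ?_
    rw [h]
    ring
  rw [h4, h1, h2, h3]
  ring

/-- Applied to each Riccati coefficient `a k`, the limits `m` become the coefficients of the
exponent in the Jost expansion. Clamping by `max s 0` makes the integrand continuous on `ℝ` without
changing it on the half-line. -/
theorem exists_primitive_limit (hw : Continuous w) {C A : ℝ}
    (hC : ∀ x, 0 ≤ x → (1 + x ^ 2) * ‖w x‖ ≤ C) {a : ℝ → ℂ} (ha : ContinuousOn a (Ici 0))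
    (hA : ∀ x, 0 ≤ x → (1 + x ^ 2) * ‖a x‖ ≤ A) :
    ∃ (G : ℝ → ℂ) (m : ℂ), G 0 = 0 ∧ Continuous G ∧
      (∀ x, 0 < x → HasDerivAt G (conj (w x) * a x) x) ∧ Tendsto G atTop (𝓝 m) ∧
      ∃ B, ‖m‖ ≤ B ∧ ∀ x, 0 ≤ x → ‖G x‖ ≤ B := by
  have hc : Continuous fun s => conj (w s) * a (max s 0) := by
    refine Continuous.mul (by fun_prop) ?_
    exact ha.comp_continuous (by fun_prop) fun x => mem_Ici.2 (le_max_right _ _)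
  have hd : ∀ x, 0 < x → HasDerivAt (fun x => ∫ s in (0 : ℝ)..x, conj (w s) * a (max s 0))
      (conj (w x) * a x) x := fun x hx => by
    have := (hc.integral_hasStrictDerivAt 0 x).hasDerivAt
    rwa [max_eq_left hx.le] at this
  have hcont : Continuous fun x => ∫ s in (0 : ℝ)..x, conj (w s) * a (max s 0) :=
    intervalIntegral.continuous_primitive (fun a b => hc.intervalIntegrable _ _) 0
  have hA0 : 0 ≤ A := le_trans (by positivity) (hA 0 le_rfl)
  have hC0 : 0 ≤ C := le_trans (by positivity) (hC 0 le_rfl)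
  obtain ⟨m, hm, hb⟩ := exists_tendsto_of_norm_deriv_le (C := C * A) hcont.continuousOn hd
    fun x hx => by
      have h1 : ‖a x‖ ≤ A :=
        le_trans (le_mul_of_one_le_left (norm_nonneg _) (by nlinarith [sq_nonneg x])) (hA x hx.le)
      rw [norm_mul, RCLike.norm_conj, ← mul_assoc]
      exact mul_le_mul (hC x hx.le) h1 (norm_nonneg _) hC0
  refine ⟨_, m, by simp, hcont, hd, hm, ‖m‖ + C * A * (Real.pi / 2), ?_, fun x hx => ?_⟩
  · have := mul_nonneg (mul_nonneg hC0 hA0) Real.pi_div_two_pos.le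
    linarith
  · have h1 := hb x hx
    have h2 : C * A * (Real.pi / 2 - Real.arctan x) ≤ C * A * (Real.pi / 2) := by
      have := Real.arctan_nonneg.2 hx
      have := mul_nonneg hC0 hA0
      gcongr
      linarith
    have h3 := norm_sub_norm_le (∫ s in (0 : ℝ)..x, conj (w s) * a (max s 0)) m
    rw [norm_sub_rev] at h3
    linarith

/-- The asymptotic expansion of the first row of `T_∞(z)`, in the closed upper half-plane. -/
theorem exists_jost_expansion (hw : Continuous w) {C : ℝ}
    (hC : ∀ x, 0 ≤ x → (1 + x ^ 2) * ‖w x‖ ≤ C) {a a' : ℕ → ℝ → ℂ}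
    (h0 : ∀ x ∈ Ici (0 : ℝ), a 0 x = 0)
    (hd : ∀ n, ∀ x ∈ Ici (0 : ℝ), HasDerivWithinAt (a n) (a' n x) (Ici 0) x)
    (ha' : ∀ n, ∀ x ∈ Ici (0 : ℝ), a' n x = -2 * Complex.I * a (n + 1) x
        + (if n = 0 then w x else 0)
        + conj (w x) * ∑ i ∈ Finset.range (n + 1), a i x * a (n - i) x)
    (hb : ∀ n, ∃ A : ℝ, ∀ x ∈ Ici (0 : ℝ), (1 + x ^ 2) * ‖a n x‖ ≤ A) (n : ℕ) :
    ∃ (m : ℕ → ℂ) (K : ℝ), ∀ z : ℂ, 0 ≤ z.im → 1 ≤ ‖z‖ → ∀ j : Fin 2,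
      ‖halfLineTransition w z 0 j - Complex.exp (∑ k ∈ Finset.range (n + 1), m k * z⁻¹ ^ k)
        * (if j = 0 then 1 else -∑ k ∈ Finset.range (n + 1), a k 0 * z⁻¹ ^ k)‖
      ≤ K * ‖z⁻¹‖ ^ n := by
  choose A hA using hb
  have hcont : ∀ k, ContinuousOn (a k) (Ici 0) := fun k x hx => (hd k x hx).continuousWithinAt
  choose G m hG0 hGc hGd hGm B hmB hGB using fun k => exists_primitive_limit hw hC (hcont k) (hA k)
  have hA0 : ∀ k, 0 ≤ A k := fun k => le_trans (by positivity) (hA k 0 self_mem_Ici)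
  have hC0 : 0 ≤ C := le_trans (by positivity) (hC 0 le_rfl)
  have hle : ∀ k x, 0 ≤ x → ‖a k x‖ ≤ A k := fun k x hx =>
    le_trans (le_mul_of_one_le_left (norm_nonneg _) (by nlinarith [sq_nonneg x])) (hA k x hx)
  set Bs := ∑ k ∈ Finset.range (n + 1), B k
  set Kr := 2 * A (n + 1) + ∑ p ∈ Finset.range (n + 1),
    ∑ k ∈ Finset.Ico (n + 1 - p) (n + 1), C * (A p * A k) with hKr
  refine ⟨m, Real.exp Bs * (Real.exp Bs * Kr * (Real.pi / 2)), fun z hz hz1 j => ?_⟩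
  set y := z⁻¹
  have hz0 : z ≠ 0 := norm_pos_iff.1 (by linarith)
  have hzy : z * y = 1 := mul_inv_cancel₀ hz0
  have hy1 : ‖y‖ ≤ 1 := by rw [norm_inv]; exact inv_le_one_of_one_le₀ hz1
  set s : ℝ → ℂ := fun x => ∑ k ∈ Finset.range (n + 1), a k x * y ^ k with hs
  set g : ℝ → ℂ := fun x => ∑ k ∈ Finset.range (n + 1), G k x * y ^ k with hg
  set r : ℝ → ℂ := fun x => -2 * Complex.I * a (n + 1) x * y ^ n - conj (w x) *
    ∑ p ∈ Finset.range (n + 1), ∑ k ∈ Finset.Ico (n + 1 - p) (n + 1), a p x * a k x * y ^ (p + k)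
    with hr
  have hpow : ∀ i, n ≤ i → ‖y‖ ^ i ≤ ‖y‖ ^ n := fun i hi => pow_le_pow_of_le_one (norm_nonneg _) hy1 hi
  have hsum : ∀ F : ℕ → ℂ, (∀ k, ‖F k‖ ≤ B k) →
      ‖∑ k ∈ Finset.range (n + 1), F k * y ^ k‖ ≤ Bs := fun F hF =>
    norm_sum_le_of_le _ fun k _ => by
      rw [norm_mul, norm_pow]
      exact (mul_le_of_le_one_right (norm_nonneg _) (pow_le_one₀ (norm_nonneg _) hy1)).trans (hF k)
  have hrb : ∀ x, 0 ≤ x → (1 + x ^ 2) * ‖r x‖ ≤ Kr * ‖y‖ ^ n := by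
    intro x hx
    have e1 : (1 + x ^ 2) * ‖-2 * Complex.I * a (n + 1) x * y ^ n‖ ≤ 2 * A (n + 1) * ‖y‖ ^ n := by
      simp only [norm_mul, norm_neg, Complex.norm_I, norm_pow, Complex.norm_ofNat, mul_one]
      have := mul_le_mul_of_nonneg_right (hA (n + 1) x hx) (pow_nonneg (norm_nonneg y) n)
      linarith
    have e2 : (1 + x ^ 2) * ‖conj (w x) * ∑ p ∈ Finset.range (n + 1),
        ∑ k ∈ Finset.Ico (n + 1 - p) (n + 1), a p x * a k x * y ^ (p + k)‖
        ≤ (∑ p ∈ Finset.range (n + 1),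
          ∑ k ∈ Finset.Ico (n + 1 - p) (n + 1), C * (A p * A k)) * ‖y‖ ^ n := by
      have e3 : ‖∑ p ∈ Finset.range (n + 1),
          ∑ k ∈ Finset.Ico (n + 1 - p) (n + 1), a p x * a k x * y ^ (p + k)‖
          ≤ ∑ p ∈ Finset.range (n + 1), ∑ k ∈ Finset.Ico (n + 1 - p) (n + 1),
            A p * A k * ‖y‖ ^ n := by
        refine norm_sum_le_of_le _ fun p _ => norm_sum_le_of_le _ fun k hk => ?_
        rw [norm_mul, norm_mul, norm_pow]
        have := (Finset.mem_Ico.1 hk).1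
        exact mul_le_mul (mul_le_mul (hle p x hx) (hle k x hx) (norm_nonneg _) (hA0 p))
          (hpow _ (by omega)) (by positivity) (mul_nonneg (hA0 p) (hA0 k))
      rw [norm_mul, RCLike.norm_conj, ← mul_assoc]
      refine (mul_le_mul (hC x hx) e3 (norm_nonneg _) hC0).trans (le_of_eq ?_)
      simp only [Finset.mul_sum, Finset.sum_mul]
      exact Finset.sum_congr rfl fun p _ => Finset.sum_congr rfl fun k _ => by ring
    calc (1 + x ^ 2) * ‖r x‖ ≤ _ := mul_le_mul_of_nonneg_left (norm_sub_le _ _) (by positivity)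
      _ ≤ Kr * ‖y‖ ^ n := by rw [hKr]; linarith
  -- The truncation solves the Riccati equation up to `r`, which is of order `y ^ n` and, by `hrb`,
  -- integrable in `x` uniformly in `z`.
  have hsd : ∀ x, 0 < x → HasDerivAt s (-2 * Complex.I * z * s x + w x + conj (w x) * s x ^ 2 + r x) x := by
    intro x hx
    rw [← riccati_truncation hzy (h0 x hx.le) (a' := fun k => a' k x) (fun k => ha' k x hx.le) n]
    exact HasDerivAt.fun_sum fun k _ => ((hd k x hx.le).hasDerivAt (Ici_mem_nhds hx)).mul_const _
  have hgd : ∀ x, 0 < x → HasDerivAt g (conj (w x) * s x) x := by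
    intro x hx
    rw [hs, Finset.mul_sum]
    simp only [← mul_assoc]
    exact HasDerivAt.fun_sum fun k _ => (hGd k x hx).mul_const _
  have hgc : Continuous g := continuous_finsetSum _ fun k _ => (hGc k).mul continuous_const
  have hsc : ContinuousOn s (Ici 0) := continuousOn_finsetSum _ fun k _ => (hcont k).mul continuousOn_const
  have hgl : Tendsto g atTop (𝓝 (∑ k ∈ Finset.range (n + 1), m k * y ^ k)) :=
    tendsto_finsetSum _ fun k _ => (hGm k).mul_const _
  have hsl : Tendsto s atTop (𝓝 0) := by
    have : Tendsto s atTop (𝓝 (∑ k ∈ Finset.range (n + 1), 0 * y ^ k)) := by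
      refine tendsto_finsetSum _ fun k _ => Tendsto.mul_const _ ?_
      have hlim : Tendsto (fun x : ℝ => A k / (1 + x ^ 2)) atTop (𝓝 0) :=
        Tendsto.const_div_atTop (tendsto_atTop_add_const_left _ _ (tendsto_pow_atTop two_ne_zero)) _
      refine squeeze_zero_norm' ?_ hlim
      filter_upwards [eventually_ge_atTop 0] with x hx
      rw [le_div_iff₀ (by positivity), mul_comm]
      exact hA k x hx
    simpa using this
  set g' := ∑ k ∈ Finset.range (n + 1), m k * y ^ k with hg'
  -- Let `φ₀`, `φ₁` be the components of a Jost column. Since `g` has derivative `conj w * s`, in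
  -- the derivative of `exp(-g) (φ₀ - s φ₁)` everything cancels except `-exp(-g) r φ₁`. So this
  -- quantity changes by `O(yⁿ)` between `0`, where it is `1` or `-s 0`, and infinity, where `s → 0`
  -- and it is `exp(-g')` times the entry of `T_∞`.
  obtain ⟨l, hl, hlb⟩ := exists_tendsto_of_norm_deriv_le
    (f := fun x => Complex.exp (-g x) * (jost w z 0 j x - s x * jost w z 1 j x))
    (f' := fun x => Complex.exp (-g x) * (-(r x * jost w z 1 j x)))
    (C := Real.exp Bs * Kr * ‖y‖ ^ n)
    (ContinuousOn.mul (by fun_prop) ((continuousOn_jost hw 0 j).sub (hsc.mul (continuousOn_jost hw 1 j))))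
    (fun x hx => by
      refine ((hgd x hx).neg.cexp.mul ((hasDerivAt_jost_zero hw j hx).sub
        ((hsd x hx).mul (hasDerivAt_jost_one hw j hx)))).congr_deriv ?_
      simp only [Pi.neg_apply, Pi.sub_apply, Pi.mul_apply]
      ring)
    (fun x hx => by
      have h1 : ‖Complex.exp (-g x)‖ ≤ Real.exp Bs := by
        refine (Complex.norm_exp_le_exp_norm _).trans (Real.exp_le_exp.2 ?_)
        rw [norm_neg]
        exact hsum (fun k => G k x) fun k => hGB k x hx.le
      have h2 : (1 + x ^ 2) * (‖r x‖ * ‖jost w z 1 j x‖) ≤ Kr * ‖y‖ ^ n := by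
        rw [← mul_assoc]
        exact (mul_le_of_le_one_right (by positivity) (norm_jost_le hw hz 1 j hx.le)).trans
          (hrb x hx.le)
      rw [norm_mul, norm_neg, norm_mul]
      calc _ = ‖Complex.exp (-g x)‖ * ((1 + x ^ 2) * (‖r x‖ * ‖jost w z 1 j x‖)) := by ring
        _ ≤ Real.exp Bs * (Kr * ‖y‖ ^ n) := mul_le_mul h1 h2 (by positivity) (Real.exp_nonneg _)
        _ = _ := by ring)
  have hl' : l = Complex.exp (-g') * halfLineTransition w z 0 j := by
    refine tendsto_nhds_unique hl ?_
    have h1 : Tendsto (fun x => s x * jost w z 1 j x) atTop (𝓝 0) := by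
      refine squeeze_zero_norm' ?_ (tendsto_zero_iff_norm_tendsto_zero.1 hsl)
      filter_upwards [eventually_ge_atTop 0] with x hx
      rw [norm_mul]
      exact mul_le_of_le_one_right (norm_nonneg _) (norm_jost_le hw hz 1 j hx)
    simpa using ((Complex.continuous_exp.tendsto _).comp hgl.neg).mul
      ((tendsto_jost hw hC hz j).1.sub h1)
  have h1 := hlb 0 le_rfl
  have hg00 : g 0 = 0 := by simp [hg, hG0]
  have hj0 : jost w z 0 j 0 - s 0 * jost w z 1 j 0 = if j = 0 then 1 else -s 0 := by
    rw [jost_zero, jost_zero]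
    obtain rfl | rfl : j = 0 ∨ j = 1 := by fin_cases j <;> simp
    all_goals simp
  simp only [hg00, hj0, neg_zero, Complex.exp_zero, one_mul, Real.arctan_zero, sub_zero] at h1
  have h2 : halfLineTransition w z 0 j - Complex.exp g' * (if j = 0 then 1 else -s 0)
      = Complex.exp g' * (l - if j = 0 then 1 else -s 0) := by
    rw [hl', mul_sub, ← mul_assoc, ← Complex.exp_add, add_neg_cancel, Complex.exp_zero, one_mul]
  rw [h2, norm_mul]
  have h3 : ‖Complex.exp g'‖ ≤ Real.exp Bs :=
    (Complex.norm_exp_le_exp_norm _).trans (Real.exp_le_exp.2 (hsum m hmB))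
  calc _ ≤ Real.exp Bs * (Real.exp Bs * Kr * ‖y‖ ^ n * (Real.pi / 2)) :=
        mul_le_mul h3 h1 (norm_nonneg _) (Real.exp_nonneg _)
    _ = _ := by ring

end Jost

/-! ### Algebra of the scattering functions; unitarity on the real axis. -/

section Scattering

open MeasureTheory Set Filter

theorem halfLineTransition_congr {u w : ℝ → ℂ} (h : ∀ x, 0 ≤ x → u x = w x) (z : ℂ) :
    halfLineTransition u z = halfLineTransition w z := by
  ext i j
  simp only [halfLineTransition, Matrix.of_apply, limUnder]
  congr 1
  refine Filter.map_congr ?_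
  filter_upwards [eventually_ge_atTop 0] with L hL
  rw [transition_congr h z hL]

theorem halfLineTransitionInv_congr {u w : ℝ → ℂ} (h : ∀ x, 0 ≤ x → u x = w x) (z : ℂ) :
    halfLineTransitionInv u z = halfLineTransitionInv w z := by
  ext i j
  simp only [halfLineTransitionInv, Matrix.of_apply, limUnder]
  congr 1
  refine Filter.map_congr ?_
  filter_upwards [eventually_ge_atTop 0] with L hL
  rw [transition_congr h z hL]

variable {w : ℝ → ℂ} {C : ℝ}

theorem conj_jost (i : Fin 2) (z : ℂ) (L : ℝ) :
    conj (jost w (conj z) i 0 L) = Complex.exp (-Complex.I * (z * L)) * conj (transition w L 0 (conj z) i 0)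
    ∧ conj (jost w (conj z) i 1 L)
      = Complex.exp (-Complex.I * (z * L)) * conj (transition w L 0 (conj z) i 1) := by
  simp [jost, ← Complex.exp_conj]

/-- With determinant `1` the inverse is the adjugate, and conjugation symmetry turns its first
column into the conjugated first row at `z^*`. -/
theorem halfLineTransitionInv_eq (hw : Continuous w) (hC : ∀ x, 0 ≤ x → (1 + x ^ 2) * ‖w x‖ ≤ C)
    {z : ℂ} (hz : z.im ≤ 0) (j : Fin 2) :
    halfLineTransitionInv w z j 0 = conj (halfLineTransition w (conj z) 0 j) := by
  have hz' : 0 ≤ (conj z).im := by simpa using hz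
  rw [halfLineTransitionInv, Matrix.of_apply]
  refine Tendsto.limUnder_eq ?_
  refine ((Complex.continuous_conj.tendsto _).comp (tendsto_jost hw hC hz' j).1).congr' ?_
  filter_upwards [eventually_ge_atTop 0] with L hL
  have h1 := conj_jost (w := w) 0 z L
  have h2 := transition_conj w z L 0
  rw [Matrix.inv_def, det_transition hw z hL, Ring.inverse_one, one_smul, Matrix.adjugate_fin_two]
  obtain rfl | rfl : j = 0 ∨ j = 1 := by fin_cases j <;> simp
  · simp [h1.1, Matrix.mul_apply, Fin.sum_univ_two, expSigma3, h2.1, mul_comm]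
  · simp [h1.2, Matrix.mul_apply, Fin.sum_univ_two, expSigma3, h2.2, mul_comm]

theorem halfLineTransition_one_eq (hw : Continuous w)
    (hC : ∀ x, 0 ≤ x → (1 + x ^ 2) * ‖w x‖ ≤ C) {z : ℂ} (hz : z.im ≤ 0) :
    halfLineTransition w z 1 0 = -conj (halfLineTransition w (conj z) 0 1) ∧
      halfLineTransition w z 1 1 = conj (halfLineTransition w (conj z) 0 0) := by
  have hz' : 0 ≤ (conj z).im := by simpa using hz
  have h1 := conj_jost (w := w) 0 z
  have h2 := fun L => transition_conj w z L 0
  constructor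
  · rw [halfLineTransition, Matrix.of_apply]
    refine Tendsto.limUnder_eq ?_
    refine ((Complex.continuous_conj.tendsto _).comp (tendsto_jost hw hC hz' 1).1).neg.congr fun L => ?_
    simp [(h1 L).2, Matrix.mul_apply, Fin.sum_univ_two, expSigma3, (h2 L).2]
  · rw [halfLineTransition, Matrix.of_apply]
    refine Tendsto.limUnder_eq ?_
    refine ((Complex.continuous_conj.tendsto _).comp (tendsto_jost hw hC hz' 0).1).congr fun L => ?_
    simp [(h1 L).1, Matrix.mul_apply, Fin.sum_univ_two, expSigma3, (h2 L).1]

theorem halfLineTransition_unitary (hw : Continuous w)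
    (hC : ∀ x, 0 ≤ x → (1 + x ^ 2) * ‖w x‖ ≤ C) (x : ℝ) :
    halfLineTransition w x 0 0 * conj (halfLineTransition w x 0 0)
      + halfLineTransition w x 0 1 * conj (halfLineTransition w x 0 1) = 1 := by
  have h := fun j => (tendsto_jost (z := x) hw hC (by simp) j).1
  have h' := fun j => (Complex.continuous_conj.tendsto _).comp (h j)
  refine tendsto_nhds_unique (((h 0).mul (h' 0)).add ((h 1).mul (h' 1))) ?_
  refine tendsto_const_nhds.congr' ?_
  filter_upwards [eventually_ge_atTop 0] with L hL
  have h1 := conj_jost (w := w) 0 x L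
  have h2 := transition_conj w x L 0
  have h3 := det_transition hw x hL
  rw [Matrix.det_fin_two, h2.1, h2.2] at h3
  simp only [Complex.conj_ofReal] at h1 h3
  have h4 : Complex.exp (Complex.I * (x * L)) * Complex.exp (-Complex.I * (x * L)) = 1 := by
    rw [← Complex.exp_add]; simp
  simp only [Function.comp_apply, h1.1, h1.2]
  rw [jost, jost]
  linear_combination (-1 : ℂ) * h3 - (transition w L 0 x 0 0 * conj (transition w L 0 x 0 0)
    + transition w L 0 x 0 1 * conj (transition w L 0 x 0 1)) * h4

/-- Every limit that occurs here exists for `Im z ≥ 0`. The entries of `T_∞` whose limits may fail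
to exist do not enter the upper left entry. -/
theorem scatA_eq (k : KappaData) (K : ℂ → Matrix (Fin 2) (Fin 2) ℂ) (hw : Continuous w)
    (hC : ∀ x, 0 ≤ x → (1 + x ^ 2) * ‖w x‖ ≤ C) {z : ℂ} (hz : 0 ≤ z.im) :
    scatA k w K z = (halfLineTransition w z 0 0 * K (-z) 0 0 + halfLineTransition w z 0 1 * K (-z) 1 0)
        * conj (halfLineTransition w (-conj z) 0 0)
      + (halfLineTransition w z 0 0 * K (-z) 0 1 + halfLineTransition w z 0 1 * K (-z) 1 1)
        * conj (halfLineTransition w (-conj z) 0 1) := by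
  have h := halfLineTransitionInv_eq hw hC (z := -z) (by simpa using hz)
  rw [scatA, monodromy]
  simp only [Matrix.mul_apply, Fin.sum_univ_two, reflKPlus, h, map_neg]
  simp

theorem scatB_eq (k : KappaData) (K : ℂ → Matrix (Fin 2) (Fin 2) ℂ) (hw : Continuous w)
    (hC : ∀ x, 0 ≤ x → (1 + x ^ 2) * ‖w x‖ ≤ C) (x : ℝ) :
    scatB k w K x = (-conj (halfLineTransition w x 0 1) * K (-x) 0 0
          + conj (halfLineTransition w x 0 0) * K (-x) 1 0)
        * conj (halfLineTransition w (-x) 0 0)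
      + (-conj (halfLineTransition w x 0 1) * K (-x) 0 1
          + conj (halfLineTransition w x 0 0) * K (-x) 1 1)
        * conj (halfLineTransition w (-x) 0 1) := by
  have h := halfLineTransitionInv_eq hw hC (z := -(x : ℂ)) (by simp)
  have h2 := halfLineTransition_one_eq hw hC (z := (x : ℂ)) (by simp)
  rw [scatB, monodromy]
  simp only [Matrix.mul_apply, Fin.sum_univ_two, reflKPlus, h, map_neg, Complex.conj_ofReal, h2.1, h2.2]
  simp

/-- The upper right entry of the monodromy matrix on the real axis, without its factor `κ`. -/
def scatN (w : ℝ → ℂ) (K : ℂ → Matrix (Fin 2) (Fin 2) ℂ) (x : ℝ) : ℂ :=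
  (halfLineTransition w x 0 0 * K (-x) 0 0 + halfLineTransition w x 0 1 * K (-x) 1 0)
      * -halfLineTransition w (-x) 0 1
    + (halfLineTransition w x 0 0 * K (-x) 0 1 + halfLineTransition w x 0 1 * K (-x) 1 1)
      * halfLineTransition w (-x) 0 0

variable {k : KappaData} {J : Set ℝ} {b bx : ℝ → ℂ} {P : ℝ → Matrix (Fin 2) (Fin 2) (Polynomial ℂ)}

/-- The reflection matrix is unitary on the real axis. -/
theorem IsReflectionFamily.conj_eq (hP : IsReflectionFamily k J b bx P)
    (hbeta : ∀ j, (k.beta j).im < 0) (halpha : ∀ l, k.alpha l < 0) {t : ℝ} (ht : t ∈ J) (x : ℝ)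
    (i j : Fin 2) : reflK k (P t) (-x) i j = conj (reflK k (P t) x j i) := by
  have hg (y : ℝ) : k.g y ≠ 0 := k.g_ne_zero hbeta halpha (by simp)
  have hgn : k.g (-(x : ℂ)) ≠ 0 := by simpa using hg (-x)
  have h1 := hP.mul_neg t ht x (hg x) hgn
  have h2 := hP.involution t ht x (hg x) hgn (by simpa using hg x)
  have h3 := hP.det_eq t ht x (hg x)
  have h4 := hP.det_eq t ht (-x) hgn
  have h5 : k.kappa x * k.kappa (-x) = 1 := by
    rw [← h3, ← h4, ← Matrix.det_mul, h1, Matrix.det_one]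
  set K := reflK k (P t) x
  set L := reflK k (P t) (-x)
  -- Inverting `K` by its adjugate brings in the same factor `κ(-x)` as the involution; comparing
  -- the two identifies `K(-x)` with the adjoint of `K(x)`.
  have h6 : L = k.kappa (-x) • K.adjugate := by
    have : K.adjugate * (K * L) = k.kappa x • L := by
      rw [← Matrix.mul_assoc, Matrix.adjugate_mul, h3, Matrix.smul_mul, Matrix.one_mul]
    rw [h1, Matrix.mul_one] at this
    rw [this, smul_smul, mul_comm, h5, one_smul]
  rw [Complex.conj_ofReal, show reflK k (P t) (x : ℂ) = K from rfl] at h2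
  have e (i j : Fin 2) := congrFun (congrFun h2 i) j
  have e00 := e 0 0
  have e01 := e 0 1
  have e10 := e 1 0
  have e11 := e 1 1
  have hI := Complex.I_mul_I
  simp only [Matrix.mul_apply, Fin.sum_univ_two, Matrix.map_apply] at e00 e01 e10 e11
  simp [sigma2] at e00 e01 e10 e11
  rw [h6, Matrix.adjugate_fin_two]
  fin_cases i <;> fin_cases j <;> simp
  · change k.kappa (-x) * K 1 1 = conj (K 0 0)
    linear_combination e11 - conj (K 0 0) * hI
  · change -(k.kappa (-x) * K 0 1) = conj (K 1 0)
    linear_combination -e01 - conj (K 1 0) * hI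
  · change -(k.kappa (-x) * K 1 0) = conj (K 0 1)
    linear_combination -e10 - conj (K 0 1) * hI
  · change k.kappa (-x) * K 0 0 = conj (K 1 1)
    linear_combination e00 - conj (K 1 1) * hI

/-- The matrix `T_∞(x) K(-x) T_∞⁻¹(-x)` is a product of unitary matrices. Its first column is `(A,
B)` and its first row is `(A, N)`; replacing `x` by `-x` gives its adjoint, so `A(-x)` is the
conjugate of `A(x)`. -/
theorem scattering_relations (hP : IsReflectionFamily k J b bx P)
    (hbeta : ∀ j, (k.beta j).im < 0) (halpha : ∀ l, k.alpha l < 0) {t : ℝ} (ht : t ∈ J)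
    (hw : Continuous w) (hC : ∀ x, 0 ≤ x → (1 + x ^ 2) * ‖w x‖ ≤ C) (x : ℝ) :
    ‖scatA k w (reflK k (P t)) x‖ ^ 2 + ‖scatB k w (reflK k (P t)) x‖ ^ 2 = 1 ∧
    ‖scatA k w (reflK k (P t)) x‖ ^ 2 + ‖scatN w (reflK k (P t)) x‖ ^ 2 = 1 ∧
    ‖scatA k w (reflK k (P t)) (-x)‖ = ‖scatA k w (reflK k (P t)) x‖ := by
  have hg (y : ℝ) : k.g y ≠ 0 := k.g_ne_zero hbeta halpha (by simp)
  have hgn : k.g (-(x : ℂ)) ≠ 0 := by simpa using hg (-x)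
  have h1 := hP.mul_neg t ht x (hg x) hgn
  have h1' := mul_eq_one_comm.1 h1
  have hc := hP.conj_eq hbeta halpha ht x
  have hp := halfLineTransition_unitary hw hC x
  have hr := halfLineTransition_unitary hw hC (-x)
  rw [scatA_eq k _ hw hC (z := x) (by simp), scatB_eq k _ hw hC x, scatN,
    scatA_eq k _ hw hC (z := -(x : ℂ)) (by simp)]
  rw [Complex.ofReal_neg] at hr
  simp only [Complex.conj_ofReal, neg_neg, map_neg]
  have u (i j : Fin 2) := congrFun (congrFun h1 i) j
  have v (i j : Fin 2) := congrFun (congrFun h1' i) j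
  have u00 := u 0 0; have u01 := u 0 1; have u10 := u 1 0; have u11 := u 1 1
  have v00 := v 0 0; have v01 := v 0 1; have v10 := v 1 0; have v11 := v 1 1
  simp only [Matrix.mul_apply, Fin.sum_univ_two, Matrix.one_apply_eq, hc] at u00 u01 u10 u11 v00 v01 v10 v11
  simp only [Matrix.one_apply_ne (show (0 : Fin 2) ≠ 1 by decide),
    Matrix.one_apply_ne (show (1 : Fin 2) ≠ 0 by decide)] at u00 u01 u10 u11 v00 v01 v10 v11
  simp only [hc]
  generalize reflK k (P t) x 0 0 = K00 at *
  generalize reflK k (P t) x 0 1 = K01 at *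
  generalize reflK k (P t) x 1 0 = K10 at *
  generalize reflK k (P t) x 1 1 = K11 at *
  generalize halfLineTransition w x 0 0 = p0 at *
  generalize halfLineTransition w x 0 1 = p1 at *
  generalize halfLineTransition w (-x) 0 0 = r0 at *
  generalize halfLineTransition w (-x) 0 1 = r1 at *
  refine ⟨?_, ?_, ?_⟩
  · rw [← Complex.ofReal_inj]
    push_cast
    rw [← Complex.mul_conj', ← Complex.mul_conj']
    simp only [map_add, map_mul, map_neg, Complex.conj_conj]
    linear_combination (p0 * conj p0 + p1 * conj p1) * (r0 * conj r0 * u00 + conj r0 * r1 * u10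
      + conj r1 * r0 * u01 + conj r1 * r1 * u11 + hr) + hp
  · rw [← Complex.ofReal_inj]
    push_cast
    rw [← Complex.mul_conj', ← Complex.mul_conj']
    simp only [map_add, map_mul, map_neg, Complex.conj_conj]
    linear_combination (r0 * conj r0 + r1 * conj r1) * (p0 * conj p0 * v00 + p0 * conj p1 * v01
      + p1 * conj p0 * v10 + p1 * conj p1 * v11 + hp) + hr
  · rw [← RCLike.norm_conj]
    congr 1
    simp only [map_add, map_mul, Complex.conj_conj]
    ring

end Scattering

/-! ### Calculus of expansions in `h = 1/z`; expansion of `A`, and decay of the off-diagonal entry.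
-/

section Expansions

open MeasureTheory Set Filter PowerSeries
open Asymptotics hiding IsLittleOTVS

/-- Along `l`, the function `f` agrees with the analytic function `F` of the small quantity `h`, up
to an error of order `h ^ n`. -/
structure HasExpansion {X : Type*} (l : Filter X) (h f : X → ℂ) (n : ℕ) (F : ℂ → ℂ) : Prop where
  analyticAt : AnalyticAt ℂ F 0
  isBigO : (fun x => f x - F (h x)) =O[l] fun x => h x ^ n

namespace HasExpansion

variable {X : Type*} {l : Filter X} {h f g : X → ℂ} {n : ℕ} {F G : ℂ → ℂ}

theorem of_eq (hF : AnalyticAt ℂ F 0) (h : X → ℂ) (n : ℕ) (hf : ∀ᶠ x in l, f x = F (h x)) :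
    HasExpansion l h f n F :=
  ⟨hF, (isBigO_zero _ _).congr' (hf.mono fun x hx => by simp [hx]) EventuallyEq.rfl⟩

theorem add (hf : HasExpansion l h f n F) (hg : HasExpansion l h g n G) :
    HasExpansion l h (fun x => f x + g x) n (fun y => F y + G y) :=
  ⟨hf.1.fun_add hg.1, (hf.2.add hg.2).congr_left fun x => by ring⟩

theorem neg (hf : HasExpansion l h f n F) : HasExpansion l h (fun x => -f x) n (fun y => -F y) :=
  ⟨hf.1.fun_neg, hf.2.neg_left.congr_left fun x => by ring⟩

theorem isBigO_one (hf : HasExpansion l h f n F) (hh : Tendsto h l (𝓝 0)) :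
    f =O[l] fun _ => (1 : ℂ) := by
  have h1 : (fun x => F (h x)) =O[l] fun _ => (1 : ℂ) :=
    (hf.1.continuousAt.tendsto.comp hh).isBigO_one ℂ
  have h2 : (fun x => h x ^ n) =O[l] fun _ => (1 : ℂ) := (hh.pow n).isBigO_one ℂ
  exact ((hf.2.trans h2).add h1).congr_left fun x => by ring

theorem mul (hf : HasExpansion l h f n F) (hg : HasExpansion l h g n G) (hh : Tendsto h l (𝓝 0)) :
    HasExpansion l h (fun x => f x * g x) n (fun y => F y * G y) := by
  refine ⟨hf.1.fun_mul hg.1, ?_⟩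
  have h1 : (fun x => F (h x)) =O[l] fun _ => (1 : ℂ) :=
    (hf.1.continuousAt.tendsto.comp hh).isBigO_one ℂ
  refine (((hf.2.mul (hg.isBigO_one hh)).add ((h1.mul hg.2).congr_right
    (g₂ := fun x => h x ^ n * 1) fun x => by ring)).congr_left fun x => ?_).congr_right fun x => mul_one _
  ring

theorem comp_neg (hf : HasExpansion l (fun x => -h x) f n F) :
    HasExpansion l h f n (fun y => F (-y)) := by
  refine ⟨AnalyticAt.fun_comp (by simpa using hf.1) (by fun_prop), hf.2.trans ?_⟩
  exact (isBigO_of_le _ fun x => by simp)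

theorem conj_conj (hf : HasExpansion l (fun x => conj (h x)) f n F) :
    HasExpansion l h (fun x => conj (f x)) n (fun y => conj (F (conj y))) := by
  constructor
  · have h1 := hf.1
    rw [Complex.analyticAt_iff_eventually_differentiableAt] at h1 ⊢
    have h2 : Tendsto (fun z : ℂ => conj z) (𝓝 0) (𝓝 0) := by
      simpa using Complex.continuous_conj.tendsto 0
    filter_upwards [h2.eventually h1] with z hz
    simpa [Function.comp_def] using DifferentiableAt.conj_conj hz
  · refine IsBigO.of_norm_norm (hf.2.norm_norm.congr (fun x => ?_) fun x => by simp)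
    rw [← RCLike.norm_conj, map_sub]

end HasExpansion

variable {w : ℝ → ℂ} {C : ℝ} {b : ℕ → ℂ}

/-- The half-line Jost coefficients have expansions to all orders in `z⁻¹`, in which the quotient
of the second by the first is given by the coefficients `-b`. -/
def HasJostExpansion (w : ℝ → ℂ) (b : ℕ → ℂ) : Prop :=
  ∀ n, ∃ (m : ℕ → ℂ) (K : ℝ), ∀ z : ℂ, 0 ≤ z.im → 1 ≤ ‖z‖ → ∀ j : Fin 2,
    ‖halfLineTransition w z 0 j - Complex.exp (∑ k ∈ Finset.range (n + 1), m k * z⁻¹ ^ k)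
      * (if j = 0 then 1 else -∑ k ∈ Finset.range (n + 1), b k * z⁻¹ ^ k)‖ ≤ K * ‖z⁻¹‖ ^ n

/-- The scalar factor `E` is chosen before the filter and the small quantity, since the same `E`
must serve at `z` and at `-z` or `-z^*` within one product. -/
theorem HasJostExpansion.hasExpansion (hb : HasJostExpansion w b) (n : ℕ) :
    ∃ E : ℂ → ℂ, AnalyticAt ℂ E 0 ∧ ∀ (X : Type) (l : Filter X) (h : X → ℂ), Tendsto h l (𝓝 0) →
      (∀ᶠ x in l, h x ≠ 0 ∧ 0 ≤ ((h x)⁻¹).im) →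
      HasExpansion l h (fun x => halfLineTransition w (h x)⁻¹ 0 0) n E ∧
      HasExpansion l h (fun x => halfLineTransition w (h x)⁻¹ 0 1) n
        (fun y => -(E y * ∑ k ∈ Finset.range (n + 1), b k * y ^ k)) := by
  obtain ⟨m, K, hK⟩ := hb n
  have hE : AnalyticAt ℂ
      (fun y : ℂ => Complex.exp (∑ k ∈ Finset.range (n + 1), m k * y ^ k)) 0 := by fun_prop
  refine ⟨_, hE, fun X l h hh hl => ?_⟩
  have h1 : ∀ᶠ x in l, ‖h x‖ ≤ 1 := by
    have := hh.norm
    rw [norm_zero] at this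
    exact (this.eventually (gt_mem_nhds one_pos)).mono fun x hx => hx.le
  have h2 : ∀ᶠ x in l, ∀ j : Fin 2, ‖halfLineTransition w (h x)⁻¹ 0 j
      - Complex.exp (∑ k ∈ Finset.range (n + 1), m k * (h x) ^ k)
      * (if j = 0 then 1 else -∑ k ∈ Finset.range (n + 1), b k * (h x) ^ k)‖ ≤ K * ‖h x ^ n‖ := by
    filter_upwards [h1, hl] with x hx hx' j
    have := hK (h x)⁻¹ hx'.2
      (by rw [norm_inv]; exact (one_le_inv₀ (norm_pos_iff.2 hx'.1)).2 hx) j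
    rwa [inv_inv, ← norm_pow] at this
  refine ⟨⟨hE, .of_bound K (h2.mono fun x hx => by simpa using hx 0)⟩,
    ⟨by fun_prop, .of_bound K (h2.mono fun x hx => by simpa using hx 1)⟩⟩

/-- The denominator of the reflection matrix in the variable `h = -z⁻¹`, normalized at `h = 0`. -/
def KappaData.reflectedG (k : KappaData) (h : ℂ) : ℂ :=
  (∏ j, (-1 - conj (k.beta j) * h) * (-1 + k.beta j * h)) * ∏ l, (-1 + Complex.I * k.alpha l * h)

theorem KappaData.reflectedG_eq (k : KappaData) {h : ℂ} (hh : h ≠ 0) :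
    k.reflectedG h = h ^ (2 * k.numBeta + k.numAlpha) * k.g (-h⁻¹) := by
  have h1 : k.g (-h⁻¹) = (∏ j, (-h⁻¹ - conj (k.beta j)) * (-h⁻¹ + k.beta j))
      * ∏ l, (-h⁻¹ + Complex.I * k.alpha l) := by
    simp [KappaData.g, KappaData.f, map_prod]
  have h2 : h ^ (2 * k.numBeta + k.numAlpha)
      = (∏ _j : Fin k.numBeta, h * h) * ∏ _l : Fin k.numAlpha, h := by
    simp [pow_add, pow_mul, sq]
  rw [h1, h2, mul_mul_mul_comm, ← Finset.prod_mul_distrib, ← Finset.prod_mul_distrib,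
    KappaData.reflectedG]
  congr 1 <;> refine Finset.prod_congr rfl fun j _ => ?_ <;> field_simp

theorem KappaData.reflectedG_zero_ne (k : KappaData) : k.reflectedG 0 ≠ 0 := by
  simp [KappaData.reflectedG]

theorem KappaData.analyticAt_reflectedG (k : KappaData) : AnalyticAt ℂ k.reflectedG 0 := by
  unfold KappaData.reflectedG
  fun_prop

variable {k : KappaData} {P : Matrix (Fin 2) (Fin 2) (Polynomial ℂ)}

theorem reflK_neg_inv (hP : ∀ i j, (P i j).natDegree ≤ 2 * k.numBeta + k.numAlpha) {h : ℂ}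
    (hh : h ≠ 0) (i j : Fin 2) : reflK k P (-h⁻¹) i j
      = (reflectNeg (2 * k.numBeta + k.numAlpha) (P i j)).eval h / k.reflectedG h := by
  rw [eval_reflectNeg (hP i j) hh, k.reflectedG_eq hh, reflK, Matrix.of_apply,
    mul_div_mul_left _ _ (pow_ne_zero _ hh)]

theorem hasExpansion_reflK (hP : ∀ i j, (P i j).natDegree ≤ 2 * k.numBeta + k.numAlpha)
    {X : Type*} {l : Filter X} {h : X → ℂ} (hl : ∀ᶠ x in l, h x ≠ 0) (n : ℕ) (i j : Fin 2) :
    HasExpansion l h (fun x => reflK k P (-(h x)⁻¹) i j) n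
      (fun y => (reflectNeg (2 * k.numBeta + k.numAlpha) (P i j)).eval y / k.reflectedG y) :=
  .of_eq (AnalyticAt.fun_div ((Polynomial.differentiable _).analyticAt _) k.analyticAt_reflectedG k.reflectedG_zero_ne) _ _ <|
    hl.mono fun _ hx => reflK_neg_inv hP hx i j

theorem tendsto_inv_cobounded_inf (s : Set ℂ) :
    Tendsto (fun z : ℂ => z⁻¹) (Bornology.cobounded ℂ ⊓ 𝓟 s) (𝓝 0) :=
  tendsto_inv₀_cobounded.mono_left inf_le_left

theorem eventually_ne_zero_cobounded_inf (s : Set ℂ) :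
    ∀ᶠ z : ℂ in Bornology.cobounded ℂ ⊓ 𝓟 s, z ≠ 0 ∧ z ∈ s := by
  refine (Eventually.and ?_ ?_)
  · exact (Bornology.eventually_ne_cobounded 0).filter_mono inf_le_left
  · exact (eventually_principal.2 fun _ h => h).filter_mono inf_le_right

/-- Only the existence of some analytic `F` is recorded. Its Taylor coefficients are identified
later along the imaginary axis. -/
theorem exists_hasExpansion_scatA (hw : Continuous w)
    (hC : ∀ x, 0 ≤ x → (1 + x ^ 2) * ‖w x‖ ≤ C) (hb : HasJostExpansion w b)
    (hP : ∀ i j, (P i j).natDegree ≤ 2 * k.numBeta + k.numAlpha) (n : ℕ) :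
    ∃ F : ℂ → ℂ, HasExpansion (Bornology.cobounded ℂ ⊓ 𝓟 {z : ℂ | 0 ≤ z.im}) (fun z => z⁻¹)
      (scatA k w (reflK k P)) n F := by
  set l := Bornology.cobounded ℂ ⊓ 𝓟 {z : ℂ | 0 ≤ z.im}
  have ht : Tendsto (fun z : ℂ => z⁻¹) l (𝓝 0) := tendsto_inv_cobounded_inf _
  have hl : ∀ᶠ z in l, z ≠ 0 ∧ 0 ≤ z.im := eventually_ne_zero_cobounded_inf _
  have hl' : ∀ᶠ z : ℂ in l, z⁻¹ ≠ 0 := hl.mono fun z hz => inv_ne_zero hz.1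
  obtain ⟨E, -, hE⟩ := hb.hasExpansion n
  obtain ⟨h0, h1⟩ := hE ℂ l (fun z => z⁻¹) ht (hl.mono fun z hz => by simpa using hz)
  -- This is the reciprocal of `-z^*`, which stays in the closed upper half-plane; the outer
  -- conjugation in the formula for `A` then restores analytic dependence on `1/z`.
  obtain ⟨h2, h3⟩ := hE ℂ l (fun z => conj (-z⁻¹))
    (by simpa [Function.comp_def] using (Complex.continuous_conj.tendsto _).comp ht.neg)
    (hl.mono fun z hz => by simpa using hz)
  have hK := hasExpansion_reflK (k := k) hP hl' n
  have h4 := ((((h0.mul (hK 0 0) ht).add (h1.mul (hK 1 0) ht)).mul h2.conj_conj.comp_neg ht).add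
    (((h0.mul (hK 0 1) ht).add (h1.mul (hK 1 1) ht)).mul h3.conj_conj.comp_neg ht))
  refine ⟨_, h4.1, h4.2.congr' (hl.mono fun z hz => ?_) EventuallyEq.rfl⟩
  dsimp only
  rw [scatA_eq k _ hw hC hz.2]
  simp

/-- Inserting the Jost expansions gives `E(h) E(-h)` times the gauge expression with `s` truncated,
divided by the normalized denominator. The full series makes that expression zero, so its truncation
is divisible by `h ^ (n + 1)`. -/
theorem scatN_isBigO (hb : HasJostExpansion w b)
    (hP : ∀ i j, (P i j).natDegree ≤ 2 * k.numBeta + k.numAlpha)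
    (hgauge : ((reflectNeg (2 * k.numBeta + k.numAlpha) (P 0 0) : ℂ⟦X⟧)
          * rescale (-1) (PowerSeries.mk b)
        + (reflectNeg (2 * k.numBeta + k.numAlpha) (P 0 1) : ℂ⟦X⟧))
      - PowerSeries.mk b * ((reflectNeg (2 * k.numBeta + k.numAlpha) (P 1 0) : ℂ⟦X⟧)
          * rescale (-1) (PowerSeries.mk b)
        + (reflectNeg (2 * k.numBeta + k.numAlpha) (P 1 1) : ℂ⟦X⟧)) = 0) (n : ℕ) :
    (fun x : ℝ => scatN w (reflK k P) x) =O[Bornology.cobounded ℝ] fun x => ((x : ℂ)⁻¹) ^ n := by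
  set l := Bornology.cobounded ℝ
  have hl : ∀ᶠ x : ℝ in l, x ≠ 0 := Bornology.eventually_ne_cobounded 0
  have ht : Tendsto (fun x : ℝ => (x : ℂ)⁻¹) l (𝓝 0) := by
    have := (Complex.continuous_ofReal.tendsto 0).comp (tendsto_inv₀_cobounded (α := ℝ))
    rw [Complex.ofReal_zero] at this
    exact this.congr fun x => by simp
  have hl' : ∀ᶠ x : ℝ in l, (x : ℂ)⁻¹ ≠ 0 := hl.mono fun x hx => by simpa using hx
  obtain ⟨E, hEa, hE⟩ := hb.hasExpansion n
  obtain ⟨h0, h1⟩ := hE ℝ l (fun x => (x : ℂ)⁻¹) ht (hl.mono fun x hx => by simpa using hx)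
  obtain ⟨h2, h3⟩ := hE ℝ l (fun x => -(x : ℂ)⁻¹) (by simpa using ht.neg)
    (hl.mono fun x hx => by simpa using hx)
  have hK := hasExpansion_reflK (k := k) hP hl' n
  have h4 := ((((h0.mul (hK 0 0) ht).add (h1.mul (hK 1 0) ht)).mul h3.comp_neg.neg ht).add
    (((h0.mul (hK 0 1) ht).add (h1.mul (hK 1 1) ht)).mul h2.comp_neg ht))
  set D := 2 * k.numBeta + k.numAlpha
  set S := trunc (n + 1) (PowerSeries.mk b)
  set S' := trunc (n + 1) (rescale (-1) (PowerSeries.mk b))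
  have hS (y : ℂ) : S.eval y = ∑ k ∈ Finset.range (n + 1), b k * y ^ k := by
    simpa using eval₂_trunc_eq_sum_range y (RingHom.id ℂ) (n + 1) (PowerSeries.mk b)
  have hS' (y : ℂ) : S'.eval y = ∑ k ∈ Finset.range (n + 1), b k * (-y) ^ k := by
    have := eval₂_trunc_eq_sum_range y (RingHom.id ℂ) (n + 1) (rescale (-1) (PowerSeries.mk b))
    rw [Polynomial.eval, this]
    refine Finset.sum_congr rfl fun k _ => ?_
    rw [neg_pow y]
    simp only [coeff_rescale, coeff_mk, RingHom.id_apply]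
    ring
  set p := (reflectNeg D (P 0 0) * S' + reflectNeg D (P 0 1))
    - S * (reflectNeg D (P 1 0) * S' + reflectNeg D (P 1 1))
  have htr (φ : ℂ⟦X⟧) : (PowerSeries.X : ℂ⟦X⟧) ^ (n + 1) ∣ φ - (trunc (n + 1) φ : ℂ⟦X⟧) := by
    rw [PowerSeries.X_pow_dvd_iff]
    intro m hm
    rw [map_sub, coeff_coe_trunc_of_lt hm, sub_self]
  have hdvd : (PowerSeries.X : ℂ⟦X⟧) ^ (n + 1) ∣ (p : ℂ⟦X⟧) := by
    obtain ⟨c, hc⟩ := htr (PowerSeries.mk b)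
    obtain ⟨d, hd⟩ := htr (rescale (-1) (PowerSeries.mk b))
    refine ⟨-((reflectNeg D (P 0 0) : ℂ⟦X⟧) * d) + c * ((reflectNeg D (P 1 0) : ℂ⟦X⟧) * S'
      + (reflectNeg D (P 1 1) : ℂ⟦X⟧)) + PowerSeries.mk b * (reflectNeg D (P 1 0) : ℂ⟦X⟧) * d, ?_⟩
    simp only [p, Polynomial.coe_add, Polynomial.coe_sub, Polynomial.coe_mul]
    linear_combination hgauge + (-((reflectNeg D (P 0 0) : ℂ⟦X⟧))
      + PowerSeries.mk b * (reflectNeg D (P 1 0) : ℂ⟦X⟧)) * hd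
      + ((reflectNeg D (P 1 0) : ℂ⟦X⟧) * S' + (reflectNeg D (P 1 1) : ℂ⟦X⟧)) * hc
  obtain ⟨p', hp'⟩ : (Polynomial.X : Polynomial ℂ) ^ (n + 1) ∣ p := by
    rw [PowerSeries.X_pow_dvd_iff] at hdvd
    rw [Polynomial.X_pow_dvd_iff]
    intro m hm
    simpa using hdvd m hm
  have hcont : ContinuousAt (fun y => E y * E (-y) / k.reflectedG y * (p'.eval y * y)) 0 := by
    have hE' : ContinuousAt (fun y => E (-y)) 0 :=
      ContinuousAt.comp' (by simpa using hEa.continuousAt) (by fun_prop)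
    exact (((hEa.continuousAt.mul hE').div k.analyticAt_reflectedG.continuousAt
      k.reflectedG_zero_ne)).mul (by fun_prop)
  have h5 := (((hcont.tendsto.comp ht).isBigO_one ℂ).mul
    (isBigO_refl (fun x : ℝ => ((x : ℂ)⁻¹) ^ n) l)).congr_right fun x => one_mul _
  refine (h4.2.add h5).congr' (hl.mono fun x hx => ?_) EventuallyEq.rfl
  have h6 : p.eval ((x : ℂ)⁻¹) = ((x : ℂ)⁻¹) ^ (n + 1) * p'.eval ((x : ℂ)⁻¹) := by
    rw [hp']; simp
  simp only [p, Polynomial.eval_sub, Polynomial.eval_add, Polynomial.eval_mul, hS, hS'] at h6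
  simp only [Function.comp_apply, scatN, inv_inv, inv_neg]
  linear_combination (-(E (x : ℂ)⁻¹ * E (-(x : ℂ)⁻¹) / k.reflectedG (x : ℂ)⁻¹)) * h6

theorem continuousOn_scatA (hw : Continuous w) (hC : ∀ x, 0 ≤ x → (1 + x ^ 2) * ‖w x‖ ≤ C)
    (hbeta : ∀ j, (k.beta j).im < 0) (halpha : ∀ l, k.alpha l < 0) :
    ContinuousOn (scatA k w (reflK k P)) {z : ℂ | 0 ≤ z.im} := by
  have h1 := continuousOn_halfLineTransition hw hC
  have h2 (j) : ContinuousOn (fun z : ℂ => conj (halfLineTransition w (-conj z) 0 j)) {z | 0 ≤ z.im} :=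
    Complex.continuous_conj.comp_continuousOn
      ((h1 j).comp (by fun_prop) fun z (hz : 0 ≤ z.im) => by simpa using hz)
  have h3 (i j) : ContinuousOn (fun z : ℂ => reflK k P (-z) i j) {z | 0 ≤ z.im} := by
    unfold reflK
    simp only [Matrix.of_apply]
    refine ContinuousOn.div (by fun_prop) ?_
      fun z (hz : 0 ≤ z.im) => k.g_ne_zero hbeta halpha (by simpa using hz)
    simp only [KappaData.g, KappaData.f]
    fun_prop
  refine ((((h1 0).mul (h3 0 0)).add ((h1 1).mul (h3 1 0))).mul (h2 0)).add
    ((((h1 0).mul (h3 0 1)).add ((h1 1).mul (h3 1 1))).mul (h2 1)) |>.congr fun z hz => ?_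
  rw [scatA_eq k _ hw hC hz]
  rfl

theorem differentiableOn_scatA (hw : Continuous w) (hC : ∀ x, 0 ≤ x → (1 + x ^ 2) * ‖w x‖ ≤ C)
    (hbeta : ∀ j, (k.beta j).im < 0) (halpha : ∀ l, k.alpha l < 0) :
    DifferentiableOn ℂ (scatA k w (reflK k P)) {z : ℂ | 0 < z.im} := by
  have ho : IsOpen {z : ℂ | 0 < z.im} := isOpen_lt continuous_const Complex.continuous_im
  have h1 := differentiableOn_halfLineTransition hw hC
  have h2 (j) : DifferentiableOn ℂ (fun z : ℂ => conj (halfLineTransition w (-conj z) 0 j))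
      {z | 0 < z.im} := by
    intro z (hz : 0 < z.im)
    have h3 : DifferentiableAt ℂ (fun y => halfLineTransition w (-y) 0 j) (conj z) :=
      DifferentiableAt.comp (g := fun y => halfLineTransition w y 0 j) (conj z)
        ((h1 j).differentiableAt (ho.mem_nhds (by simpa using hz))) differentiableAt_fun_id.fun_neg
    simpa [Function.comp_def] using (DifferentiableAt.conj_conj h3).differentiableWithinAt
  have h3 (i j) : DifferentiableOn ℂ (fun z : ℂ => reflK k P (-z) i j) {z | 0 < z.im} := by
    unfold reflK
    simp only [Matrix.of_apply]
    refine DifferentiableOn.fun_div (by fun_prop) ?_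
      fun z (hz : 0 < z.im) => k.g_ne_zero hbeta halpha (by simpa using hz.le)
    simp only [KappaData.g, KappaData.f, map_mul, map_prod, map_sub, map_add, Complex.conj_conj]
    fun_prop
  refine ((((h1 0).fun_mul (h3 0 0)).fun_add ((h1 1).fun_mul (h3 1 0))).fun_mul (h2 0)).fun_add
    ((((h1 0).fun_mul (h3 0 1)).fun_add ((h1 1).fun_mul (h3 1 1))).fun_mul (h2 1))
    |>.congr fun z hz => ?_
  rw [scatA_eq k _ hw hC (le_of_lt hz)]

end Expansions

/-! ### A logarithm on the closed upper half-plane that vanishes at infinity. -/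

section LogBranch

open Set Filter
open Asymptotics hiding IsLittleOTVS

theorem simplyConnected_univ_complex : IsSimplyConnected (univ : Set ℂ) := by
  have := (convex_univ (𝕜 := ℝ) (E := ℂ)).contractibleSpace univ_nonempty
  exact SimplyConnectedSpace.ofContractible _

theorem isPreconnected_upperHalfPlane_diff_ball {R : ℝ} (hR : 0 < R) :
    IsPreconnected {z : ℂ | 0 ≤ z.im ∧ R ≤ ‖z‖} := by
  have h1 : {z : ℂ | 0 ≤ z.im ∧ R ≤ ‖z‖}
      = (fun p : ℝ × ℝ => (p.1 : ℂ) * Complex.exp (p.2 * Complex.I)) '' (Ici R ×ˢ Icc 0 Real.pi) := by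
    ext z
    constructor
    · rintro ⟨hz, hzR⟩
      exact ⟨(‖z‖, z.arg), ⟨hzR, Complex.arg_nonneg_iff.2 hz, Complex.arg_le_pi z⟩,
        Complex.norm_mul_exp_arg_mul_I z⟩
    · rintro ⟨⟨ρ, θ⟩, ⟨hρ, h0, hπ⟩, rfl⟩
      have hρ' : 0 ≤ ρ := hR.le.trans hρ
      constructor
      · have := mul_nonneg hρ' (Real.sin_nonneg_of_nonneg_of_le_pi h0 hπ)
        simpa [Complex.exp_ofReal_mul_I_im] using this
      · simpa [Complex.norm_exp_ofReal_mul_I, abs_of_nonneg hρ'] using hρ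
  rw [h1]
  refine IsPreconnected.image ?_ _ (by fun_prop)
  exact ((convex_Ici R).prod (convex_Icc 0 Real.pi)).isPreconnected

/-- A nonvanishing function on the closed upper half-plane with limit `1` at infinity has a
logarithm that tends to `0` there. -/
theorem exists_log_upperHalfPlane {f : ℂ → ℂ} (hc : ContinuousOn f {z | 0 ≤ z.im})
    (hd : DifferentiableOn ℂ f {z | 0 < z.im}) (h0 : ∀ z : ℂ, 0 ≤ z.im → f z ≠ 0)
    (h1 : (fun z => f z - 1) =O[Bornology.cobounded ℂ ⊓ 𝓟 {z : ℂ | 0 ≤ z.im}] fun z => z⁻¹) :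
    ∃ G : ℂ → ℂ, ContinuousOn G {z | 0 ≤ z.im} ∧ DifferentiableOn ℂ G {z | 0 < z.im} ∧
      (∀ z : ℂ, 0 ≤ z.im → Complex.exp (G z) = f z) ∧
      G =O[Bornology.cobounded ℂ ⊓ 𝓟 {z : ℂ | 0 ≤ z.im}] fun z => z⁻¹ := by
  set l := Bornology.cobounded ℂ ⊓ 𝓟 {z : ℂ | 0 ≤ z.im}
  have hlim : Tendsto f l (𝓝 1) := by
    have := (h1.trans_tendsto (tendsto_inv_cobounded_inf _)).add_const 1
    simpa using this
  -- Composing with this retraction onto the closed half-plane extends `f` to a nonvanishing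
  -- continuous function on the simply connected open set `ℂ`, where a continuous logarithm exists.
  set ρ : ℂ → ℂ := fun z => ⟨z.re, max z.im 0⟩
  have hρ : Continuous ρ := by
    have : ρ = fun z => (z.re : ℂ) + (max z.im 0 : ℝ) * Complex.I := by
      ext z; apply Complex.ext <;> simp [ρ]
    rw [this]
    fun_prop
  have hρm (z : ℂ) : 0 ≤ (ρ z).im := le_max_right _ _
  have hρid {z : ℂ} (hz : 0 ≤ z.im) : ρ z = z := Complex.ext rfl (max_eq_left hz)
  obtain ⟨G₀, hG₀c, hG₀⟩ := Complex.exists_continuousOn_eqOn_exp_comp (U := univ) (X := ℂ)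
    (g := fun z => f (ρ z)) simplyConnected_univ_complex isOpen_univ
    (hc.comp_continuous hρ hρm).continuousOn (by rintro ⟨z, -, hz⟩; exact h0 _ (hρm z) hz)
  rw [continuousOn_univ] at hG₀c
  have hexp (z : ℂ) (hz : 0 ≤ z.im) : Complex.exp (G₀ z) = f z := by
    have := hG₀ (mem_univ z)
    simpa [hρid hz] using this
  obtain ⟨R, hR⟩ : ∃ R : ℝ, ∀ z : ℂ, R ≤ ‖z‖ → 0 ≤ z.im → f z ∈ Complex.slitPlane := by
    have h2 : ∀ᶠ z in l, f z ∈ Complex.slitPlane :=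
      hlim.eventually (Complex.isOpen_slitPlane.mem_nhds Complex.one_mem_slitPlane)
    rw [eventually_inf_principal, (hasBasis_cobounded_norm).eventually_iff] at h2
    obtain ⟨R, -, hR⟩ := h2
    exact ⟨R, fun z hz hz' => hR hz hz'⟩
  set S : Set ℂ := {z : ℂ | 0 ≤ z.im ∧ max R 1 ≤ ‖z‖}
  have hS : IsPreconnected S := isPreconnected_upperHalfPlane_diff_ball (by positivity)
  have hSslit (z : ℂ) (hz : z ∈ S) : f z ∈ Complex.slitPlane :=
    hR z ((le_max_left _ _).trans hz.2) hz.1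
  -- Near infinity the lift and the principal logarithm differ by a continuous function with values
  -- in the discrete group `2πi ℤ`, constant on the connected region `S`. Subtracting that constant
  -- gives the branch tending to `0`.
  obtain ⟨c, hcm, hcS⟩ := hS.eqOn_const_of_mapsTo
    (T := (AddSubgroup.zmultiples (2 * Real.pi * Complex.I) : Set ℂ))
    (f := fun z => G₀ z - Complex.log (f z))
    (isDiscrete_iff_discreteTopology.2 (NormedSpace.discreteTopology_zmultiples _))
    (hG₀c.continuousOn.sub ((hc.mono fun z hz => hz.1).clog hSslit))
    (fun z hz => by
      have h3 : Complex.exp (G₀ z) = Complex.exp (Complex.log (f z)) := by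
        rw [hexp z hz.1, Complex.exp_log (h0 z hz.1)]
      obtain ⟨n, hn⟩ := Complex.exp_eq_exp_iff_exists_int.1 h3
      exact ⟨n, by simp [hn]⟩) ⟨0, AddSubgroup.zero_mem _⟩
  have hcexp : Complex.exp c = 1 := by
    obtain ⟨n, hn⟩ := hcm
    rw [Complex.exp_eq_one_iff]
    exact ⟨n, by simp [← hn]⟩
  have hGexp (z : ℂ) (hz : 0 ≤ z.im) : Complex.exp (G₀ z - c) = f z := by
    rw [Complex.exp_sub, hcexp, div_one, hexp z hz]
  have ho : IsOpen {z : ℂ | 0 < z.im} := isOpen_lt continuous_const Complex.continuous_im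
  refine ⟨fun z => G₀ z - c, by fun_prop, fun z hz => ?_, hGexp, ?_⟩
  · have hz' : 0 < z.im := hz
    have h3 : ∀ᶠ y in 𝓝 z, ‖G₀ y - G₀ z‖ < Real.pi := by
      have := (hG₀c.tendsto z).sub_const (G₀ z)
      rw [sub_self] at this
      have := this.norm
      rw [norm_zero] at this
      exact this.eventually (gt_mem_nhds Real.pi_pos)
    -- The lift is only known to be continuous. Near `z` it equals its value there plus the
    -- principal logarithm of `f y / f z`, which is differentiable.
    have h4 : DifferentiableAt ℂ (fun y => Complex.log (f y / f z) + G₀ z - c) z := by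
      refine ((DifferentiableAt.clog ?_ ?_).add_const _).sub_const _
      · exact (hd.differentiableAt (ho.mem_nhds hz)).div_const _
      · rw [div_self (h0 z hz'.le)]
        exact Complex.one_mem_slitPlane
    refine (h4.congr_of_eventuallyEq ?_).differentiableWithinAt
    filter_upwards [h3, ho.mem_nhds hz] with y hy hy'
    have h5 := (Complex.abs_im_le_norm _).trans_lt hy
    rw [abs_lt] at h5
    rw [← hexp y (le_of_lt hy'), ← hexp z hz'.le, ← Complex.exp_sub, Complex.log_exp h5.1 h5.2.le]
    ring
  · have h6 : (fun z => Complex.log (f z)) =O[l] fun z => f z - 1 := by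
      have := ((Complex.differentiableAt_log Complex.one_mem_slitPlane).isBigO_sub).comp_tendsto hlim
      simpa [Function.comp_def] using this
    refine (h6.trans h1).congr' ?_ EventuallyEq.rfl
    have h7 : ∀ᶠ z in l, z ∈ S := by
      rw [eventually_inf_principal, hasBasis_cobounded_norm.eventually_iff]
      exact ⟨max R 1, trivial, fun z hz hz' => ⟨hz', hz⟩⟩
    filter_upwards [h7] with z hz
    have := hcS hz
    simp only [Function.const_apply] at this
    rw [← this]
    ring

end LogBranch

/-! ### Contour integration over large rectangles. -/

section Cauchy

open MeasureTheory Set Filter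
open Asymptotics hiding IsLittleOTVS

/-- Over the other three sides of the rectangle with corners `-R` and `R + iR` the integrand is
`O(R⁻²)` and the length is `4 R`. -/
theorem integral_real_eq_zero_of_isBigO {h : ℂ → ℂ} (hc : ContinuousOn h {z | 0 ≤ z.im})
    (hd : DifferentiableOn ℂ h {z | 0 < z.im})
    (hO : h =O[Bornology.cobounded ℂ ⊓ 𝓟 {z : ℂ | 0 ≤ z.im}] fun z => z⁻¹ ^ 2) :
    ∫ x : ℝ, h x = 0 := by
  by_cases hi : Integrable fun x : ℝ => h x
  swap
  -- For a nonintegrable function the integral has the default value `0`, so integrability need not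
  -- be assumed.
  · exact integral_undef hi
  obtain ⟨C, hC⟩ := hO.bound
  rw [eventually_inf_principal, hasBasis_cobounded_norm.eventually_iff] at hC
  obtain ⟨R₀, -, hR₀⟩ := hC
  have hbound (R : ℝ) (hR : R₀ ≤ R) (hR1 : 1 ≤ R) (z : ℂ) (hz : 0 ≤ z.im) (hzR : R ≤ ‖z‖) :
      ‖h z‖ ≤ |C| * R⁻¹ ^ 2 := by
    refine (hR₀ (hR.trans hzR) hz).trans ?_
    rw [norm_pow, norm_inv]
    refine mul_le_mul (le_abs_self C) ?_ (by positivity) (by positivity)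
    gcongr
  have key (R : ℝ) (hR : R₀ ≤ R) (hR1 : 1 ≤ R) : ‖∫ x in (-R)..R, h x‖ ≤ 4 * |C| * R⁻¹ := by
    have hR0 : 0 < R := by linarith
    have h1 := Complex.integral_boundary_rect_eq_zero_of_continuousOn_of_differentiableOn h
      (-R : ℂ) (R + R * Complex.I) (hc.mono fun z hz => by
        have := hz.2
        simp [uIcc_of_le hR0.le] at this
        exact this.1)
      (hd.mono fun z hz => by
        have := hz.2
        simp [hR0.le] at this
        exact this.1)
    simp at h1
    have h2 : ‖∫ x in (-R)..R, h (x + R * Complex.I)‖ ≤ |C| * R⁻¹ ^ 2 * |R - -R| := by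
      refine intervalIntegral.norm_integral_le_of_norm_le_const fun x _ => ?_
      refine hbound R hR hR1 _ (by simpa using hR0.le) ?_
      have := Complex.abs_im_le_norm ((x : ℂ) + R * Complex.I)
      simpa [abs_of_pos hR0] using this
    have h3 : ‖∫ y in (0 : ℝ)..R, h (R + y * Complex.I)‖ ≤ |C| * R⁻¹ ^ 2 * |R - 0| := by
      refine intervalIntegral.norm_integral_le_of_norm_le_const fun y hy => ?_
      rw [uIoc_of_le hR0.le] at hy
      refine hbound R hR hR1 _ (by simpa using hy.1.le) ?_
      have := Complex.abs_re_le_norm ((R : ℂ) + y * Complex.I)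
      simpa [abs_of_pos hR0] using this
    have h4 : ‖∫ y in (0 : ℝ)..R, h (-R + y * Complex.I)‖ ≤ |C| * R⁻¹ ^ 2 * |R - 0| := by
      refine intervalIntegral.norm_integral_le_of_norm_le_const fun y hy => ?_
      rw [uIoc_of_le hR0.le] at hy
      refine hbound R hR hR1 _ (by simpa using hy.1.le) ?_
      have := Complex.abs_re_le_norm (-(R : ℂ) + y * Complex.I)
      simpa [abs_of_pos hR0] using this
    have h5 : ∫ x in (-R)..R, h x = (∫ x in (-R)..R, h (x + R * Complex.I))
        - Complex.I * (∫ y in (0 : ℝ)..R, h (R + y * Complex.I))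
        + Complex.I * ∫ y in (0 : ℝ)..R, h (-R + y * Complex.I) := by
      linear_combination h1
    rw [h5]
    refine (norm_add_le _ _).trans ((add_le_add_left (norm_sub_le _ _) _).trans ?_)
    rw [norm_mul, norm_mul, Complex.norm_I, one_mul, one_mul]
    have h6 : |C| * R⁻¹ ^ 2 * |R - -R| = 2 * (|C| * R⁻¹) := by
      rw [abs_of_pos (show 0 < R - -R by linarith)]; field_simp; ring
    have h7 : |C| * R⁻¹ ^ 2 * |R - 0| = |C| * R⁻¹ := by
      rw [sub_zero, abs_of_pos hR0]; field_simp
    rw [h6] at h2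
    rw [h7] at h3 h4
    linarith
  have h1 := intervalIntegral_tendsto_integral hi tendsto_neg_atTop_atBot tendsto_id
  have h2 : Tendsto (fun R : ℝ => ∫ x in (-R)..R, h x) atTop (𝓝 0) := by
    refine squeeze_zero_norm' ?_ (by simpa using tendsto_inv_atTop_zero.const_mul (4 * |C|))
    filter_upwards [eventually_ge_atTop R₀, eventually_ge_atTop 1] with R hR hR1 using key R hR hR1
  exact tendsto_nhds_unique h1 h2

end Cauchy

/-! ### The Cauchy integral of the real part on the axis. -/

section CauchyFormula

open MeasureTheory Set Filter
open Asymptotics hiding IsLittleOTVS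

theorem isBigO_inv_sub_cobounded (a : ℂ) :
    (fun w : ℂ => (w - a)⁻¹) =O[Bornology.cobounded ℂ] fun w => w⁻¹ := by
  refine .of_bound 2 ?_
  rw [hasBasis_cobounded_norm.eventually_iff]
  refine ⟨2 * ‖a‖ + 1, trivial, fun w hw => ?_⟩
  have hw : 2 * ‖a‖ + 1 ≤ ‖w‖ := hw
  have h0 := norm_nonneg a
  have h1 := norm_sub_norm_le w a
  have h2 : ‖w‖ / 2 ≤ ‖w - a‖ := by linarith
  rw [norm_inv, norm_inv]
  calc ‖w - a‖⁻¹ ≤ (‖w‖ / 2)⁻¹ := by gcongr; linarith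
    _ = 2 * ‖w‖⁻¹ := by rw [inv_div]; ring

theorem tendsto_ofReal_cobounded_inf {s : Set ℂ} (hs : ∀ x : ℝ, (x : ℂ) ∈ s) :
    Tendsto (fun x : ℝ => (x : ℂ)) (Bornology.cobounded ℝ) (Bornology.cobounded ℂ ⊓ 𝓟 s) := by
  refine tendsto_inf.2 ⟨?_, tendsto_principal.2 (.of_forall hs)⟩
  rw [← tendsto_norm_atTop_iff_cobounded]
  exact tendsto_norm_cobounded_atTop.congr fun x => (Complex.norm_real x).symm

theorem integrable_of_isBigO_inv_sq {f : ℝ → ℂ} (hf : Continuous f)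
    (hO : f =O[Bornology.cobounded ℝ] fun x => (x : ℂ)⁻¹ ^ 2) : Integrable f := by
  refine hf.locallyIntegrable.integrable_of_isBigO_cocompact (g := fun x => (1 + x ^ 2)⁻¹) ?_
    (integrable_inv_one_add_sq.integrableAtFilter _)
  rw [← Metric.cobounded_eq_cocompact]
  refine hO.trans (.of_bound 2 ?_)
  rw [hasBasis_cobounded_norm.eventually_iff]
  refine ⟨1, trivial, fun x hx => ?_⟩
  have hx : 1 ≤ |x| := hx
  have h1 : 1 ≤ x ^ 2 := by rw [← sq_abs]; nlinarith
  rw [norm_pow, norm_inv, Complex.norm_real, Real.norm_eq_abs, Real.norm_eq_abs, inv_pow, sq_abs,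
    abs_of_pos (by positivity), ← div_eq_mul_inv, inv_eq_one_div, div_le_div_iff₀ (by positivity)
    (by positivity)]
  linarith

theorem ofReal_sub_ne_zero {z : ℂ} (hz : z.im ≠ 0) (x : ℝ) : (x : ℂ) - z ≠ 0 := by
  intro h
  apply hz
  rw [← sub_eq_zero.1 h, Complex.ofReal_im]

/-- The integrand is `2i` times the Poisson kernel, so the value follows from `∫ dx / (1 + x²) = π`
after translation and scaling. -/
theorem integral_cauchyKernel {z : ℂ} (hz : 0 < z.im) :
    ∫ x : ℝ, (z - conj z) / ((x - z) * (x - conj z)) = 2 * Real.pi * Complex.I := by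
  have h1 (x : ℝ) : (z - conj z) / ((x - z) * (x - conj z))
      = (2 * Complex.I * (z.im : ℂ)⁻¹) * (((1 + ((x - z.re) / z.im) ^ 2)⁻¹ : ℝ) : ℂ) := by
    have h2 : ((x : ℂ) - z) * (x - conj z) = (((x - z.re) ^ 2 + z.im ^ 2 : ℝ) : ℂ) := by
      apply Complex.ext <;> simp [-Complex.ofReal_add, -Complex.ofReal_pow, -Complex.ofReal_sub] <;> ring
    have h3 : (1 + ((x - z.re) / z.im) ^ 2)⁻¹ = z.im ^ 2 / ((x - z.re) ^ 2 + z.im ^ 2) := by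
      field_simp
      ring
    have h4 : z - conj z = 2 * Complex.I * z.im := by
      apply Complex.ext <;> simp
      ring
    have h5 : (((x - z.re) ^ 2 + z.im ^ 2 : ℝ) : ℂ) ≠ 0 := by
      rw [Complex.ofReal_ne_zero]; positivity
    have h6 : (z.im : ℂ) ≠ 0 := by exact_mod_cast hz.ne'
    rw [h2, h3, h4]
    rw [Complex.ofReal_div]
    push_cast at h5 ⊢
    field_simp
  simp_rw [h1]
  rw [integral_const_mul, integral_complex_ofReal,
    integral_sub_right_eq_self (fun x : ℝ => (1 + (x / z.im) ^ 2)⁻¹),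
    Measure.integral_comp_div (fun x : ℝ => (1 + x ^ 2)⁻¹), integral_univ_inv_one_add_sq,
    abs_of_pos hz]
  have h6 : (z.im : ℂ) ≠ 0 := by exact_mod_cast hz.ne'
  push_cast [smul_eq_mul]
  field_simp

/-- Reconstruction of a function in the upper half-plane from its real part on the real axis. -/
theorem eq_integral_re_of_isBigO {G : ℂ → ℂ} (hc : ContinuousOn G {z | 0 ≤ z.im})
    (hd : DifferentiableOn ℂ G {z | 0 < z.im})
    (hO : G =O[Bornology.cobounded ℂ ⊓ 𝓟 {z : ℂ | 0 ≤ z.im}] fun z => z⁻¹) {z : ℂ}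
    (hz : 0 < z.im) :
    Integrable (fun x : ℝ => (2 * (G x).re : ℂ) / (x - z)) ∧
    G z = 1 / (2 * Real.pi * Complex.I) * ∫ x : ℝ, (2 * (G x).re : ℂ) / (x - z) := by
  set l := Bornology.cobounded ℂ ⊓ 𝓟 {z : ℂ | 0 ≤ z.im}
  have hl : l ≤ Bornology.cobounded ℂ := inf_le_left
  have hlR : Tendsto (fun x : ℝ => (x : ℂ)) (Bornology.cobounded ℝ) l :=
    tendsto_ofReal_cobounded_inf fun x => by simp
  have ho : IsOpen {z : ℂ | 0 < z.im} := isOpen_lt continuous_const Complex.continuous_im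
  have hzc (w : ℂ) (hw : 0 ≤ w.im) : w - conj z ≠ 0 := by
    intro h
    have := congrArg Complex.im h
    simp at this
    linarith
  have hkc : ContinuousOn (fun w : ℂ => (w - conj z)⁻¹) {w | 0 ≤ w.im} :=
    ContinuousOn.inv₀ (by fun_prop) hzc
  have hkd : DifferentiableOn ℂ (fun w : ℂ => (w - conj z)⁻¹) {w | 0 < w.im} :=
    DifferentiableOn.fun_inv (by fun_prop) fun w hw => hzc w (le_of_lt hw)
  have hkO := (isBigO_inv_sub_cobounded (conj z)).mono hl
  have h1c := hc.mul hkc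
  have h1O : (fun w => G w * (w - conj z)⁻¹) =O[l] fun w => w⁻¹ ^ 2 :=
    (hO.mul hkO).congr_right fun w => (sq _).symm
  -- The pole `z^*` is below the axis, so this integral vanishes. Its conjugate says that the
  -- conjugate of `G` integrates to zero against `1 / (x - z)`, which lets the real part replace
  -- `G`.
  have h1 := integral_real_eq_zero_of_isBigO h1c (hd.fun_mul hkd) h1O
  -- The subtracted term equals `G z` at `w = z`, is regular in the upper half-plane and is
  -- `O(1/w)`. Thus `N w / (w - z)` extends over `z` and is `O(w⁻²)`, and the residue is carried by
  -- the explicit kernel.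
  set N : ℂ → ℂ := fun w => G w - G z * (z - conj z) * (w - conj z)⁻¹
  have hNc : ContinuousOn N {w | 0 ≤ w.im} := hc.sub (continuousOn_const.mul hkc)
  have hNd : DifferentiableOn ℂ N {w | 0 < w.im} := hd.fun_sub (hkd.const_mul _)
  have hNz : N z = 0 := by
    simp only [N]
    rw [mul_assoc, mul_inv_cancel₀ (hzc z hz.le), mul_one, sub_self]
  have hslope {w : ℂ} (hw : w ≠ z) : dslope N z w = N w * (w - z)⁻¹ := by
    rw [dslope_of_ne _ hw, slope_def_field, hNz, sub_zero, div_eq_mul_inv]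
  have h2c : ContinuousOn (dslope N z) {w | 0 ≤ w.im} :=
    (continuousOn_dslope (mem_of_superset (ho.mem_nhds hz) fun w (hw : 0 < w.im) => hw.le)).2
      ⟨hNc, hNd.differentiableAt (ho.mem_nhds hz)⟩
  have h2d := (Complex.differentiableOn_dslope (ho.mem_nhds hz)).2 hNd
  have h2O : dslope N z =O[l] fun w => w⁻¹ ^ 2 := by
    have h3 : (fun w => N w * (w - z)⁻¹) =O[l] fun w => w⁻¹ ^ 2 :=
      ((hO.sub (hkO.const_mul_left _)).mul ((isBigO_inv_sub_cobounded z).mono hl)).congr_right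
        fun w => (sq _).symm
    refine h3.congr' ?_ EventuallyEq.rfl
    filter_upwards [hl (Bornology.eventually_ne_cobounded z)] with w hw using (hslope hw).symm
  have h2 := integral_real_eq_zero_of_isBigO h2c h2d h2O
  have hGO : (fun x : ℝ => G x) =O[Bornology.cobounded ℝ] fun x => (x : ℂ)⁻¹ := hO.comp_tendsto hlR
  have hGc : Continuous fun x : ℝ => G x := hc.comp_continuous (by fun_prop) fun x => by simp
  have hkR (a : ℂ) : (fun x : ℝ => ((x : ℂ) - a)⁻¹) =O[Bornology.cobounded ℝ] fun x => (x : ℂ)⁻¹ :=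
    ((isBigO_inv_sub_cobounded a).mono hl).comp_tendsto hlR
  have hkRc {a : ℂ} (ha : a.im ≠ 0) : Continuous fun x : ℝ => ((x : ℂ) - a)⁻¹ :=
    Continuous.inv₀ (by fun_prop) (ofReal_sub_ne_zero ha)
  have hzim : (conj z).im ≠ 0 := by simpa using hz.ne'
  have hi1 : Integrable fun x : ℝ => G x * ((x : ℂ) - z)⁻¹ :=
    integrable_of_isBigO_inv_sq (hGc.mul (hkRc hz.ne'))
      ((hGO.mul (hkR z)).congr_right fun w => (sq _).symm)
  have hi2 : Integrable fun x : ℝ => (z - conj z) / (((x : ℂ) - z) * (x - conj z)) := by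
    simp_rw [div_eq_mul_inv, mul_inv]
    refine (integrable_of_isBigO_inv_sq ((hkRc hz.ne').mul (hkRc hzim)) ?_).const_mul _
    exact ((hkR z).mul (hkR _)).congr_right fun w => (sq _).symm
  have hi3 : Integrable fun x : ℝ => conj (G x * ((x : ℂ) - conj z)⁻¹) :=
    (Complex.conjLIE.integrable_comp_iff).2 (integrable_of_isBigO_inv_sq (hGc.mul (hkRc hzim))
      ((hGO.mul (hkR _)).congr_right fun w => (sq _).symm))
  have e1 : ∫ x : ℝ, G x * ((x : ℂ) - z)⁻¹ = G z * (2 * Real.pi * Complex.I) := by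
    rw [← integral_cauchyKernel hz, ← integral_const_mul, ← sub_eq_zero, ← integral_sub hi1
      (hi2.const_mul _), ← h2]
    refine integral_congr_ae (.of_forall fun x => ?_)
    have hxz : (x : ℂ) ≠ z := fun h => ofReal_sub_ne_zero hz.ne' x (sub_eq_zero.2 h)
    simp only [hslope hxz, N, div_eq_mul_inv, mul_inv]
    ring
  have e3 : ∫ x : ℝ, conj (G x * ((x : ℂ) - conj z)⁻¹) = 0 := by
    rw [integral_conj]
    exact (congrArg conj h1).trans (map_zero _)
  have e4 (x : ℝ) : (2 * (G x).re : ℂ) / (x - z)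
      = G x * ((x : ℂ) - z)⁻¹ + conj (G x * ((x : ℂ) - conj z)⁻¹) := by
    rw [map_mul, map_inv₀, map_sub, Complex.conj_conj, Complex.conj_ofReal, ← add_mul,
      Complex.add_conj, div_eq_mul_inv]
    push_cast
    ring
  simp_rw [e4]
  refine ⟨hi1.add hi3, ?_⟩
  rw [integral_add hi1 hi3, e1, e3]
  have := Complex.two_pi_I_ne_zero
  field_simp
  ring

end CauchyFormula

/-! ### Removal of the zeros, and the dispersion relation. -/

section Blaschke

open MeasureTheory Set Filter
open Asymptotics hiding IsLittleOTVS

variable {ι : Type*} {A : ℂ → ℂ} {a : ι → ℂ}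

/-- The zeros are divided out one at a time by `dslope`, which preserves analyticity inside and
continuity up to the axis. -/
theorem exists_eq_mul_prod_sub (hc : ContinuousOn A {z | 0 ≤ z.im})
    (hd : DifferentiableOn ℂ A {z | 0 < z.im}) (ha : ∀ i, 0 < (a i).im)
    (hinj : Function.Injective a) (hA : ∀ i, A (a i) = 0) (s : Finset ι) :
    ∃ f : ℂ → ℂ, ContinuousOn f {z | 0 ≤ z.im} ∧ DifferentiableOn ℂ f {z | 0 < z.im} ∧
      ∀ z, A z = f z * ∏ i ∈ s, (z - a i) := by
  classical
  have ho : IsOpen {z : ℂ | 0 < z.im} := isOpen_lt continuous_const Complex.continuous_im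
  induction s using Finset.induction_on with
  | empty => exact ⟨A, hc, hd, by simp⟩
  | insert i s his ih =>
    obtain ⟨f, hfc, hfd, hf⟩ := ih
    have hi := ho.mem_nhds (ha i)
    refine ⟨dslope f (a i), (continuousOn_dslope (mem_of_superset hi
      fun w (hw : 0 < w.im) => hw.le)).2 ⟨hfc, hfd.differentiableAt hi⟩,
      (Complex.differentiableOn_dslope hi).2 hfd, fun z => ?_⟩
    have h0 : f (a i) = 0 := by
      have h1 := hf (a i)
      rw [hA i] at h1
      refine (mul_eq_zero.1 h1.symm).resolve_right (Finset.prod_ne_zero_iff.2 fun j hj => ?_)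
      exact sub_ne_zero.2 fun h => his (hinj h ▸ hj)
    have h2 := sub_smul_dslope f (a i) z
    rw [h0, sub_zero, smul_eq_mul] at h2
    rw [Finset.prod_insert his, hf z, ← h2]
    ring

theorem prod_div_sub_one_isBigO (s : Finset ι) (b c : ι → ℂ) :
    (fun z : ℂ => ∏ i ∈ s, (z - b i) / (z - c i) - 1) =O[Bornology.cobounded ℂ] fun z => z⁻¹ := by
  classical
  induction s using Finset.induction_on with
  | empty => simpa using isBigO_zero _ _
  | insert i s his ih =>
    have h1 : (fun z : ℂ => (z - b i) / (z - c i) - 1) =O[Bornology.cobounded ℂ] fun z => z⁻¹ := by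
      refine ((isBigO_inv_sub_cobounded (c i)).const_mul_left (c i - b i)).congr' ?_ .rfl
      filter_upwards [Bornology.eventually_ne_cobounded (c i)] with z hz
      have := sub_ne_zero.2 hz
      field_simp
      ring
    have h2 : Tendsto (fun z : ℂ => ∏ i ∈ s, (z - b i) / (z - c i)) (Bornology.cobounded ℂ) (𝓝 1) := by
      simpa using (ih.trans_tendsto tendsto_inv₀_cobounded).add_const 1
    refine (((h1.mul (h2.isBigO_one ℂ)).congr_right fun z => mul_one _).add ih).congr_left fun z => ?_
    rw [Finset.prod_insert his]
    ring

theorem norm_prod_div_conj [Fintype ι] (ha : ∀ i, (a i).im ≠ 0) (x : ℝ) :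
    ‖∏ i, ((x : ℂ) - a i) / (x - conj (a i))‖ = 1 := by
  rw [norm_prod]
  refine Finset.prod_eq_one fun i _ => ?_
  have h1 : ‖(x : ℂ) - conj (a i)‖ = ‖(x : ℂ) - a i‖ := by
    rw [← RCLike.norm_conj, map_sub, Complex.conj_ofReal, Complex.conj_conj]
  rw [norm_div, h1, div_self (norm_ne_zero_iff.2 (ofReal_sub_ne_zero (ha i) x))]

/-- A function in the upper half-plane that tends to `1` at infinity is recovered from its (simple)
zeros and its absolute value on the real axis, if the latter is even. -/
theorem eq_prod_mul_exp_integral [Fintype ι] (hc : ContinuousOn A {z | 0 ≤ z.im})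
    (hd : DifferentiableOn ℂ A {z | 0 < z.im})
    (hO : (fun z => A z - 1) =O[Bornology.cobounded ℂ ⊓ 𝓟 {z : ℂ | 0 ≤ z.im}] fun z => z⁻¹)
    (hinj : Function.Injective a) (hzero : {z : ℂ | 0 < z.im ∧ A z = 0} = range a)
    (hsimple : ∀ z : ℂ, 0 < z.im → A z = 0 → deriv A z ≠ 0) (hreal : ∀ x : ℝ, A x ≠ 0)
    (heven : ∀ x : ℝ, ‖A (-x)‖ = ‖A x‖) {z : ℂ} (hz : 0 < z.im) :
    IntegrableOn (fun x : ℝ => z * (Real.log (‖A x‖ ^ 2) : ℂ) / ((x : ℂ) ^ 2 - z ^ 2)) (Ioi 0) ∧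
    A z = (∏ i, (z - a i) / (z - conj (a i))) * Complex.exp (1 / (Complex.I * Real.pi) *
      ∫ x in Ioi (0 : ℝ), z * (Real.log (‖A x‖ ^ 2) : ℂ) / ((x : ℂ) ^ 2 - z ^ 2)) := by
  set l := Bornology.cobounded ℂ ⊓ 𝓟 {z : ℂ | 0 ≤ z.im}
  have hl : l ≤ Bornology.cobounded ℂ := inf_le_left
  have ho : IsOpen {z : ℂ | 0 < z.im} := isOpen_lt continuous_const Complex.continuous_im
  have hai (i) : 0 < (a i).im ∧ A (a i) = 0 := by
    have : a i ∈ {z : ℂ | 0 < z.im ∧ A z = 0} := hzero ▸ mem_range_self i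
    exact this
  obtain ⟨f, hfc, hfd, hf⟩ := exists_eq_mul_prod_sub hc hd (fun i => (hai i).1) hinj
    (fun i => (hai i).2) Finset.univ
  have hconj (w : ℂ) (hw : 0 ≤ w.im) (i) : w - conj (a i) ≠ 0 := by
    intro h
    have h1 := congrArg Complex.im h
    have h2 := (hai i).1
    simp at h1
    linarith
  have hf0 (w : ℂ) (hw : 0 ≤ w.im) : f w ≠ 0 := by
    intro h
    have h1 : A w = 0 := by rw [hf, h, zero_mul]
    rcases hw.eq_or_lt with hw' | hw'
    · refine hreal w.re ?_
      rwa [show ((w.re : ℝ) : ℂ) = w from Complex.ext rfl hw']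
    -- A zero of the quotient at `a i` would make it a multiple zero of `A`, against simplicity.
    · obtain ⟨i, rfl⟩ : w ∈ range a := hzero ▸ ⟨hw', h1⟩
      refine hsimple _ hw' h1 ?_
      have h2 : HasDerivAt f (deriv f (a i)) (a i) :=
        (hfd.differentiableAt (ho.mem_nhds hw')).hasDerivAt
      have h3 : DifferentiableAt ℂ (fun w => ∏ j, (w - a j)) (a i) := by fun_prop
      have h4 := h2.fun_mul h3.hasDerivAt
      rw [h, zero_mul, add_zero,
        Finset.prod_eq_zero (i := i) (Finset.mem_univ _) (sub_self _), mul_zero] at h4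
      rw [show A = fun w => f w * ∏ j, (w - a j) from funext hf]
      exact h4.deriv
  -- This is `A` divided by the Blaschke product, written without division. It has no zeros in the
  -- closed half-plane and the same absolute value as `A` on the real axis.
  set F : ℂ → ℂ := fun w => f w * ∏ i, (w - conj (a i))
  have hFA (w : ℂ) (hw : 0 ≤ w.im) : A w = F w * ∏ i, (w - a i) / (w - conj (a i)) := by
    have := Finset.prod_ne_zero_iff.2 fun i (_ : i ∈ Finset.univ) => hconj w hw i
    rw [Finset.prod_div_distrib, hf]
    simp only [F]
    field_simp
  have hF1 : (fun w => F w - 1) =O[l] fun w => w⁻¹ := by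
    have h1 := (prod_div_sub_one_isBigO Finset.univ (fun i => conj (a i)) a).mono hl
    have h2 : Tendsto (fun w : ℂ => ∏ i, (w - conj (a i)) / (w - a i)) l (𝓝 1) := by
      simpa using (h1.trans_tendsto (tendsto_inv_cobounded_inf _)).add_const 1
    refine (((hO.mul (h2.isBigO_one ℂ)).congr_right fun z => mul_one _).add h1).congr' ?_ .rfl
    have h3 : ∀ᶠ w in l, ∀ i, w - a i ≠ 0 :=
      eventually_all.2 fun i => ((Bornology.eventually_ne_cobounded (a i)).filter_mono hl).mono
        fun w hw => sub_ne_zero.2 hw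
    filter_upwards [h3] with w hw
    have := Finset.prod_ne_zero_iff.2 fun i (_ : i ∈ Finset.univ) => hw i
    rw [Finset.prod_div_distrib, hf]
    simp only [F]
    field_simp
    ring
  obtain ⟨G, hGc, hGd, hGexp, hGO⟩ := exists_log_upperHalfPlane (f := F)
    (hfc.mul (by fun_prop)) (hfd.fun_mul (by fun_prop))
    (fun w hw => mul_ne_zero (hf0 w hw) (Finset.prod_ne_zero_iff.2 fun i _ => hconj w hw i)) hF1
  obtain ⟨hGi, hGz⟩ := eq_integral_re_of_isBigO hGc hGd hGO hz
  have hre (x : ℝ) : 2 * (G x).re = Real.log (‖A x‖ ^ 2) := by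
    rw [hFA x (by simp), norm_mul, norm_prod_div_conj (fun i => (hai i).1.ne'), mul_one,
      ← hGexp x (by simp), Complex.norm_exp, Real.log_pow, Real.log_exp]
    norm_num
  set ρ : ℝ → ℂ := fun x => (Real.log (‖A x‖ ^ 2) : ℂ)
  have hρ (x : ℝ) : (2 * (G x).re : ℂ) = ρ x := by
    simp only [ρ, ← hre]
    push_cast
    rfl
  have hρe (x : ℝ) : ρ (-x) = ρ x := by
    simp only [ρ, Complex.ofReal_neg, heven]
  simp_rw [hρ] at hGi hGz
  -- Evenness pairs the points `x` and `-x`, and the sum of their Cauchy kernels is `2 z / (x² -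
  -- z²)`.
  have hker (x : ℝ) : ρ (-x) / (((-x : ℝ) : ℂ) - z) + ρ x / (x - z)
      = 2 * (z * ρ x / ((x : ℂ) ^ 2 - z ^ 2)) := by
    have h1 := ofReal_sub_ne_zero hz.ne' x
    have h2 := ofReal_sub_ne_zero hz.ne' (-x)
    have h3 : (x : ℂ) ^ 2 - z ^ 2 = -((x - z) * (((-x : ℝ) : ℂ) - z)) := by
      push_cast; ring
    rw [hρe, h3]
    push_cast at h2 ⊢
    field_simp
    ring
  have hi2 : IntegrableOn (fun x : ℝ => 2 * (z * ρ x / ((x : ℂ) ^ 2 - z ^ 2))) (Ioi 0) :=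
    ((hGi.comp_neg.add hGi).congr (.of_forall hker)).integrableOn
  refine ⟨(hi2.const_mul (1 / 2)).congr (.of_forall fun x => by simp only [ρ]; ring), ?_⟩
  have h5 : ∫ x : ℝ, ρ x / (x - z) = ∫ x in Ioi (0 : ℝ), 2 * (z * ρ x / ((x : ℂ) ^ 2 - z ^ 2)) := by
    have h6 := integral_comp_neg_Iic 0 (fun x : ℝ => ρ (-x) / (((-x : ℝ) : ℂ) - z))
    simp only [neg_neg, neg_zero] at h6
    rw [← intervalIntegral.integral_Iic_add_Ioi hGi.integrableOn hGi.integrableOn, h6,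
      ← integral_add hGi.comp_neg.integrableOn hGi.integrableOn]
    exact integral_congr_ae (.of_forall hker)
  rw [hFA z hz.le, ← hGexp z hz.le, hGz, h5, integral_const_mul, mul_comm]
  congr 2
  have := Complex.I_ne_zero
  have hπ : (Real.pi : ℂ) ≠ 0 := by exact_mod_cast Real.pi_ne_zero
  field_simp
  rfl

end Blaschke

/-! ### Behaviour of `A` at infinity, and rapid decay of `log |A|²`. -/

section ScatteringDecay

open MeasureTheory Set Filter PowerSeries
open Asymptotics hiding IsLittleOTVS

theorem HasExpansion.tendsto {X : Type*} {l : Filter X} {h f : X → ℂ} {n : ℕ} {F : ℂ → ℂ}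
    (hf : HasExpansion l h f n F) (hn : n ≠ 0) (hh : Tendsto h l (𝓝 0)) : Tendsto f l (𝓝 (F 0)) := by
  have h1 : Tendsto (fun x => h x ^ n) l (𝓝 0) := by simpa [hn] using hh.pow n
  have h2 := (hf.2.trans_tendsto h1).add (hf.1.continuousAt.tendsto.comp hh)
  simpa using h2

variable {w : ℝ → ℂ} {C : ℝ} {b : ℕ → ℂ} {k : KappaData} {J : Set ℝ} {v vx : ℝ → ℂ}
  {P : ℝ → Matrix (Fin 2) (Fin 2) (Polynomial ℂ)}

/-- Since `b 0 = 0`, the second Jost entry tends to `0`, and `K` becomes diagonal, so the limit is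
`|E(0)|²`. Unitarity on the real axis forces this to be `1`. -/
theorem tendsto_scatA (hP : IsReflectionFamily k J v vx P) {t : ℝ} (ht : t ∈ J) (hw : Continuous w)
    (hC : ∀ x, 0 ≤ x → (1 + x ^ 2) * ‖w x‖ ≤ C) (hb : HasJostExpansion w b) (hb0 : b 0 = 0) :
    Tendsto (scatA k w (reflK k (P t))) (Bornology.cobounded ℂ ⊓ 𝓟 {z : ℂ | 0 ≤ z.im}) (𝓝 1) := by
  set l := Bornology.cobounded ℂ ⊓ 𝓟 {z : ℂ | 0 ≤ z.im}
  have hinv : Tendsto (fun z : ℂ => z⁻¹) l (𝓝 0) := tendsto_inv_cobounded_inf _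
  have hl : ∀ᶠ z in l, z ≠ 0 ∧ 0 ≤ z.im := eventually_ne_zero_cobounded_inf _
  obtain ⟨E, -, hE⟩ := hb.hasExpansion 1
  have hrow (X : Type) (l : Filter X) (φ : X → ℂ) (hφ : Tendsto (fun x => (φ x)⁻¹) l (𝓝 0))
      (hφ' : ∀ᶠ x in l, φ x ≠ 0 ∧ 0 ≤ (φ x).im) :
      Tendsto (fun x => halfLineTransition w (φ x) 0 0) l (𝓝 (E 0)) ∧
      Tendsto (fun x => halfLineTransition w (φ x) 0 1) l (𝓝 0) := by
    obtain ⟨h0, h1⟩ := hE X l (fun x => (φ x)⁻¹) hφ (by simpa using hφ')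
    have h2 := h0.tendsto one_ne_zero hφ
    have h3 := h1.tendsto one_ne_zero hφ
    simp only [inv_inv] at h2 h3
    refine ⟨h2, ?_⟩
    simpa [Finset.sum_range_succ, hb0] using h3
  have hR := hrow ℝ (Bornology.cobounded ℝ) (fun x => (x : ℂ))
    ((tendsto_inv_cobounded_inf univ).comp (tendsto_ofReal_cobounded_inf fun x => mem_univ _))
    ((Bornology.eventually_ne_cobounded 0).mono fun x hx => by simpa using hx)
  have hE1 : E 0 * conj (E 0) = 1 := by
    have h1 := (hR.1.mul ((Complex.continuous_conj.tendsto _).comp hR.1)).add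
      (hR.2.mul ((Complex.continuous_conj.tendsto _).comp hR.2))
    simp only [Function.comp_def, halfLineTransition_unitary hw hC, map_zero, mul_zero, add_zero] at h1
    exact tendsto_nhds_unique h1 tendsto_const_nhds
  have h1 := hrow ℂ l (fun z => z) hinv hl
  have h2 := hrow ℂ l (fun z => -conj z)
    (by simpa [Function.comp_def, inv_neg] using ((Complex.continuous_conj.tendsto _).comp hinv).neg)
    (hl.mono fun z hz => by simpa using hz)
  have hK (i j) : Tendsto (fun z => reflK k (P t) (-z) i j) l _ :=
    (hP.tendsto t ht i j).comp ((tendsto_neg_cobounded).mono_left inf_le_left)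
  have hc := fun {f : ℂ → ℂ} {a : ℂ} (h : Tendsto f l (𝓝 a)) =>
    (Complex.continuous_conj.tendsto a).comp h
  have h3 := (((h1.1.mul (hK 0 0)).add (h1.2.mul (hK 1 0))).mul (hc h2.1)).add
    (((h1.1.mul (hK 0 1)).add (h1.2.mul (hK 1 1))).mul (hc h2.2))
  simp only [Matrix.of_apply, Matrix.cons_val', Matrix.cons_val_zero, Matrix.cons_val_fin_one,
    Matrix.cons_val_one, mul_one, mul_zero, zero_mul, add_zero, map_zero, hE1] at h3
  refine h3.congr' (hl.mono fun z hz => ?_)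
  rw [scatA_eq k _ hw hC hz.2]
  rfl

instance neBot_cobounded_inf : (Bornology.cobounded ℂ ⊓ 𝓟 {z : ℂ | 0 ≤ z.im}).NeBot :=
  (tendsto_ofReal_cobounded_inf fun x => by simp).neBot

theorem scatA_sub_one_isBigO (hP : IsReflectionFamily k J v vx P) {t : ℝ} (ht : t ∈ J)
    (hw : Continuous w) (hC : ∀ x, 0 ≤ x → (1 + x ^ 2) * ‖w x‖ ≤ C) (hb : HasJostExpansion w b)
    (hb0 : b 0 = 0) :
    (fun z => scatA k w (reflK k (P t)) z - 1)
      =O[Bornology.cobounded ℂ ⊓ 𝓟 {z : ℂ | 0 ≤ z.im}] fun z => z⁻¹ := by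
  obtain ⟨F, hF⟩ := exists_hasExpansion_scatA hw hC hb (hP.natDegree_le t ht) 1
  have hinv := tendsto_inv_cobounded_inf {z : ℂ | 0 ≤ z.im}
  have h1 : F 0 = 1 := tendsto_nhds_unique (hF.tendsto one_ne_zero hinv) (tendsto_scatA hP ht hw hC hb hb0)
  have h2 := hF.1.differentiableAt.isBigO_sub.comp_tendsto hinv
  have h3 := hF.2
  simp only [pow_one] at h3
  refine (h3.add (h2.congr_right fun z => sub_zero _)).congr_left fun z => ?_
  simp [h1]

/-- `log |A|²` is continuous and rapidly decreasing on the real axis. -/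
theorem log_scatA_decay (hP : IsReflectionFamily k J v vx P)
    (hbeta : ∀ j, (k.beta j).im < 0) (halpha : ∀ l, k.alpha l < 0) {t : ℝ} (ht : t ∈ J)
    (hw : Continuous w) (hC : ∀ x, 0 ≤ x → (1 + x ^ 2) * ‖w x‖ ≤ C) (hb : HasJostExpansion w b)
    (hgauge : ((reflectNeg (2 * k.numBeta + k.numAlpha) (P t 0 0) : ℂ⟦X⟧)
          * rescale (-1) (PowerSeries.mk b)
        + (reflectNeg (2 * k.numBeta + k.numAlpha) (P t 0 1) : ℂ⟦X⟧))
      - PowerSeries.mk b * ((reflectNeg (2 * k.numBeta + k.numAlpha) (P t 1 0) : ℂ⟦X⟧)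
          * rescale (-1) (PowerSeries.mk b)
        + (reflectNeg (2 * k.numBeta + k.numAlpha) (P t 1 1) : ℂ⟦X⟧)) = 0)
    (hreal : ∀ x : ℝ, scatA k w (reflK k (P t)) x ≠ 0) :
    Continuous (fun x : ℝ => Real.log (‖scatA k w (reflK k (P t)) x‖ ^ 2)) ∧
    ∀ n : ℕ, (fun x : ℝ => (Real.log (‖scatA k w (reflK k (P t)) x‖ ^ 2) : ℂ))
      =O[Bornology.cobounded ℝ] fun x => (x : ℂ)⁻¹ ^ n := by
  have hcont : Continuous fun x : ℝ => scatA k w (reflK k (P t)) x :=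
    (continuousOn_scatA hw hC hbeta halpha).comp_continuous (by fun_prop) fun x => by simp
  refine ⟨(hcont.norm.pow 2).log fun x => pow_ne_zero _ (norm_ne_zero_iff.2 (hreal x)), fun n => ?_⟩
  set l := Bornology.cobounded ℝ
  have hN := scatN_isBigO hb (hP.natDegree_le t ht) hgauge
  have hinv : Tendsto (fun x : ℝ => (x : ℂ)⁻¹) l (𝓝 0) :=
    (tendsto_inv_cobounded_inf univ).comp (tendsto_ofReal_cobounded_inf fun x => mem_univ _)
  -- The row relation replaces `1 - |A|²` by the square of the off-diagonal entry, which the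
  -- boundary condition has shown to be of every order.
  have h1 (x : ℝ) : ‖scatA k w (reflK k (P t)) x‖ ^ 2 = 1 - ‖scatN w (reflK k (P t)) x‖ ^ 2 := by
    linarith [(scattering_relations hP hbeta halpha ht hw hC x).2.1]
  simp_rw [h1]
  have hN0 : Tendsto (fun x : ℝ => scatN w (reflK k (P t)) x) l (𝓝 0) := by
    exact (hN 1).trans_tendsto (hinv.congr fun x => (pow_one _).symm)
  have h2 : Tendsto (fun x => 1 - ‖scatN w (reflK k (P t)) x‖ ^ 2) l (𝓝 1) := by
    simpa using (hN0.norm.pow 2).const_sub 1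
  have h3 := (Real.differentiableAt_log one_ne_zero).isBigO_sub.comp_tendsto h2
  have h4 : (fun x : ℝ => Real.log (1 - ‖scatN w (reflK k (P t)) x‖ ^ 2)) =O[l]
      fun x => scatN w (reflK k (P t)) x := by
    refine (h3.congr_left (f₂ := fun x => Real.log (1 - ‖scatN w (reflK k (P t)) x‖ ^ 2))
      fun x => by simp).trans ?_
    have h5 := ((hN0.isBigO_one ℂ).mul (isBigO_refl (fun x => scatN w (reflK k (P t)) x) l))
    refine (isBigO_of_le _ fun x => ?_).trans (h5.congr_right fun x => one_mul _)
    simp [sq]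
  refine (IsBigO.of_norm_left ?_).trans (hN n)
  simpa [Complex.norm_real] using h4.norm_left

end ScatteringDecay

/-! ### Expansion of the Blaschke product and of the integral; transfer between domains. -/

section Asymptotics

open MeasureTheory Set Filter
open Asymptotics hiding IsLittleOTVS

namespace HasExpansion

variable {X : Type*} {l : Filter X} {h f : X → ℂ} {n : ℕ} {F : ℂ → ℂ}

theorem cexp (hf : HasExpansion l h f n F) (hn : n ≠ 0) (hh : Tendsto h l (𝓝 0)) :
    HasExpansion l h (fun x => Complex.exp (f x)) n (fun y => Complex.exp (F y)) := by
  refine ⟨hf.1.cexp', ?_⟩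
  have h1 : Tendsto (fun x => (f x, F (h x))) l (𝓝 (F 0, F 0)) :=
    (hf.tendsto hn hh).prodMk_nhds (hf.1.continuousAt.tendsto.comp hh)
  have h2 := (Complex.hasStrictDerivAt_exp (F 0)).hasStrictFDerivAt.isBigO_sub.comp_tendsto h1
  exact h2.trans hf.2

theorem finset_prod {ι : Type*} (s : Finset ι) {f : ι → X → ℂ} {F : ι → ℂ → ℂ}
    (hf : ∀ i, HasExpansion l h (f i) n (F i)) (hh : Tendsto h l (𝓝 0)) :
    HasExpansion l h (fun x => ∏ i ∈ s, f i x) n (fun y => ∏ i ∈ s, F i y) := by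
  classical
  induction s using Finset.induction_on with
  | empty => simpa using of_eq (F := fun _ => 1) (by fun_prop) h n (.of_forall fun _ => rfl)
  | insert i s his ih =>
    simp only [Finset.prod_insert his]
    exact (hf i).mul ih hh

end HasExpansion

/-- The summand `k = 0` has denominator `0` and is therefore `0`; the rest is the Taylor polynomial
of the logarithm. -/
theorem hasExpansion_log_one_sub {X : Type*} {l : Filter X} {h : X → ℂ} (hh : Tendsto h l (𝓝 0))
    (a : ℂ) (n : ℕ) : HasExpansion l h (fun x => Complex.log (1 - a * h x)) (n + 1)
      (fun y => -∑ k ∈ Finset.range (n + 1), a ^ k * y ^ k / k) := by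
  refine ⟨by fun_prop, .of_bound (‖a‖ ^ (n + 1) * 2) ?_⟩
  have h1 : Tendsto (fun x => ‖-(a * h x)‖) l (𝓝 0) := by simpa using (hh.const_mul a).neg.norm
  filter_upwards [h1.eventually (gt_mem_nhds (show (0 : ℝ) < 1 / 2 by norm_num))] with x hx
  have h2 := Complex.norm_log_sub_logTaylor_le n (hx.trans (by norm_num))
  have h3 : Complex.logTaylor (n + 1) (-(a * h x))
      = -∑ k ∈ Finset.range (n + 1), a ^ k * h x ^ k / k := by
    rw [Complex.logTaylor, ← Finset.sum_neg_distrib]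
    refine Finset.sum_congr rfl fun k _ => ?_
    have h4 : (-1 : ℂ) ^ (k + 1) * (-(a * h x)) ^ k = -(a ^ k * h x ^ k) := by
      rw [pow_succ, mul_right_comm, ← mul_pow, ← mul_pow]
      simp
    rw [h4, neg_div]
  rw [h3, ← sub_eq_add_neg] at h2
  refine h2.trans ?_
  have h5 : (1 - ‖-(a * h x)‖)⁻¹ ≤ 2 := by
    rw [show (2 : ℝ) = (1 / 2)⁻¹ by norm_num]
    gcongr
    linarith
  have h6 : ‖-(a * h x)‖ ^ (n + 1) = ‖a‖ ^ (n + 1) * ‖h x ^ (n + 1)‖ := by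
    rw [norm_neg, norm_mul, mul_pow, norm_pow]
  rw [h6]
  calc ‖a‖ ^ (n + 1) * ‖h x ^ (n + 1)‖ * (1 - ‖-(a * h x)‖)⁻¹ / (n + 1)
      ≤ ‖a‖ ^ (n + 1) * ‖h x ^ (n + 1)‖ * (1 - ‖-(a * h x)‖)⁻¹ := by
        refine div_le_self ?_ (by linarith [(Nat.cast_nonneg n : (0 : ℝ) ≤ n)])
        have : 0 ≤ (1 - ‖-(a * h x)‖)⁻¹ := inv_nonneg.2 (by linarith)
        positivity
    _ ≤ ‖a‖ ^ (n + 1) * ‖h x ^ (n + 1)‖ * 2 := by gcongr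
    _ = _ := by ring

theorem hasExpansion_blaschke {X : Type*} {l : Filter X} {z : X → ℂ} (hz : Tendsto (fun x => (z x)⁻¹) l (𝓝 0))
    (hz0 : ∀ᶠ x in l, z x ≠ 0) {ι : Type*} [Fintype ι] (a : ι → ℂ) (n : ℕ) :
    HasExpansion l (fun x => (z x)⁻¹) (fun x => ∏ i, (z x - a i) / (z x - conj (a i))) (n + 1)
      (fun y => Complex.exp (∑ k ∈ Finset.range (n + 1),
        (∑ i, (conj (a i) ^ k - a i ^ k)) / k * y ^ k)) := by
  have h1 (i : ι) : HasExpansion l (fun x => (z x)⁻¹) (fun x => (z x - a i) / (z x - conj (a i)))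
      (n + 1) (fun y => Complex.exp (∑ k ∈ Finset.range (n + 1),
        (conj (a i) ^ k - a i ^ k) / k * y ^ k)) := by
    have h2 := ((hasExpansion_log_one_sub hz (a i) n).add
      (hasExpansion_log_one_sub hz (conj (a i)) n).neg).cexp n.succ_ne_zero hz
    have h3 (c : ℂ) : ∀ᶠ x in l, 1 - c * (z x)⁻¹ ≠ 0 := by
      have : Tendsto (fun x => 1 - c * (z x)⁻¹) l (𝓝 1) := by
        simpa using (hz.const_mul c).const_sub 1
      exact this.eventually_ne one_ne_zero
    refine ⟨by fun_prop, h2.2.congr' ?_ .rfl⟩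
    filter_upwards [h3 (a i), h3 (conj (a i)), hz0] with x hx1 hx2 hx0
    rw [Complex.exp_add, Complex.exp_neg, Complex.exp_log hx1, Complex.exp_log hx2]
    congr 1
    · have h4 (c : ℂ) : z x - c = z x * (1 - c * (z x)⁻¹) := by field_simp
      rw [h4 (a i), h4 (conj (a i)), mul_div_mul_left _ _ hx0, div_eq_mul_inv]
    · congr 1
      rw [neg_neg, neg_add_eq_sub, ← Finset.sum_sub_distrib]
      refine Finset.sum_congr rfl fun k _ => ?_
      ring
  have h2 := HasExpansion.finset_prod Finset.univ h1 hz
  refine ⟨by fun_prop, h2.2.congr_left fun x => ?_⟩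
  rw [← Complex.exp_sum, Finset.sum_comm]
  congr 2
  refine Finset.sum_congr rfl fun k _ => ?_
  rw [← Finset.sum_mul, Finset.sum_div]

/-- Unless it vanishes near `0`, an analytic `D` is `y ^ m` times a factor not vanishing at `0`. A
bound of order `n` along any nonzero quantity tending to `0` already forces `m ≥ n`. -/
theorem isBigO_pow_of_tendsto {X : Type*} {l : Filter X} [l.NeBot] {h : X → ℂ}
    (hh : Tendsto h l (𝓝 0)) (h0 : ∀ᶠ x in l, h x ≠ 0) {D : ℂ → ℂ} (hD : AnalyticAt ℂ D 0) {n : ℕ}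
    (hO : (fun x => D (h x)) =O[l] fun x => h x ^ n) : D =O[𝓝 0] fun y => y ^ n := by
  by_cases hz : ∀ᶠ y in 𝓝 0, D y = 0
  · exact (isBigO_zero _ _).congr' (hz.mono fun y hy => hy.symm) .rfl
  obtain ⟨m, g, hg, hg0, hgD⟩ := hD.exists_eventuallyEq_pow_smul_nonzero_iff.2 hz
  simp only [sub_zero, smul_eq_mul] at hgD
  rcases le_or_gt n m with hnm | hnm
  · refine IsBigO.congr' (f₁ := fun y => y ^ n * (y ^ (m - n) * g y)) (g₁ := fun y => y ^ n * 1)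
      ((isBigO_refl _ _).mul ?_) (hgD.mono fun y hy => ?_) (.of_forall fun y => mul_one _)
    · exact Tendsto.isBigO_one ℂ ((continuous_pow (m - n)).continuousAt.mul hg.continuousAt).tendsto
    · dsimp only
      rw [hy, ← mul_assoc, ← pow_add, Nat.add_sub_cancel' hnm]
  · exfalso
    have h1 : (fun x => g (h x)) =O[l] fun x => h x ^ (n - m) := by
      have h2 := (isBigO_refl (fun x => (h x ^ m)⁻¹) l).mul hO
      refine h2.congr' ?_ ?_
      · filter_upwards [h0, hh.eventually hgD] with x hx hx'
        rw [hx']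
        field_simp
      · filter_upwards [h0] with x hx
        rw [← Nat.add_sub_cancel' hnm.le, pow_add, Nat.add_sub_cancel_left]
        field_simp
    have h2 : Tendsto (fun x => h x ^ (n - m)) l (𝓝 0) := by
      simpa [Nat.sub_ne_zero_of_lt hnm] using hh.pow (n - m)
    exact hg0 (tendsto_nhds_unique (hg.continuousAt.tendsto.comp hh) (h1.trans_tendsto h2))

/-- Two expansions of the same order of a function agree up to terms of this order, and one of
them holding in a larger domain, so does the other. -/
theorem HasExpansion.transfer {X Y : Type*} {l : Filter X} {l' : Filter Y} [l'.NeBot] {h : X → ℂ}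
    {f : X → ℂ} {n : ℕ} {F G : ℂ → ℂ} (hf : HasExpansion l h f n F) (hh : Tendsto h l (𝓝 0))
    {φ : Y → X} (hφ : Tendsto φ l' l) (h0 : ∀ᶠ y in l', h (φ y) ≠ 0)
    (hg : HasExpansion l' (h ∘ φ) (f ∘ φ) n G) : HasExpansion l h f n G := by
  have h1 : (fun y => (G - F) ((h ∘ φ) y)) =O[l'] fun y => (h ∘ φ) y ^ n :=
    ((hf.2.comp_tendsto hφ).sub hg.2).congr_left fun y => by simp
  have h2 := (isBigO_pow_of_tendsto (hh.comp hφ) h0 (hg.1.sub hf.1) h1).comp_tendsto hh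
  exact ⟨hg.1, (hf.2.sub h2).congr_left fun x => by simp⟩

/-- For `z = i y` the ratio `x² / z²` is real and nonpositive, so the remainder of the geometric
series is bounded by its first omitted term, uniformly in `x`. Near the real axis the kernel has no
such bound, hence the restriction to this ray. -/
theorem hasExpansion_integral {ρ : ℝ → ℝ} (hρ : Continuous ρ)
    (hdecay : ∀ n : ℕ, (fun x : ℝ => (ρ x : ℂ)) =O[Bornology.cobounded ℝ] fun x => (x : ℂ)⁻¹ ^ n)
    (hint : ∀ z : ℂ, 0 < z.im →
      IntegrableOn (fun x : ℝ => z * (ρ x : ℂ) / ((x : ℂ) ^ 2 - z ^ 2)) (Ioi 0)) (n : ℕ) :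
    (∀ m : ℕ, Integrable fun x : ℝ => (ρ x : ℂ) * (x : ℂ) ^ m) ∧
    HasExpansion atTop (fun y : ℝ => (Complex.I * y)⁻¹)
      (fun y => ∫ x in Ioi (0 : ℝ), Complex.I * y * (ρ x : ℂ) / ((x : ℂ) ^ 2 - (Complex.I * y) ^ 2))
      (2 * n + 1) (fun y => -∑ j ∈ Finset.range n,
        (∫ x in Ioi (0 : ℝ), (ρ x : ℂ) * (x : ℂ) ^ (2 * j)) * y ^ (2 * j + 1)) := by
  have hmom (m : ℕ) : Integrable fun x : ℝ => (ρ x : ℂ) * (x : ℂ) ^ m := by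
    refine integrable_of_isBigO_inv_sq (by fun_prop) ?_
    refine ((hdecay (m + 2)).mul (isBigO_refl (fun x : ℝ => (x : ℂ) ^ m) _)).congr' .rfl ?_
    filter_upwards [Bornology.eventually_ne_cobounded 0] with x hx
    have : (x : ℂ) ≠ 0 := by simpa using hx
    rw [add_comm m, pow_add, mul_assoc, ← mul_pow, inv_mul_cancel₀ this, one_pow, mul_one]
  refine ⟨hmom, by fun_prop, .of_bound (∫ x in Ioi (0 : ℝ), ‖(ρ x : ℂ) * (x : ℂ) ^ (2 * n)‖) ?_⟩
  filter_upwards [eventually_gt_atTop 0] with y hy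
  set z : ℂ := Complex.I * y
  have hz : 0 < z.im := by simpa [z] using hy
  have hz0 : z ≠ 0 := by intro h; simp [h] at hz
  have h1 : (∫ x in Ioi (0 : ℝ), z * (ρ x : ℂ) / ((x : ℂ) ^ 2 - z ^ 2))
      - -∑ j ∈ Finset.range n, (∫ x in Ioi (0 : ℝ), (ρ x : ℂ) * (x : ℂ) ^ (2 * j)) * z⁻¹ ^ (2 * j + 1)
      = ∫ x in Ioi (0 : ℝ), (z * (ρ x : ℂ) / ((x : ℂ) ^ 2 - z ^ 2)
        + ∑ j ∈ Finset.range n, (ρ x : ℂ) * (x : ℂ) ^ (2 * j) * z⁻¹ ^ (2 * j + 1)) := by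
    rw [integral_add (hint z hz) (integrable_finsetSum _ fun j _ =>
      ((hmom (2 * j)).mul_const _).integrableOn), integral_finsetSum _ fun j _ =>
      ((hmom (2 * j)).mul_const _).integrableOn, sub_neg_eq_add]
    congr 1
    refine Finset.sum_congr rfl fun j _ => ?_
    rw [integral_mul_const]
  rw [h1, ← integral_mul_const]
  refine norm_integral_le_of_norm_le ((hmom (2 * n)).norm.mul_const _).integrableOn
    (.of_forall fun x => ?_)
  have h2 : (x : ℂ) ^ 2 * z⁻¹ ^ 2 = ((-(x / y) ^ 2 : ℝ) : ℂ) := by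
    have hy' : (y : ℂ) ≠ 0 := by exact_mod_cast hy.ne'
    simp only [z]
    push_cast
    rw [mul_inv, mul_pow, Complex.inv_I, neg_sq, Complex.I_sq]
    field_simp
  have h3 : ((x : ℂ) ^ 2 * z⁻¹ ^ 2) - 1 ≠ 0 := by
    rw [h2]
    norm_cast
    nlinarith [sq_nonneg (x / y)]
  have h4 : (x : ℂ) ^ 2 - z ^ 2 = z ^ 2 * (((x : ℂ) ^ 2 * z⁻¹ ^ 2) - 1) := by field_simp
  -- Exact geometric remainder after `n` terms. The factor `(x² z⁻² - 1)⁻¹` has norm at most `1`,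
  -- and the rest is the moment of order `2 n` times `z⁻¹ ^ (2 n + 1)`.
  have h5 : z * (ρ x : ℂ) / ((x : ℂ) ^ 2 - z ^ 2)
        + ∑ j ∈ Finset.range n, (ρ x : ℂ) * (x : ℂ) ^ (2 * j) * z⁻¹ ^ (2 * j + 1)
      = (ρ x : ℂ) * (x : ℂ) ^ (2 * n) * z⁻¹ ^ (2 * n + 1) * (((x : ℂ) ^ 2 * z⁻¹ ^ 2) - 1)⁻¹ := by
    have h6 : ∑ j ∈ Finset.range n, (ρ x : ℂ) * (x : ℂ) ^ (2 * j) * z⁻¹ ^ (2 * j + 1)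
        = ρ x * z⁻¹ * ∑ j ∈ Finset.range n, ((x : ℂ) ^ 2 * z⁻¹ ^ 2) ^ j := by
      rw [Finset.mul_sum]
      refine Finset.sum_congr rfl fun j _ => ?_
      ring
    have h7 : (x : ℂ) ^ (2 * n) * z⁻¹ ^ (2 * n + 1) = ((x : ℂ) ^ 2 * z⁻¹ ^ 2) ^ n * z⁻¹ := by ring
    rw [h6, geom_sum_eq (sub_ne_zero.1 h3), h4, mul_assoc (ρ x : ℂ) (_ ^ _), h7]
    generalize (x : ℂ) ^ 2 * z⁻¹ ^ 2 = q at h3 ⊢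
    field_simp
    ring
  rw [h5, norm_mul, norm_mul]
  refine mul_le_of_le_one_right (by positivity) ?_
  rw [norm_inv, h2]
  refine inv_le_one_of_one_le₀ ?_
  rw [← Complex.ofReal_one, ← Complex.ofReal_sub, Complex.norm_real, Real.norm_eq_abs, abs_sub_comm]
  refine le_trans ?_ (le_abs_self _)
  nlinarith [sq_nonneg (x / y)]

end Asymptotics

/-! ### The symmetric family of zeros and the coefficients `I_{2j}`. -/

section TraceIdentities

open MeasureTheory Set Filter
open Asymptotics hiding IsLittleOTVS

theorem scatA_congr (k : KappaData) (K : ℂ → Matrix (Fin 2) (Fin 2) ℂ) {u w : ℝ → ℂ}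
    (h : ∀ x, 0 ≤ x → u x = w x) : scatA k u K = scatA k w K := by
  funext z
  simp only [scatA, monodromy, halfLineTransition_congr h, halfLineTransitionInv_congr h]

theorem scatB_congr (k : KappaData) (K : ℂ → Matrix (Fin 2) (Fin 2) ℂ) {u w : ℝ → ℂ}
    (h : ∀ x, 0 ≤ x → u x = w x) : scatB k u K = scatB k w K := by
  funext z
  simp only [scatB, monodromy, halfLineTransition_congr h, halfLineTransitionInv_congr h]

variable {N M : ℕ}

/-- The family of the zeros `r_j`, `-r_j^*`, `i s_ℓ`. -/
def zeroFamily (r : Fin N → ℂ) (s : Fin M → ℝ) : (Fin N ⊕ Fin N) ⊕ Fin M → ℂ :=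
  Sum.elim (Sum.elim r fun j => -conj (r j)) fun l => Complex.I * s l

theorem range_zeroFamily (r : Fin N → ℂ) (s : Fin M → ℝ) : range (zeroFamily r s) =
    range r ∪ range (fun j => -conj (r j)) ∪ range (fun l => Complex.I * (s l : ℂ)) := by
  rw [zeroFamily, Sum.elim_range, Sum.elim_range]

theorem injective_zeroFamily {r : Fin N → ℂ} {s : Fin M → ℝ} (hr : ∀ j, (r j).re ≠ 0)
    (hinj : Function.Injective r) (hpair : ∀ i j, r i ≠ -conj (r j)) (hs : Function.Injective s) :
    Function.Injective (zeroFamily r s) := by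
  refine Function.Injective.sumElim (Function.Injective.sumElim hinj ?_ hpair) ?_ ?_
  · intro i j h
    exact hinj ((starRingEnd ℂ).injective (neg_injective h))
  · intro i j h
    exact hs (by simpa using h)
  · rintro (i | i) j h
    · exact hr i (by simpa using congrArg Complex.re h)
    · exact hr i (by simpa using congrArg Complex.re h)

theorem prod_zeroFamily (r : Fin N → ℂ) (s : Fin M → ℝ) (z : ℂ) :
    ∏ i, (z - zeroFamily r s i) / (z - conj (zeroFamily r s i)) = zetaFactor r s z := by
  simp [Fintype.prod_sum_type, zeroFamily, zetaFactor, Finset.prod_mul_distrib, mul_div_mul_comm]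

/-- Conjugation followed by a change of sign permutes the zeros, and even powers do not see the
sign. Hence only odd powers of `1/z` occur. -/
theorem sum_zeroFamily_even (r : Fin N → ℂ) (s : Fin M → ℝ) (j : ℕ) :
    ∑ i, (conj (zeroFamily r s i) ^ (2 * j) - zeroFamily r s i ^ (2 * j)) = 0 := by
  have h (x : ℂ) : (-x) ^ (2 * j) = x ^ (2 * j) := Even.neg_pow (even_two_mul j) x
  simp [Fintype.sum_sum_type, zeroFamily, h]
  ring

theorem sum_zeroFamily_odd (r : Fin N → ℂ) (s : Fin M → ℝ) (j : ℕ) :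
    ∑ i, (conj (zeroFamily r s i) ^ (2 * j + 1) - zeroFamily r s i ^ (2 * j + 1))
      = 2 * ∑ l, (conj (r l) ^ (2 * j + 1) - r l ^ (2 * j + 1))
        - 2 * ∑ l, (Complex.I * (s l : ℂ)) ^ (2 * j + 1) := by
  have h (x : ℂ) : (-x) ^ (2 * j + 1) = -x ^ (2 * j + 1) := Odd.neg_pow (odd_two_mul_add_one j) x
  simp only [Fintype.sum_sum_type, zeroFamily, Sum.elim_inl, Sum.elim_inr, map_neg,
    Complex.conj_conj, map_mul, Complex.conj_I, Complex.conj_ofReal, neg_mul, h]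
  simp only [Finset.sum_sub_distrib, Finset.sum_neg_distrib]
  ring

theorem sum_range_two_mul_add_one {f : ℕ → ℂ} (hf : ∀ j, f (2 * j) = 0) (n : ℕ) :
    ∑ k ∈ Finset.range (2 * n + 1), f k = ∑ j ∈ Finset.range n, f (2 * j + 1) := by
  induction n with
  | zero => simpa using hf 0
  | succ n ih =>
    rw [show 2 * (n + 1) + 1 = (2 * n + 1) + 1 + 1 by ring, Finset.sum_range_succ,
      Finset.sum_range_succ, ih, Finset.sum_range_succ, show 2 * n + 1 + 1 = 2 * (n + 1) by ring, hf,
      add_zero]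

/-- Each term of the trace expansion separates into the Taylor term of the logarithm of the Blaschke
product and the moment term of the integral. The contribution of `s l` has a plus sign in `I_{2j}`
because `(2i) (i s) = -2 s` is raised to an odd power. -/
theorem traceCoeff_div (B : ℝ → ℂ) (r : Fin N → ℂ) (s : Fin M → ℝ) (j : ℕ) (y : ℂ) :
    traceCoeff B r s j / (2 * Complex.I) ^ (2 * j + 1) * y ^ (2 * j + 1)
      = (∑ i, (conj (zeroFamily r s i) ^ (2 * j + 1) - zeroFamily r s i ^ (2 * j + 1)))
          / ((2 * j + 1 : ℕ) : ℂ) * y ^ (2 * j + 1)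
        - 1 / (Complex.I * Real.pi) * ((∫ x in Ioi (0 : ℝ),
          (Real.log (1 - ‖B x‖ ^ 2) : ℂ) * (x : ℂ) ^ (2 * j)) * y ^ (2 * j + 1)) := by
  have hI := Complex.I_ne_zero
  have hπ : (Real.pi : ℂ) ≠ 0 := by exact_mod_cast Real.pi_ne_zero
  have h2 : (2 * j + 1 : ℂ) ≠ 0 := by exact_mod_cast (2 * j).succ_ne_zero
  have h0 : (2 * Complex.I) ^ (2 * j + 1) ≠ 0 := pow_ne_zero _ (by simp)
  have h3 : ∫ x in Ioi (0 : ℝ), (Real.log (1 - ‖B x‖ ^ 2) : ℂ) * (2 * Complex.I * x) ^ (2 * j)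
      = (2 * Complex.I) ^ (2 * j) * ∫ x in Ioi (0 : ℝ),
          (Real.log (1 - ‖B x‖ ^ 2) : ℂ) * (x : ℂ) ^ (2 * j) := by
    rw [← integral_const_mul]
    congr 1
    funext x
    rw [mul_pow (2 * Complex.I)]
    ring
  have h4 (x : ℂ) : (2 * Complex.I * x) ^ (2 * j + 1)
      = (2 * Complex.I) ^ (2 * j + 1) * x ^ (2 * j + 1) := mul_pow _ _ _
  have h5 (x : ℝ) : (2 * (x : ℂ)) ^ (2 * j + 1)
      = -((2 * Complex.I) ^ (2 * j + 1) * (Complex.I * x) ^ (2 * j + 1)) := by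
    rw [← mul_pow, ← Odd.neg_pow (odd_two_mul_add_one j)]
    congr 1
    linear_combination (2 * (x : ℂ)) * Complex.I_mul_I
  rw [traceCoeff, sum_zeroFamily_odd, h3]
  simp only [h4, h5, ← mul_sub, ← Finset.sum_div, ← Finset.mul_sum, Finset.sum_neg_distrib]
  rw [pow_succ (2 * Complex.I)] at h0 ⊢
  have h6 : (2 * Complex.I) ^ (2 * j) ≠ 0 := left_ne_zero_of_mul h0
  generalize (2 * Complex.I) ^ (2 * j) = c at h6 ⊢
  push_cast
  field_simp
  ring

/-- Passing to the logarithm in an expansion whose leading term is `1`. -/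
theorem HasExpansion.log_sub_isBigO {X : Type*} {l : Filter X} {h f : X → ℂ} {n : ℕ} {S : ℂ → ℂ}
    (hf : HasExpansion l h f n fun y => Complex.exp (S y)) (hn : n ≠ 0) (hh : Tendsto h l (𝓝 0))
    (hS : ContinuousAt S 0) (hS0 : S 0 = 0) :
    (fun x => Complex.log (f x) - S (h x)) =O[l] fun x => h x ^ n := by
  have h0 : Tendsto (fun x => S (h x)) l (𝓝 0) := by
    have := hS.tendsto.comp hh
    rwa [hS0] at this
  have h1 : Tendsto (fun x => (f x, Complex.exp (S (h x)))) l (𝓝 (1, 1)) := by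
    refine Tendsto.prodMk_nhds ?_ ?_
    · simpa [hS0] using hf.tendsto hn hh
    · simpa [Function.comp_def] using (Complex.continuous_exp.tendsto _).comp h0
  have h2 := ((Complex.hasStrictDerivAt_log
    Complex.one_mem_slitPlane).hasStrictFDerivAt.isBigO_sub.comp_tendsto h1).trans hf.2
  refine h2.congr' ?_ .rfl
  have h3 : Tendsto (fun x => ‖S (h x)‖) l (𝓝 0) := by simpa using h0.norm
  filter_upwards [h3.eventually (gt_mem_nhds Real.pi_pos)] with x hx
  have h4 := abs_lt.1 ((Complex.abs_im_le_norm _).trans_lt hx)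
  simp only [Function.comp_apply]
  rw [Complex.log_exp h4.1 h4.2.le]

theorem IsHalfLineSchwartz.exists_extension {u : ℝ → ℂ} (hu : IsHalfLineSchwartz u) :
    Continuous (fun x => u (max x 0)) ∧
      ∃ C : ℝ, ∀ x, 0 ≤ x → (1 + x ^ 2) * ‖u (max x 0)‖ ≤ C := by
  refine ⟨hu.1.continuousOn.comp_continuous (by fun_prop)
    fun x => mem_Ici.2 (le_max_right _ _), ?_⟩
  obtain ⟨C₀, h0⟩ := hu.2 0 0
  obtain ⟨C₂, h2⟩ := hu.2 2 0
  refine ⟨C₀ + C₂, fun x hx => ?_⟩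
  have h0 := h0 x hx
  have h2 := h2 x hx
  rw [iteratedDerivWithin_zero] at h0 h2
  rw [max_eq_left hx]
  linarith

end TraceIdentities

end NLSHalfLine

end

/-! ### Assembly of the trace identities. -/

theorem mainTheorem3
    (k : NLSHalfLine.KappaData)
    (hbeta : ∀ j, (k.beta j).im < 0) (halpha : ∀ l, k.alpha l < 0)
    (J : Set ℝ) (hJ : J.OrdConnected) (hJ' : J.Nontrivial) (t₀ : ℝ) (ht₀ : t₀ ∈ J)
    (q : ℝ → ℝ → ℂ) (hq : NLSHalfLine.IsNLSSolution J q)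
    (hq₀ : NLSHalfLine.IsHalfLineSchwartz (fun x => q x t₀))
    (P : ℝ → Matrix (Fin 2) (Fin 2) (Polynomial ℂ))
    (hP : NLSHalfLine.IsReflectionFamily k J (fun t => q 0 t)
      (fun t => derivWithin (fun x => q x t) (Set.Ici 0) 0) P)
    (A : ℂ → ℂ)
    (hA : A = NLSHalfLine.scatA k (fun x => q x t₀) (NLSHalfLine.reflK k (P t₀)))
    (B : ℝ → ℂ)
    (hB : B = NLSHalfLine.scatB k (fun x => q x t₀) (NLSHalfLine.reflK k (P t₀)))
    (N M : ℕ) (r : Fin N → ℂ) (s : Fin M → ℝ)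
    (hr_re : ∀ j, (r j).re ≠ 0) (hr_im : ∀ j, 0 < (r j).im)
    (hr_inj : Function.Injective r) (hr_pair : ∀ i j, r i ≠ -conj (r j))
    (hs_pos : ∀ l, 0 < s l) (hs_inj : Function.Injective s)
    (hA_real : ∀ x : ℝ, A x ≠ 0)
    (hA_zeros : {z : ℂ | 0 < z.im ∧ A z = 0} =
      Set.range r ∪ Set.range (fun j => -conj (r j)) ∪ Set.range (fun l => Complex.I * (s l : ℂ)))
    (hA_simple : ∀ z : ℂ, 0 < z.im → A z = 0 → deriv A z ≠ 0) :
    (DifferentiableOn ℂ A {z : ℂ | 0 < z.im} ∧ ContinuousOn A {z : ℂ | 0 ≤ z.im}) ∧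
    (∀ x : ℝ, ‖B x‖ < 1) ∧
    (∀ z : ℂ, 0 < z.im →
      MeasureTheory.IntegrableOn
        (fun x : ℝ => z * (Real.log (1 - ‖B x‖ ^ 2) : ℂ) / ((x : ℂ) ^ 2 - z ^ 2)) (Set.Ioi 0) ∧
      A z = NLSHalfLine.zetaFactor r s z *
        Complex.exp (1 / (Complex.I * Real.pi) *
          ∫ x in Set.Ioi (0 : ℝ),
            z * (Real.log (1 - ‖B x‖ ^ 2) : ℂ) / ((x : ℂ) ^ 2 - z ^ 2))) ∧
    (∀ j : ℕ, MeasureTheory.IntegrableOn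
      (fun x : ℝ => (Real.log (1 - ‖B x‖ ^ 2) : ℂ) * (2 * Complex.I * x) ^ (2 * j))
      (Set.Ioi 0)) ∧
    (∀ n : ℕ, Asymptotics.IsBigO
      (Bornology.cobounded ℂ ⊓ Filter.principal {z : ℂ | 0 < z.im})
      (fun z : ℂ => Complex.log (A z) - ∑ j ∈ Finset.range n,
        NLSHalfLine.traceCoeff B r s j / (2 * Complex.I * z) ^ (2 * j + 1))
      (fun z : ℂ => (z ^ (2 * n + 1))⁻¹)) := by
  open NLSHalfLine MeasureTheory Set Filter in
  obtain ⟨hw, C, hC⟩ := hq₀.exists_extension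
  -- The field is extended to the negative axis by its value at `0`, so that continuity holds on all
  -- of `ℝ`; the scattering functions are unaffected.
  set w : ℝ → ℂ := fun x => q (max x 0) t₀ with hw_def
  have huw : ∀ x, 0 ≤ x → q x t₀ = w x := fun x hx => by rw [hw_def]; simp [hx]
  rw [scatA_congr k _ huw] at hA
  rw [scatB_congr k _ huw] at hB
  obtain ⟨a, a', ha0, had, ha', hab, hgauge⟩ :=
    exists_riccati_coefficients hbeta halpha hJ hJ' ht₀ hq hq₀ hP
  have hb : HasJostExpansion w (a · 0) := fun n =>
    exists_jost_expansion hw hC ha0 had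
      (fun n x hx => by rw [← huw x hx]; exact ha' n x hx) hab n
  have hb0 : a 0 0 = 0 := ha0 0 (by simp)
  have hAc : ContinuousOn A {z | 0 ≤ z.im} := hA ▸ continuousOn_scatA hw hC hbeta halpha
  have hAd : DifferentiableOn ℂ A {z | 0 < z.im} := hA ▸ differentiableOn_scatA hw hC hbeta halpha
  have hrel := scattering_relations hP hbeta halpha ht₀ hw hC
  rw [← hA, ← hB] at hrel
  have hAB (x : ℝ) : 1 - ‖B x‖ ^ 2 = ‖A x‖ ^ 2 := by linarith [(hrel x).1]
  have hA1 := scatA_sub_one_isBigO hP ht₀ hw hC hb hb0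
  rw [← hA] at hA1
  obtain ⟨hρ, hdecay⟩ := log_scatA_decay hP hbeta halpha ht₀ hw hC hb hgauge (hA ▸ hA_real)
  rw [← hA] at hρ hdecay
  simp only [← hAB] at hρ hdecay
  have hrep (z : ℂ) (hz : 0 < z.im) := eq_prod_mul_exp_integral hAc hAd hA1
    (injective_zeroFamily hr_re hr_inj hr_pair hs_inj)
    (hA_zeros.trans (range_zeroFamily r s).symm) hA_simple hA_real (fun x => (hrel x).2.2) hz
  simp only [← hAB, prod_zeroFamily] at hrep
  have hexp (n : ℕ) := hasExpansion_integral hρ hdecay (fun z hz => (hrep z hz).1) n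
  refine ⟨⟨hAd, hAc⟩, fun x => ?_, hrep, fun j => ?_, fun n => ?_⟩
  · have := norm_pos_iff.2 (hA_real x)
    rw [← sq_lt_one_iff₀ (norm_nonneg _)]
    nlinarith [hAB x]
  · refine (((hexp 0).1 (2 * j)).const_mul ((2 * Complex.I) ^ (2 * j))).integrableOn.congr
      (.of_forall fun x => ?_)
    simp only [mul_pow (2 * Complex.I)]
    ring
  set l := Bornology.cobounded ℂ ⊓ Filter.principal {z : ℂ | 0 ≤ z.im} with hl_def
  have hinv : Tendsto (fun z : ℂ => z⁻¹) l (𝓝 0) := tendsto_inv_cobounded_inf _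
  -- The imaginary ray on which the coefficients are determined.
  have hφ : Tendsto (fun y : ℝ => Complex.I * y) atTop l := by
    refine tendsto_inf.2 ⟨?_, tendsto_principal.2 ?_⟩
    · rw [← tendsto_norm_atTop_iff_cobounded]
      simpa using tendsto_abs_atTop_atTop
    · filter_upwards [eventually_ge_atTop 0] with y hy
      simpa using hy
  have hφ0 : ∀ᶠ y : ℝ in atTop, Complex.I * y ≠ 0 := by
    filter_upwards [eventually_ne_atTop 0] with y hy
    simpa using hy
  obtain ⟨F, hF⟩ := exists_hasExpansion_scatA hw hC hb (hP.natDegree_le t₀ ht₀) (2 * n + 1)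
  rw [← hA] at hF
  have hζ := hasExpansion_blaschke (hinv.comp hφ) hφ0 (zeroFamily r s) (2 * n)
  have hconst : HasExpansion atTop (fun y : ℝ => (Complex.I * y)⁻¹)
      (fun _ => 1 / (Complex.I * Real.pi)) (2 * n + 1) (fun _ => 1 / (Complex.I * Real.pi)) :=
    .of_eq analyticAt_const _ _ (.of_forall fun _ => rfl)
  have hI := (hconst.mul (hexp n).2 (hinv.comp hφ)).cexp (2 * n).succ_ne_zero (hinv.comp hφ)
  have hprod := hζ.mul hI (hinv.comp hφ)
  set S : ℂ → ℂ := fun y => ∑ j ∈ Finset.range n,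
    traceCoeff B r s j / (2 * Complex.I) ^ (2 * j + 1) * y ^ (2 * j + 1) with hS_def
  -- Along the ray, the Blaschke factor and the exponential of the integral combine into the
  -- exponential of one odd polynomial in `1/z`.
  have hS : HasExpansion atTop ((fun z : ℂ => z⁻¹) ∘ fun y : ℝ => Complex.I * y)
      (A ∘ fun y : ℝ => Complex.I * y) (2 * n + 1) (fun y => Complex.exp (S y)) := by
    refine ⟨by fun_prop, hprod.2.congr' ?_ .rfl⟩
    filter_upwards [eventually_gt_atTop 0] with y hy
    have h1 := (hrep (Complex.I * y) (by simpa using hy)).2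
    rw [prod_zeroFamily, Function.comp_apply, h1]
    congr 1
    rw [← Complex.exp_add]
    congr 1
    rw [sum_range_two_mul_add_one (fun j => by rw [sum_zeroFamily_even]; simp), hS_def]
    simp only [traceCoeff_div, Finset.sum_sub_distrib, ← Finset.mul_sum, Function.comp_apply]
    ring
  -- The expansion known to exist in the closed half-plane inherits the coefficients found on the
  -- ray. Since `A → 1`, the principal logarithm is the branch tending to `0`.
  have hfin := (hF.transfer hinv hφ (hφ0.mono fun y hy => inv_ne_zero hy) hS).log_sub_isBigO
    (2 * n).succ_ne_zero hinv (by fun_prop) (by simp [hS_def])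
  refine ((hfin.mono (inf_le_inf_left _ (principal_mono.2
    fun z (hz : 0 < z.im) => hz.le))).congr_left fun z => ?_).congr_right fun z => inv_pow _ _
  congr 1
  refine Finset.sum_congr rfl fun j _ => ?_
  rw [mul_pow (2 * Complex.I), inv_pow, ← div_eq_mul_inv, div_div]
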